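/- **Setting.** Let $K=\mathrm{SU}(2)$ and, for $\ell\in\tfrac12\mathbb N=\{0,\tfrac12,1,\dots\}$, let $H^\ell$ be the space of homogeneous polynomials of degree $2\ell$ in $x,y$, with orthonormal basis $\psi^\ell_j=\binom{2\ell}{\ell-j}^{1/2}x^{\ell-j}y^{\ell+j}$, $j=-\ell,-\ell+1,\dots,\ell$, and with the irreducible unitary representation $T^\ell(k)p=p\circ k^t$ of $K$. For $(\ell_1,\ell_2)$ with $|\ell_1-\ell_2|\le\ell\le\ell_1+\ell_2$ and $\ell_1+\ell_2-\ell\in\mathbb Z$ let $\beta:H^\ell\to H^{\ell_1}\otimes H^{\ell_2}$ be an isometric $K$-intertwiner (unique up to a phase) and put $$\Phi^\ell_{\ell_1,\ell_2}(k_1,k_2)=\beta^*\,(T^{\ell_1}(k_1)\otimes T^{\ell_2}(k_2))\,\beta .$$ Let $m_t=\mathrm{diag}(e^{it/2},e^{-it/2})$, $a_t=(m_t,m_{-t})$, $A_*=\{a_t:0\le t<4\pi\}$. For $d\in\mathbb N$ (including $d=0$) let $\Phi_d^\ell$ be the matrix function on $A_*$ with $$(\Phi^\ell_d(a))_{p,q}=\bigl(\Phi^\ell_{(d+\ell+p)/2,\,(d+\ell-p)/2}(a)\bigr)_{q,q},\qquad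 p,q\in\{-\ell,\dots,\ell\},$$ and put $Q^\ell_d(a_t)=\Phi^\ell_d(a_t)\Phi^\ell_0(a_t)^{-1}$ ($t\notin\pi\mathbb Z$) and $V^\ell(a_t)=\Phi_0^\ell(a_t)\Phi_0^\ell(a_t)^*\sin^2t$. Finally let $W$ be the $(2\ell+1)\times(2\ell+1)$ matrix function on $[-1,1]$ given by $$\sqrt{1-x^2}\;W(x)_{n,m}=V^\ell(a_{\arccos x})_{-\ell+n,-\ell+m},\qquad n,m\in\{0,\dots,2\ell\},$$ with $W(\pm1)=0$. A *weight* on $(-1,1)$ is an integrable $N\times N$ matrix function $w$ with finite moments of all orders that is positive definite almost everywhere. A *sequence of monic matrix-valued orthogonal polynomials (MVOPs)* for $w$ is a sequence $(P_d)_{d\ge0}$ of matrix polynomials, $P_d$ of degree $d$ with leading coefficient $I$, such that $\int_{-1}^1P_d(x)w(x)P_e(x)^*\,dx=0$ for $d\ne e$. A matrix function $w$ *reduces to a smaller size* if there are a constant nonsingular matrix $M$ and square blocks $w_1(x),w_2(x)$ of positive sizes with $w(x)=M\,\mathrm{diag}(w_1(x),w_2(x))\,M^*$ for all $x$. Let $I_n$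 be the identity and $J_n$ the antidiagonal identity matrix of size $n$, and let $$Y=\tfrac1{\sqrt2}\begin{pmatrix}I_{\ell+\frac12}&J_{\ell+\frac12}\\-J_{\ell+\frac12}&I_{\ell+\frac12}\end{pmatrix}\ (\ell\in\tfrac12+\mathbb N),\qquad Y=\tfrac1{\sqrt2}\begin{pmatrix}I_\ell&0&J_\ell\\0&\sqrt2&0\\-J_\ell&0&I_\ell\end{pmatrix}\ (\ell\in\mathbb N).$$ Let $Y_\ell$ be the matrix whose columns are the normalized vectors $\psi^\ell_j-\psi^\ell_{-j}$ ($j<0$), followed by the normalized vectors $\psi^\ell_j+\psi^\ell_{-j}$ ($j\ge0$), each group in increasing order of $j$; these are eigenvectors of $J:\psi^\ell_j\mapsto\psi^\ell_{-j}$ for the eigenvalues $-1$ and $+1$. **Theorem.** Let $\ell\in\tfrac12\mathbb N$. 1. $W$ is a weight, $Y$ is orthogonal, and for all $x\in[-1,1]$ $$\widetilde W(x)=YW(x)Y^t=\begin{pmatrix}W_1(x)&0\\0&W_2(x)\end{pmatrix},$$ with weights $W_1$ of size $\lfloor\ell\rfloor+1$ and $W_2$ of size $\lfloor\ell+\frac12\rfloor$.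 2. There is exactly one sequence of monic MVOPs for $W$. If $(P_{d,1})_d$ and $(P_{d,2})_d$ are sequences of monic MVOPs for $W_1$ and $W_2$, then $\mathrm{diag}(P_{d,1},P_{d,2})$, $d\ge0$, is a sequence of monic MVOPs for $\widetilde W$. Conversely, if $(P_d)_d$ is the sequence of monic MVOPs for $W$, then $YP_d(x)Y^t=\mathrm{diag}(P_{d,1}(x),P_{d,2}(x))$ for all $d$, where $(P_{d,i})_d$ is a sequence of monic MVOPs for $W_i$, $i=1,2$. 3. There is no further reduction: neither $W_1$ nor $W_2$ reduces to a smaller size. 4. On the group, $Y_\ell$ is orthogonal, and $$Y_\ell^{-1}Q_d^\ell(a_t)Y_\ell=\begin{pmatrix}Q^\ell_{d,-}(a_t)&0\\0&Q^\ell_{d,+}(a_t)\end{pmatrix}\ (d\ge0,\ t\notin\pi\mathbb Z),\qquad Y_\ell^{-1}V^\ell(a_t)Y_\ell=\begin{pmatrix}V^\ell_-(a_t)&0\\0&V^\ell_+(a_t)\end{pmatrix}\ (t\in\mathbb R),$$ with first blocks of size $\lfloor\ell+\frac12\rfloor$. For each sign, the family $(Q^\ell_{d,\pm})_{d\ge0}$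 is orthogonal for $V^\ell_\pm$: for $d\ne e$, $\int_0^{4\pi}Q^\ell_{d,\pm}(a_t)V^\ell_\pm(a_t)Q^\ell_{e,\pm}(a_t)^*\,dt$ exists and is $0$. Neither $V^\ell_-$ nor $V^\ell_+$ reduces to a smaller size. -/

import Mathlib

/- Throughout, `m : ℕ` stands for `2ℓ`, so that `ℓ = m / 2` runs through `½ℕ`, and an index
`n : Fin (m + 1)` stands for the weight `j = -ℓ + n ∈ {-ℓ, -ℓ + 1, …, ℓ}`. -/

namespace SphericalSU2

open Matrix MeasureTheory Set
open scoped ComplexOrder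

noncomputable section

/-! ### The groups -/

/-- `K = SU(2)`. -/
abbrev K : Type := Matrix.specialUnitaryGroup (Fin 2) ℂ

/-- `m_t = k(e^{it/2}, 0) ∈ K`. -/
def torus (t : ℝ) : K :=
  ⟨!![Complex.exp (Complex.I * (t / 2)), 0; 0, Complex.exp (-(Complex.I * (t / 2)))], by
    rw [Matrix.mem_specialUnitaryGroup_iff, Matrix.mem_unitaryGroup_iff]
    refine ⟨?_, ?_⟩
    · ext i j
      fin_cases i <;> fin_cases j <;>
        simp [Matrix.mul_apply, Fin.sum_univ_two, ← Complex.exp_conj, ← Complex.exp_add,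
          Complex.conj_ofReal, Complex.conj_ofNat]
    · simp [Matrix.det_fin_two, ← Complex.exp_add]⟩

/-- `a_t = (m_t, m_{-t}) ∈ U = K × K`; the group `A_*` is `{a_t : 0 ≤ t < 4π}`. -/
def aElt (t : ℝ) : K × K := (torus t, torus (-t))

/-! ### The irreducible representations of `K` -/

/-- The basis vector `ψ_j = (2ℓ choose ℓ - j)^{1/2} x^{ℓ-j} y^{ℓ+j}` of the space `H^ℓ` of
homogeneous polynomials of degree `2ℓ` in `x, y`, with `j = -ℓ + n`. -/
def psi (m : ℕ) (n : Fin (m + 1)) : MvPolynomial (Fin 2) ℂ :=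
  MvPolynomial.C ((Real.sqrt (m.choose (m - n)) : ℝ) : ℂ) *
    MvPolynomial.X 0 ^ (m - (n : ℕ)) * MvPolynomial.X 1 ^ (n : ℕ)

/-- The action `p ↦ p ∘ kᵗ` on polynomial functions on `ℂ²`. -/
def act (k : Matrix (Fin 2) (Fin 2) ℂ) (p : MvPolynomial (Fin 2) ℂ) : MvPolynomial (Fin 2) ℂ :=
  MvPolynomial.bind₁ (fun i => ∑ j, MvPolynomial.C (kᵀ i j) * MvPolynomial.X j) p

/-- The matrix of `T^ℓ(k)` in the orthonormal basis `ψ_{-ℓ}, …, ψ_ℓ`. The entry at `(i, j)` is the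
coefficient of `ψ_i` in `ψ_j ∘ kᵗ`. -/
def rep (m : ℕ) (k : K) : Matrix (Fin (m + 1)) (Fin (m + 1)) ℂ := fun i j =>
  MvPolynomial.coeff (Finsupp.single 0 (m - (i : ℕ)) + Finsupp.single 1 (i : ℕ))
      (act (k : Matrix (Fin 2) (Fin 2) ℂ) (psi m j)) /
    ((Real.sqrt (m.choose (m - i)) : ℝ) : ℂ)

/-- The matrix of `T^{ℓ₁,ℓ₂}(k₁, k₂) = T^{ℓ₁}(k₁) ⊗ T^{ℓ₂}(k₂)`. -/
def tensorRep (m₁ m₂ : ℕ) (u : K × K) :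
    Matrix (Fin (m₁ + 1) × Fin (m₂ + 1)) (Fin (m₁ + 1) × Fin (m₂ + 1)) ℂ :=
  Matrix.kroneckerMap (· * ·) (rep m₁ u.1) (rep m₂ u.2)

/-! ### Spherical functions -/

/-- `β` is (the matrix of) an isometric `K`-intertwiner `H^ℓ → H^{ℓ₁} ⊗ H^{ℓ₂}`. By irreducibility
and multiplicity freeness it is unique up to a phase when it exists. -/
def IsIsometricIntertwiner (m m₁ m₂ : ℕ)
    (β : Matrix (Fin (m₁ + 1) × Fin (m₂ + 1)) (Fin (m + 1)) ℂ) : Prop :=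
  (∀ k : K, tensorRep m₁ m₂ (k, k) * β = β * rep m k) ∧ βᴴ * β = 1

open Classical in
/-- The spherical function `Φ^ℓ_{ℓ₁,ℓ₂}(u) = β^* T^{ℓ₁,ℓ₂}(u) β` of type `ℓ`, with `β` an isometric
intertwiner (the result does not depend on the phase of `β`). It is set to `0` for pairs
`(ℓ₁, ℓ₂)` that do not contain `ℓ`. -/
def spherical (m m₁ m₂ : ℕ) (u : K × K) : Matrix (Fin (m + 1)) (Fin (m + 1)) ℂ :=
  if h : ∃ β, IsIsometricIntertwiner m m₁ m₂ β then
    (h.choose)ᴴ * tensorRep m₁ m₂ u * h.choose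
  else 0

/-- The full spherical function `Φ_d^ℓ`: its `p`-th row is the diagonal of `Φ^ℓ_{ζ(d,p)}`, where
`ζ(d,p) = ((d+ℓ+p)/2, (d+ℓ-p)/2)`. For `p = -ℓ + i` this is `(2ℓ₁, 2ℓ₂) = (d + i, d + 2ℓ - i)`. -/
def fullSpherical (m d : ℕ) (u : K × K) : Matrix (Fin (m + 1)) (Fin (m + 1)) ℂ := fun i j =>
  spherical m (d + i) (d + (m - i)) u j j

/-- The full spherical polynomial `Q_d^ℓ(a_t) = Φ_d^ℓ(a_t) Φ_0^ℓ(a_t)⁻¹`. -/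
def fullQ (m d : ℕ) (t : ℝ) : Matrix (Fin (m + 1)) (Fin (m + 1)) ℂ :=
  fullSpherical m d (aElt t) * (fullSpherical m 0 (aElt t))⁻¹

/-- The weight `V^ℓ(a_t) = Φ_0^ℓ(a_t) Φ_0^ℓ(a_t)^* |D_*(a_t)|` with `D_*(a_t) = sin² t`. -/
def V (m : ℕ) (t : ℝ) : Matrix (Fin (m + 1)) (Fin (m + 1)) ℂ :=
  ((|Real.sin t ^ 2| : ℝ) : ℂ) • (fullSpherical m 0 (aElt t) * (fullSpherical m 0 (aElt t))ᴴ)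

/-- The weight `W` on `[-1, 1]`, defined by `√(1-x²) W(x) = V(a_{arccos x})`
(and equal to `0` at `x = ±1`). -/
def W (m : ℕ) (x : ℝ) : Matrix (Fin (m + 1)) (Fin (m + 1)) ℂ :=
  (((Real.sqrt (1 - x ^ 2))⁻¹ : ℝ) : ℂ) • V m (Real.arccos x)

/-! ### Blocks -/

/-- The ordered splitting of `{0, …, N-1}` into the first `a` and the last `b` indices. -/
def blockEquiv {a b N : ℕ} (h : a + b = N) : Fin a ⊕ Fin b ≃ Fin N :=
  finSumFinEquiv.trans (finCongr h)

/-- A matrix of size `a + b`, seen as a `2 × 2` block matrix. -/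
def inBlocks {R : Type*} {a b N : ℕ} (h : a + b = N) (M : Matrix (Fin N) (Fin N) R) :
    Matrix (Fin a ⊕ Fin b) (Fin a ⊕ Fin b) R :=
  M.submatrix (blockEquiv h) (blockEquiv h)

/-! ### Matrix-valued orthogonal polynomials on `(-1, 1)` -/

/-- A weight matrix on `(-1, 1)`: integrable with finite moments of all orders, and positive
definite almost everywhere. -/
structure IsWeight {n : Type*} [Fintype n] (w : ℝ → Matrix n n ℂ) : Prop where
  moments : ∀ (k : ℕ) (i j : n), IntegrableOn (fun x : ℝ => (x : ℂ) ^ k * w x i j) (Ioo (-1) 1)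
  posDef : ∀ᵐ x ∂(volume.restrict (Ioo (-1 : ℝ) 1)), (w x).PosDef

/-- The value at `x` of a matrix polynomial. -/
def evalAt {n : Type*} (P : Matrix n n (Polynomial ℂ)) (x : ℝ) : Matrix n n ℂ :=
  P.map (Polynomial.eval (x : ℂ))

/-- `⟨P, Q⟩ = ∫_{-1}^{1} P(x) w(x) Q(x)^* dx`. -/
def pairing {n : Type*} [Fintype n] (w : ℝ → Matrix n n ℂ) (P Q : Matrix n n (Polynomial ℂ)) :
    Matrix n n ℂ := fun i j =>
  ∫ x in (-1 : ℝ)..1, (evalAt P x * w x * (evalAt Q x)ᴴ) i j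

/-- `(P_d)` is a sequence of monic matrix orthogonal polynomials for `w`: each `P_d` has degree `d`
with leading coefficient the identity matrix, and `⟨P_d, P_e⟩ = 0` if `d ≠ e`. -/
structure IsMonicOPS {n : Type*} [Fintype n] [DecidableEq n] (w : ℝ → Matrix n n ℂ)
    (P : ℕ → Matrix n n (Polynomial ℂ)) : Prop where
  natDegree_le : ∀ d i j, (P d i j).natDegree ≤ d
  leadingCoeff : ∀ d, (P d).map (fun p => p.coeff d) = 1
  orthogonal : ∀ d e, d ≠ e → pairing w (P d) (P e) = 0

/-- A weight (a matrix function on the parameter set `D`) reduces to a smaller size if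
`w(x) = M diag(w₁(x), w₂(x)) M^*` for all `x ∈ D`, for a constant nonsingular matrix `M` and blocks
`w₁, w₂` of strictly smaller sizes. -/
def Reduces {N : ℕ} (D : Set ℝ) (w : ℝ → Matrix (Fin N) (Fin N) ℂ) : Prop :=
  ∃ (a b : ℕ) (h : a + b = N) (M : Matrix (Fin N) (Fin N) ℂ)
    (w₁ : ℝ → Matrix (Fin a) (Fin a) ℂ) (w₂ : ℝ → Matrix (Fin b) (Fin b) ℂ),
    0 < a ∧ 0 < b ∧ IsUnit M ∧
      ∀ x ∈ D, w x =
        M * (fromBlocks (w₁ x) 0 0 (w₂ x)).submatrix (blockEquiv h).symm (blockEquiv h).symm * Mᴴ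

/-! ### Splitting of `V` and `Q_d` over the group -/

theorem size_minus_add_plus (m : ℕ) : (m + 1) / 2 + (m / 2 + 1) = m + 1 := by omega

/-- The basis `ψ_j - ψ_{-j}` (`j < 0`), followed by `ψ_j + ψ_{-j}` (`j ≥ 0`), of eigenvectors of
`J : ψ_j ↦ ψ_{-j}`, as the columns of a matrix. -/
def eigenbasis (m : ℕ) : Matrix (Fin (m + 1)) (Fin (m + 1)) ℝ := fun i k =>
  let e : Fin (m + 1) → ℝ := Pi.single k 1
  let e' : Fin (m + 1) → ℝ := Pi.single (Fin.rev k) 1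
  if 2 * (k : ℕ) < m then e i - e' i else e i + e' i

/-- The matrix `Y_ℓ`, whose columns are the normalized vectors of `eigenbasis`. -/
def Yl (m : ℕ) : Matrix (Fin (m + 1)) (Fin (m + 1)) ℂ := fun i k =>
  ((eigenbasis m i k / Real.sqrt (∑ i', eigenbasis m i' k ^ 2) : ℝ) : ℂ)

/-- `Y_ℓ⁻¹ Q_d^ℓ(a_t) Y_ℓ` in blocks; the first block has size `⌊ℓ + 1/2⌋`. -/
def Qconj (m d : ℕ) (t : ℝ) :
    Matrix (Fin ((m + 1) / 2) ⊕ Fin (m / 2 + 1)) (Fin ((m + 1) / 2) ⊕ Fin (m / 2 + 1)) ℂ :=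
  inBlocks (size_minus_add_plus m) ((Yl m)⁻¹ * fullQ m d t * Yl m)

/-- `Y_ℓ⁻¹ V^ℓ(a_t) Y_ℓ` in blocks. -/
def Vconj (m : ℕ) (t : ℝ) :
    Matrix (Fin ((m + 1) / 2) ⊕ Fin (m / 2 + 1)) (Fin ((m + 1) / 2) ⊕ Fin (m / 2 + 1)) ℂ :=
  inBlocks (size_minus_add_plus m) ((Yl m)⁻¹ * V m t * Yl m)

/-- `Q_{d,-}^ℓ`. -/
def Qminus (m d : ℕ) (t : ℝ) := (Qconj m d t).toBlocks₁₁
/-- `Q_{d,+}^ℓ`. -/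
def Qplus (m d : ℕ) (t : ℝ) := (Qconj m d t).toBlocks₂₂
/-- `V_-^ℓ`. -/
def Vminus (m : ℕ) (t : ℝ) := (Vconj m t).toBlocks₁₁
/-- `V_+^ℓ`. -/
def Vplus (m : ℕ) (t : ℝ) := (Vconj m t).toBlocks₂₂

/-- A family `(Q_d)` of matrix functions on `A_*` (functions of `t`, where `a_t ∈ A_*`) is orthogonal
with respect to the weight `v` on `A_*`: for `d ≠ e` the integral of `Q_d v Q_e^*` over
`A_* = {a_t : 0 ≤ t < 4π}` exists and vanishes. -/
def OrthogonalOnA {n : Type*} [Fintype n] (v : ℝ → Matrix n n ℂ) (Q : ℕ → ℝ → Matrix n n ℂ) : Prop :=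
  ∀ d e, d ≠ e → ∀ i j,
    IntervalIntegrable (fun t => (Q d t * v t * (Q e t)ᴴ) i j) volume 0 (4 * Real.pi) ∧
      ∫ t in (0 : ℝ)..(4 * Real.pi), (Q d t * v t * (Q e t)ᴴ) i j = 0

/-! ### Splitting of `W` -/

theorem size_one_add_two (m : ℕ) : (m / 2 + 1) + (m + 1) / 2 = m + 1 := by omega

/-- The real matrix `Y`. With `I` the identity and `J` the antidiagonal identity matrix, it is
`(1/√2) (I J; -J I)` for `2ℓ` odd and `(1/√2) (I 0 J; 0 √2 0; -J 0 I)` for `2ℓ` even. -/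
def YReal (m : ℕ) : Matrix (Fin (m + 1)) (Fin (m + 1)) ℝ := fun i j =>
  if 2 * (i : ℕ) = m then (if j = i then 1 else 0)
  else (1 / Real.sqrt 2) *
    (if j = i then 1 else if j = Fin.rev i then (if 2 * (i : ℕ) < m then 1 else -1) else 0)

/-- The matrix `Y`, with complex entries. -/
def Y (m : ℕ) : Matrix (Fin (m + 1)) (Fin (m + 1)) ℂ := (YReal m).map Complex.ofReal

/-- `W̃(x) = Y W(x) Yᵗ` in blocks; the first block has size `⌊ℓ⌋ + 1`. -/
def Wtilde (m : ℕ) (x : ℝ) :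
    Matrix (Fin (m / 2 + 1) ⊕ Fin ((m + 1) / 2)) (Fin (m / 2 + 1) ⊕ Fin ((m + 1) / 2)) ℂ :=
  inBlocks (size_one_add_two m) (Y m * W m x * (Y m)ᵀ)

/-- The upper left block `W_1`. -/
def W1 (m : ℕ) (x : ℝ) := (Wtilde m x).toBlocks₁₁
/-- The lower right block `W_2`. -/
def W2 (m : ℕ) (x : ℝ) := (Wtilde m x).toBlocks₂₂

/-- `Y P(x) Yᵗ` for a matrix polynomial `P`, in blocks. -/
def Pconj (m : ℕ) (P : Matrix (Fin (m + 1)) (Fin (m + 1)) (Polynomial ℂ)) :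
    Matrix (Fin (m / 2 + 1) ⊕ Fin ((m + 1) / 2)) (Fin (m / 2 + 1) ⊕ Fin ((m + 1) / 2))
      (Polynomial ℂ) :=
  inBlocks (size_one_add_two m) ((Y m).map Polynomial.C * P * ((Y m)ᵀ).map Polynomial.C)

end

end SphericalSU2

open SphericalSU2
open scoped Matrix

namespace SphericalSU2

open Matrix MeasureTheory Set
open scoped ComplexOrder

noncomputable section

/-! ### Symmetric powers of a `2 × 2` matrix -/

/-! Everything rests on the flip J : ψ_j ↦ ψ_{-j}.

Splitting. Exchanging the two tensor factors turns (ℓ₁, ℓ₂) into (ℓ₂, ℓ₁) and a_t into a_{-t}; the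
Weyl element also turns a_t into a_{-t} and reverses the diagonal. Together these give J Φ_d J = Φ_d
on A_* (`fullSpherical_rev_rev`), so V, W and Q_d commute with J. The matrices Y and Y_ℓ diagonalize
J, hence conjugation by them gives two blocks. For this the spherical functions must not depend on
the chosen intertwiner: an intertwiner is determined by one entry of its highest weight column
(`IsLieIntertwiner.eq_zero`), hence is unique up to a phase. Existence of intertwiners is used only
for ℓ = ℓ₁ + ℓ₂, that is for Φ_0; where none exists the spherical function is 0 and the other
arguments are unaffected.

Orthogonality on A_*. Since Q_d V Q_e^* = sin² t · Φ_d Φ_e^*, and spherical functions are diagonal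
on A_*, the entries to integrate are sin² t times traces of products of two spherical functions. The
Casimir operator of the first factor gives a second order differential equation in t with eigenvalue
governed by ℓ₁ (`IsLieIntertwiner.radial_ode`). Green's identity then writes the integrand, times
the difference of eigenvalues, as the derivative of a function with a factor sin² t, which vanishes
at the endpoints. If only the ℓ₂ differ, the factors are exchanged first. No integration over the
group is needed.

Orthogonal polynomials. Positivity almost everywhere makes the form on rows of polynomials definite,
which gives existence and uniqueness of the monic sequence. Conjugating by the constant orthogonal
matrix Y gives a monic sequence for W̃; by uniqueness it is the block diagonal one built from W_1
and W_2.

No further reduction. A reduction w = M diag(w₁, w₂) M^* produces a nonscalar E = M p M⁻¹, with p a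
block projection, such that E w = w E^*. So it suffices that a T commuting with J and satisfying T
S(t) = S(t) T^* for all t, where S = Φ_0 Φ_0^*, is a combination of 1 and J
(`eq_smul_one_add_smul_flip`). With N the diagonal matrix `normInv`, Φ_0(a_t) = N Sym(g_t) N for a
symmetric 2 × 2 matrix g_t, which the constant Hadamard matrix h brings to diagonal form. Hence S(t)
= L Λ_t C Λ_t^* L^* with L and C constant and Λ_t proportional to diag((-iτ)^n), τ = tan(t/2).
Comparing powers of τ makes L⁻¹TL diagonal with entries depending only on parity, provided C_{ij} ≠
0 for i + j even. This holds because the inverse binomials in N² are beta integrals, so C_{ij} is an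
integral of an even polynomial with nonnegative coefficients. -/

/-- The values at `v` of the orthonormal basis `ψ_{-ℓ}, …, ψ_ℓ`. -/
def psiVec (m : ℕ) (v : Fin 2 → ℂ) (i : Fin (m + 1)) : ℂ :=
  ((Real.sqrt (m.choose i) : ℝ) : ℂ) * v 0 ^ (m - (i : ℕ)) * v 1 ^ (i : ℕ)

/-- The action of an arbitrary `2 × 2` matrix on `H^ℓ`, in the basis `ψ_{-ℓ}, …, ψ_ℓ`. -/
def symPow (m : ℕ) (g : Matrix (Fin 2) (Fin 2) ℂ) : Matrix (Fin (m + 1)) (Fin (m + 1)) ℂ :=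
  fun i j => MvPolynomial.coeff (Finsupp.single 0 (m - (i : ℕ)) + Finsupp.single 1 (i : ℕ))
      (act g (psi m j)) / ((Real.sqrt (m.choose (m - i)) : ℝ) : ℂ)

theorem rep_eq_symPow (m : ℕ) (k : K) : rep m k = symPow m (k : Matrix (Fin 2) (Fin 2) ℂ) := rfl

theorem sqrt_choose_pos (m : ℕ) (i : Fin (m + 1)) : 0 < Real.sqrt (m.choose i) :=
  Real.sqrt_pos.2 (by exact_mod_cast Nat.choose_pos (Nat.lt_succ_iff.1 i.2))

theorem sqrt_choose_ne_zero (m : ℕ) (i : Fin (m + 1)) :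
    ((Real.sqrt (m.choose i) : ℝ) : ℂ) ≠ 0 := by
  exact_mod_cast (sqrt_choose_pos m i).ne'

theorem sqrt_choose_mul_self (m : ℕ) (i : ℕ) :
    ((Real.sqrt (m.choose i) : ℝ) : ℂ) * ((Real.sqrt (m.choose i) : ℝ) : ℂ) = (m.choose i : ℂ) := by
  rw [← Complex.ofReal_mul, Real.mul_self_sqrt (by positivity)]; simp

theorem eval_eq_sum_of_isHomogeneous {p : MvPolynomial (Fin 2) ℂ} {m : ℕ} (hp : p.IsHomogeneous m)
    (v : Fin 2 → ℂ) :
    MvPolynomial.eval v p = ∑ i : Fin (m + 1),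
      MvPolynomial.coeff (Finsupp.single 0 (m - (i : ℕ)) + Finsupp.single 1 (i : ℕ)) p *
        (v 0 ^ (m - (i : ℕ)) * v 1 ^ (i : ℕ)) := by
  classical
  let f : Fin (m + 1) → (Fin 2 →₀ ℕ) := fun i =>
    Finsupp.single 0 (m - (i : ℕ)) + Finsupp.single 1 (i : ℕ)
  have hf : Function.Injective f := by
    intro i j h
    have := DFunLike.congr_fun h 1
    simpa [f, Fin.ext_iff] using this
  have h1 : ∑ i : Fin (m + 1), MvPolynomial.coeff (f i) p * (v 0 ^ (m - (i : ℕ)) * v 1 ^ (i : ℕ))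
      = ∑ d ∈ Finset.univ.image f, MvPolynomial.coeff d p * ∏ i, v i ^ d i := by
    rw [Finset.sum_image (fun _ _ _ _ h => hf h)]
    refine Finset.sum_congr rfl fun i _ => ?_
    simp [f, Fin.prod_univ_two]
  rw [h1, MvPolynomial.eval_eq']
  refine Finset.sum_subset (fun d hd => ?_) (fun d _ hd => ?_)
  · have := hp (MvPolynomial.mem_support_iff.1 hd)
    rw [Finsupp.weight_apply, Finsupp.sum_fintype _ _ (by simp)] at this
    simp [Fin.sum_univ_two] at this
    refine Finset.mem_image.2 ⟨⟨d 1, by omega⟩, Finset.mem_univ _, ?_⟩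
    ext j
    fin_cases j
    · simp [f]; omega
    · simp [f]
  · simp [MvPolynomial.notMem_support_iff.1 hd]

theorem isHomogeneous_act_psi (m : ℕ) (g : Matrix (Fin 2) (Fin 2) ℂ) (j : Fin (m + 1)) :
    (act g (psi m j)).IsHomogeneous m := by
  have hl : ∀ i : Fin 2, (∑ j, MvPolynomial.C (gᵀ i j) * MvPolynomial.X j :
      MvPolynomial (Fin 2) ℂ).IsHomogeneous 1 := fun i =>
    MvPolynomial.IsHomogeneous.sum _ _ _ fun j _ => MvPolynomial.isHomogeneous_C_mul_X _ _
  have h := (((MvPolynomial.isHomogeneous_C (Fin 2)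
    ((Real.sqrt (m.choose (m - j)) : ℝ) : ℂ))).mul ((hl 0).pow (m - (j : ℕ)))).mul
      ((hl 1).pow (j : ℕ))
  have e : 0 + 1 * (m - (j : ℕ)) + 1 * (j : ℕ) = m := by have := j.2; omega
  rw [e] at h
  simpa [act, psi] using h

/-- Evaluating p ∘ gᵗ at v is evaluating p at v g. As the vectors `psiVec m v` span, this determines
`symPow m g`, and identities for it are checked by evaluating polynomials at points. -/
theorem psiVec_vecMul_symPow (m : ℕ) (g : Matrix (Fin 2) (Fin 2) ℂ) (v : Fin 2 → ℂ) :
    psiVec m v ᵥ* symPow m g = psiVec m (v ᵥ* g) := by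
  ext j
  have h := eval_eq_sum_of_isHomogeneous (isHomogeneous_act_psi m g j) v
  have h2 : MvPolynomial.eval v (act g (psi m j)) = psiVec m (v ᵥ* g) j := by
    have hj : m.choose (m - j) = m.choose j := Nat.choose_symm (Nat.lt_succ_iff.1 j.2)
    simp [act, psi, psiVec, Matrix.vecMul, dotProduct, Fin.sum_univ_two, hj, mul_comm]
  rw [← h2, h]
  simp only [Matrix.vecMul, dotProduct, psiVec, symPow]
  refine Finset.sum_congr rfl fun i _ => ?_
  rw [Nat.choose_symm (Nat.lt_succ_iff.1 i.2)]
  field_simp [sqrt_choose_ne_zero m i]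

/-- Along (1, z) the basis takes the values √(m choose i) zⁱ, so the hypothesis says that a
polynomial in z vanishes identically. -/
theorem eq_zero_of_psiVec_one_dotProduct {m : ℕ} {c : Fin (m + 1) → ℂ}
    (h : ∀ z, psiVec m ![1, z] ⬝ᵥ c = 0) : c = 0 := by
  let P : Polynomial ℂ := ∑ i : Fin (m + 1),
    Polynomial.monomial (i : ℕ) (((Real.sqrt (m.choose i) : ℝ) : ℂ) * c i)
  have hP : P = 0 := Polynomial.funext fun z => by
    have := h z
    simp only [dotProduct, psiVec] at this
    simp only [P, Polynomial.eval_finsetSum, Polynomial.eval_monomial, Polynomial.eval_zero]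
    rw [← this]
    refine Finset.sum_congr rfl fun i _ => ?_
    simp; ring
  ext i
  have := congrArg (fun p => Polynomial.coeff p i) hP
  simp only [P, Polynomial.finsetSum_coeff, Polynomial.coeff_monomial, Polynomial.coeff_zero] at this
  rw [Finset.sum_eq_single i (fun j _ hj => if_neg (by simpa [Fin.ext_iff] using hj)) (by simp)]
    at this
  rw [if_pos rfl] at this
  exact (mul_eq_zero.1 this).resolve_left (sqrt_choose_ne_zero m i)

theorem eq_zero_of_psiVec_dotProduct {m : ℕ} {c : Fin (m + 1) → ℂ}
    (h : ∀ v, psiVec m v ⬝ᵥ c = 0) : c = 0 := eq_zero_of_psiVec_one_dotProduct fun _ => h _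

theorem matrix_ext_of_psiVec {m : ℕ} {n : Type*} {A B : Matrix (Fin (m + 1)) n ℂ}
    (h : ∀ v, psiVec m v ᵥ* A = psiVec m v ᵥ* B) : A = B := by
  ext i j
  have : (fun i => A i j - B i j) = 0 := eq_zero_of_psiVec_dotProduct fun v => by
    have := congrFun (h v) j
    simp only [Matrix.vecMul, dotProduct] at this ⊢
    simp [mul_sub, this]
  exact sub_eq_zero.1 (congrFun this i)

theorem matrix_ext_of_psiVec_right {m : ℕ} {n : Type*} {A B : Matrix n (Fin (m + 1)) ℂ}
    (h : ∀ v, A *ᵥ psiVec m v = B *ᵥ psiVec m v) : A = B := by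
  rw [← Matrix.transpose_inj]
  exact matrix_ext_of_psiVec fun v => by simpa [Matrix.vecMul_transpose] using h v

theorem symPow_mul (m : ℕ) (g h : Matrix (Fin 2) (Fin 2) ℂ) :
    symPow m (g * h) = symPow m g * symPow m h := matrix_ext_of_psiVec fun v => by
  rw [← Matrix.vecMul_vecMul, psiVec_vecMul_symPow, psiVec_vecMul_symPow, psiVec_vecMul_symPow,
    Matrix.vecMul_vecMul]

theorem symPow_one (m : ℕ) : symPow m 1 = 1 := matrix_ext_of_psiVec fun v => by
  rw [psiVec_vecMul_symPow, Matrix.vecMul_one, Matrix.vecMul_one]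

/-- This is the binomial theorem: (v · w)^m is the reproducing kernel of the basis. It makes
`symPow` compatible with transposes and `polarization` isometric. -/
theorem psiVec_dotProduct_psiVec (m : ℕ) (v w : Fin 2 → ℂ) :
    psiVec m v ⬝ᵥ psiVec m w = (v ⬝ᵥ w) ^ m := by
  have : v ⬝ᵥ w = v 1 * w 1 + v 0 * w 0 := by simp [dotProduct, Fin.sum_univ_two, add_comm]
  rw [this, add_pow, Finset.sum_range]
  refine Finset.sum_congr rfl fun i _ => ?_
  simp only [psiVec, ← sqrt_choose_mul_self]
  ring

theorem symPow_transpose (m : ℕ) (g : Matrix (Fin 2) (Fin 2) ℂ) :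
    symPow m gᵀ = (symPow m g)ᵀ := matrix_ext_of_psiVec fun v => by
  rw [← sub_eq_zero]
  refine eq_zero_of_psiVec_dotProduct fun w => ?_
  rw [dotProduct_sub, psiVec_vecMul_symPow, psiVec_dotProduct_psiVec, Matrix.vecMul_transpose,
    Matrix.dotProduct_mulVec, Matrix.vecMul_transpose, Matrix.dotProduct_mulVec,
    psiVec_vecMul_symPow, psiVec_dotProduct_psiVec, sub_self]

theorem symPow_mulVec_psiVec (m : ℕ) (g : Matrix (Fin 2) (Fin 2) ℂ) (v : Fin 2 → ℂ) :
    symPow m g *ᵥ psiVec m v = psiVec m (g *ᵥ v) := by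
  rw [← Matrix.transpose_transpose g, symPow_transpose, Matrix.mulVec_transpose,
    psiVec_vecMul_symPow, Matrix.mulVec_transpose]

theorem star_psiVec (m : ℕ) (v : Fin 2 → ℂ) : star (psiVec m v) = psiVec m (star v) := by
  ext i
  simp [psiVec]

theorem symPow_conjTranspose (m : ℕ) (g : Matrix (Fin 2) (Fin 2) ℂ) :
    symPow m gᴴ = (symPow m g)ᴴ := matrix_ext_of_psiVec fun v => by
  rw [psiVec_vecMul_symPow, Matrix.vecMul_conjTranspose (symPow m g), star_psiVec,
    symPow_mulVec_psiVec, star_psiVec, Matrix.star_mulVec, star_star]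

theorem symPow_diagonal (m : ℕ) (a b : ℂ) :
    symPow m (diagonal ![a, b]) =
      diagonal fun i : Fin (m + 1) => a ^ (m - (i : ℕ)) * b ^ (i : ℕ) :=
  matrix_ext_of_psiVec fun v => by
    rw [psiVec_vecMul_symPow]
    ext i
    simp [psiVec, Matrix.vecMul_diagonal, mul_pow]
    ring

theorem rep_mul (m : ℕ) (k k' : K) : rep m (k * k') = rep m k * rep m k' := symPow_mul m _ _

theorem rep_torus (m : ℕ) (t : ℝ) :
    rep m (torus t) = diagonal fun i : Fin (m + 1) =>
      Complex.exp (Complex.I * t * (((m : ℂ) - 2 * (i : ℕ)) / 2)) := by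
  have : (torus t : Matrix (Fin 2) (Fin 2) ℂ) =
      diagonal ![Complex.exp (Complex.I * (t / 2)), Complex.exp (-(Complex.I * (t / 2)))] := by
    ext i j; fin_cases i <;> fin_cases j <;> simp [torus]
  rw [rep_eq_symPow, this, symPow_diagonal]
  congr 1; ext i
  rw [← Complex.exp_nat_mul, ← Complex.exp_nat_mul, ← Complex.exp_add,
    Nat.cast_sub (Nat.lt_succ_iff.1 i.2)]
  congr 1; ring

/-! ### Entrywise derivatives of matrix functions -/

/-- The matrix function `A` has the derivative `A'` at `t`, entry by entry. -/
def HasEntryDerivAt {p q : Type*} (A : ℝ → Matrix p q ℂ) (A' : Matrix p q ℂ) (t : ℝ) : Prop :=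
  ∀ i j, HasDerivAt (fun s => A s i j) (A' i j) t

section EntryDeriv
variable {p q r s : Type*} {A B : ℝ → Matrix p q ℂ} {A' B' : Matrix p q ℂ} {t : ℝ}

theorem HasEntryDerivAt.unique (h : HasEntryDerivAt A A' t) (h' : HasEntryDerivAt A B' t) :
    A' = B' := by
  ext i j; exact (h i j).unique (h' i j)

theorem hasEntryDerivAt_const (M : Matrix p q ℂ) : HasEntryDerivAt (fun _ => M) 0 t :=
  fun i j => hasDerivAt_const t (M i j)

theorem HasEntryDerivAt.mul [Fintype q] {C : ℝ → Matrix q r ℂ} {C' : Matrix q r ℂ}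
    (hA : HasEntryDerivAt A A' t) (hC : HasEntryDerivAt C C' t) :
    HasEntryDerivAt (fun s => A s * C s) (A' * C t + A t * C') t := fun i j => by
  simp only [Matrix.mul_apply, Matrix.add_apply, ← Finset.sum_add_distrib]
  exact HasDerivAt.fun_sum fun k _ => (hA i k).mul (hC k j)

theorem HasEntryDerivAt.const_mul [Fintype p] (M : Matrix r p ℂ) (hA : HasEntryDerivAt A A' t) :
    HasEntryDerivAt (fun s => M * A s) (M * A') t := by
  simpa using (hasEntryDerivAt_const M).mul hA

theorem HasEntryDerivAt.mul_const [Fintype q] (M : Matrix q r ℂ) (hA : HasEntryDerivAt A A' t) :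
    HasEntryDerivAt (fun s => A s * M) (A' * M) t := by
  simpa using hA.mul (hasEntryDerivAt_const M)

theorem HasEntryDerivAt.conjTranspose (hA : HasEntryDerivAt A A' t) :
    HasEntryDerivAt (fun s => (A s)ᴴ) A'ᴴ t := fun i j => (hA j i).star

theorem HasEntryDerivAt.trace {n : Type*} [Fintype n] {A : ℝ → Matrix n n ℂ} {A' : Matrix n n ℂ}
    (hA : HasEntryDerivAt A A' t) : HasDerivAt (fun s => (A s).trace) A'.trace t :=
  HasDerivAt.fun_sum fun k _ => hA k k

theorem HasEntryDerivAt.kronecker {C : ℝ → Matrix r s ℂ} {C' : Matrix r s ℂ}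
    (hA : HasEntryDerivAt A A' t) (hC : HasEntryDerivAt C C' t) :
    HasEntryDerivAt (fun s => kroneckerMap (· * ·) (A s) (C s))
      (kroneckerMap (· * ·) A' (C t) + kroneckerMap (· * ·) (A t) C') t :=
  fun i j => (hA i.1 j.1).mul (hC i.2 j.2)

end EntryDeriv

/-! ### The infinitesimal representations -/

/-- The raising operator of the Lie algebra on `H^ℓ`. -/
def opE (m : ℕ) : Matrix (Fin (m + 1)) (Fin (m + 1)) ℂ := fun i j =>
  if (i : ℕ) + 1 = j then ((Real.sqrt ((j : ℕ) * (m + 1 - j) : ℕ) : ℝ) : ℂ) else 0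

/-- The lowering operator of the Lie algebra on `H^ℓ`. -/
def opF (m : ℕ) : Matrix (Fin (m + 1)) (Fin (m + 1)) ℂ := (opE m)ᵀ

/-- The weight operator of the Lie algebra on `H^ℓ`. -/
def opH (m : ℕ) : Matrix (Fin (m + 1)) (Fin (m + 1)) ℂ :=
  diagonal fun i => ((m : ℂ) - 2 * (i : ℕ)) / 2

theorem opE_conjTranspose (m : ℕ) : (opE m)ᴴ = opF m := by
  ext i j
  simp only [opF, opE, conjTranspose_apply, transpose_apply]
  split_ifs <;> simp

theorem opF_conjTranspose (m : ℕ) : (opF m)ᴴ = opE m := by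
  rw [← opE_conjTranspose, conjTranspose_conjTranspose]

theorem opH_conjTranspose (m : ℕ) : (opH m)ᴴ = opH m := by
  rw [opH, diagonal_conjTranspose]
  congr 1; ext i
  simp

theorem opF_mul_opE (m : ℕ) :
    opF m * opE m = diagonal fun i : Fin (m + 1) => ((i : ℕ) : ℂ) * (m + 1 - (i : ℕ)) := by
  ext i j
  rw [Matrix.mul_apply, diagonal_apply]
  simp only [opF, opE, transpose_apply]
  split_ifs with h
  · subst h
    rcases Nat.eq_zero_or_pos (i : ℕ) with h0 | h0
    · rw [Finset.sum_eq_zero]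
      · simp [h0]
      · intro k _; rw [if_neg (by omega)]; simp
    · rw [Finset.sum_eq_single ⟨(i : ℕ) - 1, by omega⟩]
      · simp only [Nat.sub_add_cancel h0, if_true]
        rw [← Complex.ofReal_mul, Real.mul_self_sqrt (by positivity), Complex.ofReal_natCast]
        push_cast [Nat.cast_sub (by omega : (i : ℕ) ≤ m + 1)]
        ring
      · intro k _ hk
        rw [if_neg, zero_mul]
        intro hk2; exact hk (Fin.ext (by simp; omega))
      · simp
  · refine Finset.sum_eq_zero fun k _ => ?_
    rw [Fin.ext_iff] at h
    by_cases h1 : (k : ℕ) + 1 = i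
    · rw [if_neg (show ¬ (k : ℕ) + 1 = j by omega), mul_zero]
    · rw [if_neg h1, zero_mul]

theorem opE_mul_opF (m : ℕ) :
    opE m * opF m = diagonal fun i : Fin (m + 1) => ((i : ℕ) + 1 : ℂ) * (m - (i : ℕ)) := by
  ext i j
  rw [Matrix.mul_apply, diagonal_apply]
  simp only [opF, opE, transpose_apply]
  split_ifs with h
  · subst h
    rcases (Nat.lt_succ_iff.1 i.2).eq_or_lt with h0 | h0
    · rw [Finset.sum_eq_zero]
      · simp [h0]
      · intro k _; rw [if_neg (by omega)]; simp
    · rw [Finset.sum_eq_single ⟨(i : ℕ) + 1, by omega⟩]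
      · simp only [if_true]
        rw [← Complex.ofReal_mul, Real.mul_self_sqrt (by positivity), Complex.ofReal_natCast]
        rw [Nat.add_sub_add_right]
        push_cast [Nat.cast_sub h0.le]
        ring
      · intro k _ hk
        rw [if_neg, zero_mul]
        intro hk2; exact hk (Fin.ext (by simp; omega))
      · simp
  · refine Finset.sum_eq_zero fun k _ => ?_
    rw [Fin.ext_iff] at h
    by_cases h1 : (i : ℕ) + 1 = k
    · rw [if_neg (show ¬ (j : ℕ) + 1 = k by omega), mul_zero]
    · rw [if_neg h1, zero_mul]

theorem opE_opF_commutator (m : ℕ) : opE m * opF m - opF m * opE m = (2 : ℂ) • opH m := by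
  rw [opE_mul_opF, opF_mul_opE, opH, diagonal_sub, ← diagonal_smul]
  congr 1; ext i; simp; ring

/-- Applied to the first tensor factor alone, this scalar is the eigenvalue in the radial equation
and separates different ℓ₁. -/
theorem casimir (m : ℕ) :
    opH m * opH m + opH m + opF m * opE m = ((m : ℂ) / 2 * (m / 2 + 1)) • 1 := by
  rw [opF_mul_opE, opH, diagonal_mul_diagonal, diagonal_add, diagonal_add, ← diagonal_one,
    ← diagonal_smul]
  congr 1; ext i; simp; ring

theorem sqrt_mul_sqrt_choose (m k : ℕ) :
    Real.sqrt ((k + 1) * (m + 1 - (k + 1)) : ℕ) * Real.sqrt (m.choose k) =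
      (k + 1) * Real.sqrt (m.choose (k + 1)) := by
  have h := Nat.choose_succ_right_eq m k
  have e : (k + 1) * (m + 1 - (k + 1)) * m.choose k = (k + 1) ^ 2 * m.choose (k + 1) := by
    rw [Nat.add_sub_add_right]; nlinarith [h]
  rw [← Real.sqrt_mul (by positivity), ← Nat.cast_mul, e, Nat.cast_mul, Real.sqrt_mul (by positivity)]
  push_cast
  rw [Real.sqrt_sq (by positivity)]

theorem sqrt_mul_sqrt_choose_succ (m k : ℕ) (hk : k ≤ m) :
    Real.sqrt ((k + 1) * (m + 1 - (k + 1)) : ℕ) * Real.sqrt (m.choose (k + 1)) =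
      ((m : ℝ) - k) * Real.sqrt (m.choose k) := by
  have h := Nat.choose_succ_right_eq m k
  have e : (k + 1) * (m + 1 - (k + 1)) * m.choose (k + 1) = (m - k) ^ 2 * m.choose k := by
    rw [Nat.add_sub_add_right]; linear_combination (m - k) * h
  rw [← Real.sqrt_mul (by positivity), ← Nat.cast_mul, e, Nat.cast_mul, Real.sqrt_mul (by positivity)]
  push_cast
  rw [Real.sqrt_sq (by positivity), Nat.cast_sub hk]

/-- On polynomials `opE` is x ∂/∂y (and `opF` is y ∂/∂x); the square roots in the entries absorb the
ratios of the norms of neighbouring monomials. -/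
theorem psiVec_vecMul_opE (m : ℕ) (v : Fin 2 → ℂ) (j : Fin (m + 1)) :
    (psiVec m v ᵥ* opE m) j =
      ((Real.sqrt (m.choose j) : ℝ) : ℂ) * (v 0 ^ (m - (j : ℕ)) * ((j : ℕ) * v 1 ^ ((j : ℕ) - 1) * v 0)) := by
  obtain ⟨j, hj⟩ := j
  rcases j with _ | k
  · simp only [Matrix.vecMul, dotProduct, opE]
    rw [Finset.sum_eq_zero] <;> simp
  · simp only [Matrix.vecMul, dotProduct, opE]
    rw [Finset.sum_eq_single ⟨k, by omega⟩]
    · have h := congrArg (fun x : ℝ => (x : ℂ)) (sqrt_mul_sqrt_choose m k)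
      have e : m - k = m - (k + 1) + 1 := by omega
      simp only [psiVec, if_true, e, pow_succ, Nat.add_sub_cancel]
      push_cast at h ⊢
      linear_combination (v 0 ^ (m - (k + 1)) * v 0 * v 1 ^ k) * h
    · intro b _ hb
      rw [if_neg, mul_zero]
      intro h; exact hb (Fin.ext (by simpa using h))
    · simp

theorem psiVec_vecMul_opF (m : ℕ) (v : Fin 2 → ℂ) (j : Fin (m + 1)) :
    (psiVec m v ᵥ* opF m) j = ((Real.sqrt (m.choose j) : ℝ) : ℂ) *
      (((m - (j : ℕ) : ℕ) : ℂ) * v 0 ^ (m - (j : ℕ) - 1) * v 1 * v 1 ^ (j : ℕ)) := by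
  obtain ⟨k, hk⟩ := j
  simp only [Matrix.vecMul, dotProduct, opF, opE, transpose_apply]
  rcases (Nat.lt_succ_iff.1 hk).eq_or_lt with h0 | h0
  · rw [Finset.sum_eq_zero]
    · simp [h0]
    · intro b _; rw [if_neg (by omega), mul_zero]
  · rw [Finset.sum_eq_single ⟨k + 1, by omega⟩]
    · have h := congrArg (fun x : ℝ => (x : ℂ)) (sqrt_mul_sqrt_choose_succ m k (by omega))
      have e : m - k - 1 = m - (k + 1) := by omega
      simp only [psiVec, if_true, e, pow_succ, Nat.cast_sub h0.le]
      push_cast at h ⊢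
      linear_combination (v 0 ^ (m - (k + 1)) * v 1 * v 1 ^ k) * h
    · intro b _ hb
      rw [if_neg, mul_zero]
      intro h; exact hb (Fin.ext (by simpa using h.symm))
    · simp

/-- The matrix of values of the basis at `(1, 0), (1, 1), …, (1, 2ℓ)`. -/
def psiSample (m : ℕ) : Matrix (Fin (m + 1)) (Fin (m + 1)) ℂ :=
  fun i => psiVec m ![1, ((i : ℕ) : ℂ)]

/-- A Vandermonde matrix times an invertible diagonal one. Its inverse expresses the entries of
`symPow m g` as fixed combinations of values of polynomials, which carries differentiability and
continuity over to the entries. -/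
theorem isUnit_psiSample (m : ℕ) : IsUnit (psiSample m).det := by
  have : psiSample m = vandermonde (fun i : Fin (m + 1) => ((i : ℕ) : ℂ)) *
      diagonal fun i : Fin (m + 1) => ((Real.sqrt (m.choose i) : ℝ) : ℂ) := by
    ext i j
    rw [mul_diagonal, vandermonde_apply]
    simp [psiSample, psiVec, mul_comm]
  rw [this, det_mul, det_diagonal, isUnit_iff_ne_zero]
  refine mul_ne_zero (det_vandermonde_ne_zero_iff.2 fun i j h => ?_)
    (Finset.prod_ne_zero_iff.2 fun i _ => sqrt_choose_ne_zero m i)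
  exact Fin.ext (by exact_mod_cast h)

/-- Off-diagonal tangent directions are enough, since the weight operator is recovered from the
commutator of `opE` and `opF`. -/
theorem hasEntryDerivAt_symPow (m : ℕ) {k : ℝ → Matrix (Fin 2) (Fin 2) ℂ} {b c : ℂ}
    (h0 : k 0 = 1) (hk : HasEntryDerivAt k !![0, b; c, 0] 0) :
    HasEntryDerivAt (fun s => symPow m (k s)) (b • opE m + c • opF m) 0 := by
  have hv : ∀ v : Fin 2 → ℂ, ∀ j, HasDerivAt (fun s => psiVec m (v ᵥ* k s) j)
      ((psiVec m v ᵥ* (b • opE m + c • opF m)) j) 0 := by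
    intro v j
    have d0 : HasDerivAt (fun s => (v ᵥ* k s) 0) (v 1 * c) 0 := by
      have := ((hk 0 0).const_mul (v 0)).add ((hk 1 0).const_mul (v 1))
      simpa [Matrix.vecMul, dotProduct, Fin.sum_univ_two, Pi.add_def] using this
    have d1 : HasDerivAt (fun s => (v ᵥ* k s) 1) (v 0 * b) 0 := by
      have := ((hk 0 1).const_mul (v 0)).add ((hk 1 1).const_mul (v 1))
      simpa [Matrix.vecMul, dotProduct, Fin.sum_univ_two, Pi.add_def] using this
    have := ((d0.fun_pow (m - (j : ℕ))).const_mul ((Real.sqrt (m.choose j) : ℝ) : ℂ)).mul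
      (d1.fun_pow (j : ℕ))
    refine this.congr_deriv ?_
    rw [h0, Matrix.vecMul_one, Matrix.vecMul_add, Matrix.vecMul_smul, Matrix.vecMul_smul]
    simp only [Pi.add_apply, Pi.smul_apply, smul_eq_mul, psiVec_vecMul_opE, psiVec_vecMul_opF]
    ring
  have e : ∀ g, symPow m g = (psiSample m)⁻¹ * (psiSample m * symPow m g) := fun g => by
    rw [nonsing_inv_mul_cancel_left _ _ (isUnit_psiSample m)]
  have h : HasEntryDerivAt (fun s => psiSample m * symPow m (k s))
      (psiSample m * (b • opE m + c • opF m)) 0 := fun i j => by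
    refine (hv ![1, ((i : ℕ) : ℂ)] j).congr_of_eventuallyEq (Filter.Eventually.of_forall fun s => ?_)
    simp only [← psiVec_vecMul_symPow]
    rfl
  have := h.const_mul (psiSample m)⁻¹
  rw [nonsing_inv_mul_cancel_left _ _ (isUnit_psiSample m)] at this
  simpa only [← e] using this

/-! ### Infinitesimal form of the intertwining property -/

/-- The element `k(a, b) ∈ SU(2)`. -/
def mkK (a b : ℂ) (h : a * star a + b * star b = 1) : K :=
  ⟨!![a, b; -star b, star a], by
    rw [Matrix.mem_specialUnitaryGroup_iff, Matrix.mem_unitaryGroup_iff]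
    refine ⟨?_, ?_⟩
    · ext i j
      fin_cases i <;> fin_cases j <;>
        simp [Matrix.mul_apply, Fin.sum_univ_two] <;> simp at h <;> first | ring1 | linear_combination h
    · rw [Matrix.det_fin_two_of]; linear_combination h⟩

/-- The operator `A ⊗ 1` on `H^{ℓ₁} ⊗ H^{ℓ₂}`. -/
def tens₁ {m₁ : ℕ} (m₂ : ℕ) (A : Matrix (Fin (m₁ + 1)) (Fin (m₁ + 1)) ℂ) :
    Matrix (Fin (m₁ + 1) × Fin (m₂ + 1)) (Fin (m₁ + 1) × Fin (m₂ + 1)) ℂ :=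
  kroneckerMap (· * ·) A 1

/-- The operator `1 ⊗ A` on `H^{ℓ₁} ⊗ H^{ℓ₂}`. -/
def tens₂ (m₁ : ℕ) {m₂ : ℕ} (A : Matrix (Fin (m₂ + 1)) (Fin (m₂ + 1)) ℂ) :
    Matrix (Fin (m₁ + 1) × Fin (m₂ + 1)) (Fin (m₁ + 1) × Fin (m₂ + 1)) ℂ :=
  kroneckerMap (· * ·) 1 A

section Tens
variable {m₁ m₂ : ℕ} (A A' : Matrix (Fin (m₁ + 1)) (Fin (m₁ + 1)) ℂ)
  (B B' : Matrix (Fin (m₂ + 1)) (Fin (m₂ + 1)) ℂ)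

theorem tens₁_mul : tens₁ m₂ (A * A') = tens₁ m₂ A * tens₁ m₂ A' := by
  simpa [tens₁] using Matrix.mul_kronecker_mul A A' (1 : Matrix (Fin (m₂ + 1)) (Fin (m₂ + 1)) ℂ) 1

theorem tens₂_mul : tens₂ m₁ (B * B') = tens₂ m₁ B * tens₂ m₁ B' := by
  simpa [tens₂] using Matrix.mul_kronecker_mul (1 : Matrix (Fin (m₁ + 1)) (Fin (m₁ + 1)) ℂ) 1 B B'

theorem tens₁_mul_tens₂ : tens₁ m₂ A * tens₂ m₁ B = kroneckerMap (· * ·) A B := by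
  simpa [tens₁, tens₂] using (Matrix.mul_kronecker_mul A (1 : Matrix (Fin (m₁ + 1)) (Fin (m₁ + 1)) ℂ)
    (1 : Matrix (Fin (m₂ + 1)) (Fin (m₂ + 1)) ℂ) B).symm

theorem tens₂_mul_tens₁ : tens₂ m₁ B * tens₁ m₂ A = kroneckerMap (· * ·) A B := by
  simpa [tens₁, tens₂] using (Matrix.mul_kronecker_mul (1 : Matrix (Fin (m₁ + 1)) (Fin (m₁ + 1)) ℂ) A B
    (1 : Matrix (Fin (m₂ + 1)) (Fin (m₂ + 1)) ℂ)).symm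

theorem tens_comm : tens₁ m₂ A * tens₂ m₁ B = tens₂ m₁ B * tens₁ m₂ A := by
  rw [tens₁_mul_tens₂, tens₂_mul_tens₁]

theorem tens₁_add : tens₁ m₂ (A + A') = tens₁ m₂ A + tens₁ m₂ A' := by
  ext; simp [tens₁, add_mul]
theorem tens₂_add : tens₂ m₁ (B + B') = tens₂ m₁ B + tens₂ m₁ B' := by
  ext; simp [tens₂, mul_add]
theorem tens₁_sub : tens₁ m₂ (A - A') = tens₁ m₂ A - tens₁ m₂ A' := by
  ext; simp [tens₁, sub_mul]
theorem tens₂_sub : tens₂ m₁ (B - B') = tens₂ m₁ B - tens₂ m₁ B' := by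
  ext; simp [tens₂, mul_sub]
theorem tens₁_smul (c : ℂ) : tens₁ m₂ (c • A) = c • tens₁ m₂ A := by
  ext; simp [tens₁, mul_assoc]
theorem tens₂_smul (c : ℂ) : tens₂ m₁ (c • B) = c • tens₂ m₁ B := by
  ext; simp [tens₂]; ring
theorem tens₁_conjTranspose : (tens₁ m₂ A)ᴴ = tens₁ m₂ Aᴴ := by
  simpa [tens₁] using Matrix.conjTranspose_kronecker A (1 : Matrix (Fin (m₂ + 1)) (Fin (m₂ + 1)) ℂ)
theorem tens₂_conjTranspose : (tens₂ m₁ B)ᴴ = tens₂ m₁ Bᴴ := by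
  simpa [tens₂] using Matrix.conjTranspose_kronecker (1 : Matrix (Fin (m₁ + 1)) (Fin (m₁ + 1)) ℂ) B
theorem tens₁_one : tens₁ m₂ (1 : Matrix (Fin (m₁ + 1)) (Fin (m₁ + 1)) ℂ) = 1 := by
  simp [tens₁]

end Tens

theorem tensorRep_eq (m₁ m₂ : ℕ) (u : K × K) :
    tensorRep m₁ m₂ u = tens₁ m₂ (rep m₁ u.1) * tens₂ m₁ (rep m₂ u.2) := by
  rw [tens₁_mul_tens₂]; rfl

section Intertwiner
variable {m m₁ m₂ : ℕ} {β : Matrix (Fin (m₁ + 1) × Fin (m₂ + 1)) (Fin (m + 1)) ℂ}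

theorem intertwiner_deriv (hβ : ∀ k : K, tensorRep m₁ m₂ (k, k) * β = β * rep m k)
    {k : ℝ → K} {b c : ℂ} (h0 : (k 0 : Matrix (Fin 2) (Fin 2) ℂ) = 1)
    (hk : HasEntryDerivAt (fun s => (k s : Matrix (Fin 2) (Fin 2) ℂ)) !![0, b; c, 0] 0) :
    b • ((tens₁ m₂ (opE m₁) + tens₂ m₁ (opE m₂)) * β - β * opE m) +
      c • ((tens₁ m₂ (opF m₁) + tens₂ m₁ (opF m₂)) * β - β * opF m) = 0 := by
  have l := ((hasEntryDerivAt_symPow m₁ h0 hk).kronecker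
    (hasEntryDerivAt_symPow m₂ h0 hk)).mul_const β
  have r := (hasEntryDerivAt_symPow m h0 hk).const_mul β
  have e : (fun s => kroneckerMap (· * ·) (symPow m₁ (k s)) (symPow m₂ (k s)) * β) =
      fun s => β * symPow m (k s) := funext fun s => hβ (k s)
  rw [e] at l
  have := l.unique r
  simp only [h0, symPow_one] at this
  change (tens₁ m₂ (b • opE m₁ + c • opF m₁) + tens₂ m₁ (b • opE m₂ + c • opF m₂)) * β = _ at this
  rw [tens₁_add, tens₂_add, tens₁_smul, tens₂_smul, tens₁_smul, tens₂_smul] at this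
  rw [← sub_eq_zero] at this
  rw [← this]
  simp only [Matrix.add_mul, Matrix.mul_add, Matrix.smul_mul, Matrix.mul_smul]
  module

theorem cos_sq_add_sin_sq_cast (s : ℝ) : ((Real.cos s : ℝ) : ℂ) ^ 2 + ((Real.sin s : ℝ) : ℂ) ^ 2 =
    1 := by
  exact_mod_cast Real.cos_sq_add_sin_sq s

theorem intertwiner_opE_opF (hβ : ∀ k : K, tensorRep m₁ m₂ (k, k) * β = β * rep m k) :
    (tens₁ m₂ (opE m₁) + tens₂ m₁ (opE m₂)) * β = β * opE m ∧
      (tens₁ m₂ (opF m₁) + tens₂ m₁ (opF m₂)) * β = β * opF m := by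
  have key : ∀ z : ℂ, z * star z = 1 →
      z • ((tens₁ m₂ (opE m₁) + tens₂ m₁ (opE m₂)) * β - β * opE m) +
        (-star z) • ((tens₁ m₂ (opF m₁) + tens₂ m₁ (opF m₂)) * β - β * opF m) = 0 := by
    intro z hz
    have hs : HasDerivAt (fun s : ℝ => ((Real.sin s : ℝ) : ℂ)) 1 0 := by
      simpa using (Real.hasDerivAt_sin 0).ofReal_comp
    have hc : HasDerivAt (fun s : ℝ => ((Real.cos s : ℝ) : ℂ)) 0 0 := by
      simpa using (Real.hasDerivAt_cos 0).ofReal_comp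
    refine intertwiner_deriv hβ (k := fun s => mkK (Real.cos s : ℝ) (z * (Real.sin s : ℝ)) ?_) ?_ ?_
    · have := cos_sq_add_sin_sq_cast s
      simp only [star_mul', Complex.star_def, Complex.conj_ofReal] at hz ⊢
      linear_combination this + ((Real.sin s : ℝ) : ℂ) ^ 2 * hz
    · ext i j; fin_cases i <;> fin_cases j <;> simp [mkK]
    · intro i j
      fin_cases i <;> fin_cases j
      · simpa [mkK] using hc
      · simpa [mkK] using hs.const_mul z
      · have := (hs.const_mul (star z)).fun_neg
        simpa [mkK, ← Complex.ofReal_sin, Complex.conj_ofReal, -Complex.ofReal_sin] using this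
      · simpa [mkK, ← Complex.ofReal_cos, Complex.conj_ofReal, -Complex.ofReal_cos] using hc
  -- The directions z = 1 and z = i give X - Z = 0 and X + Z = 0 for the two defects X (of E) and Z
  -- (of F), so both vanish.
  have k1 := key 1 (by simp)
  have k2 := key Complex.I (by simp)
  simp only [star_one, one_smul, Complex.star_def, Complex.conj_I, neg_neg] at k1 k2
  set X := (tens₁ m₂ (opE m₁) + tens₂ m₁ (opE m₂)) * β - β * opE m
  set Z := (tens₁ m₂ (opF m₁) + tens₂ m₁ (opF m₂)) * β - β * opF m
  rw [← smul_add, smul_eq_zero_iff_right Complex.I_ne_zero] at k2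
  have hX : X = 0 := by
    have : (2 : ℂ) • X = (X + -(1 : ℂ) • Z) + (X + Z) := by module
    rw [k1, k2, add_zero] at this
    exact (smul_eq_zero_iff_right two_ne_zero).1 this
  have hZ : Z = 0 := by rw [hX, zero_add] at k2; exact k2
  exact ⟨sub_eq_zero.1 hX, sub_eq_zero.1 hZ⟩

end Intertwiner

/-! ### Intertwiners of the infinitesimal representations -/

section
variable {m₁ m₂ : ℕ} {n : Type*}

theorem tens₁_mul_apply (A : Matrix (Fin (m₁ + 1)) (Fin (m₁ + 1)) ℂ)
    (γ : Matrix (Fin (m₁ + 1) × Fin (m₂ + 1)) n ℂ) (a : Fin (m₁ + 1)) (b : Fin (m₂ + 1)) (k : n) :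
    (tens₁ m₂ A * γ) (a, b) k = ∑ a', A a a' * γ (a', b) k := by
  rw [Matrix.mul_apply, Fintype.sum_prod_type]
  refine Finset.sum_congr rfl fun a' _ => ?_
  rw [Finset.sum_eq_single b] <;> simp +contextual [tens₁, eq_comm]

theorem tens₂_mul_apply (B : Matrix (Fin (m₂ + 1)) (Fin (m₂ + 1)) ℂ)
    (γ : Matrix (Fin (m₁ + 1) × Fin (m₂ + 1)) n ℂ) (a : Fin (m₁ + 1)) (b : Fin (m₂ + 1)) (k : n) :
    (tens₂ m₁ B * γ) (a, b) k = ∑ b', B b b' * γ (a, b') k := by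
  rw [Matrix.mul_apply, Fintype.sum_prod_type, Finset.sum_eq_single a]
  · simp [tens₂]
  · intro a' _ h
    exact Finset.sum_eq_zero fun b' _ => by simp [tens₂, h.symm]
  · simp

theorem tens_add_commutator (A A' : Matrix (Fin (m₁ + 1)) (Fin (m₁ + 1)) ℂ)
    (B B' : Matrix (Fin (m₂ + 1)) (Fin (m₂ + 1)) ℂ) :
    (tens₁ m₂ A + tens₂ m₁ B) * (tens₁ m₂ A' + tens₂ m₁ B') -
      (tens₁ m₂ A' + tens₂ m₁ B') * (tens₁ m₂ A + tens₂ m₁ B) =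
      tens₁ m₂ (A * A' - A' * A) + tens₂ m₁ (B * B' - B' * B) := by
  rw [tens₁_sub, tens₂_sub, tens₁_mul, tens₁_mul, tens₂_mul, tens₂_mul]
  simp only [Matrix.add_mul, Matrix.mul_add, tens_comm]
  abel

end

/-- `γ` intertwines the infinitesimal representations on `H^ℓ` and `H^{ℓ₁} ⊗ H^{ℓ₂}`. -/
structure IsLieIntertwiner (m m₁ m₂ : ℕ)
    (γ : Matrix (Fin (m₁ + 1) × Fin (m₂ + 1)) (Fin (m + 1)) ℂ) : Prop where
  opE : (tens₁ m₂ (opE m₁) + tens₂ m₁ (opE m₂)) * γ = γ * opE m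
  opF : (tens₁ m₂ (opF m₁) + tens₂ m₁ (opF m₂)) * γ = γ * opF m
  opH : (tens₁ m₂ (opH m₁) + tens₂ m₁ (opH m₂)) * γ = γ * opH m

section
variable {m m₁ m₂ : ℕ} {γ γ' : Matrix (Fin (m₁ + 1) × Fin (m₂ + 1)) (Fin (m + 1)) ℂ}

/-- The relation for H follows from those for E and F because 2H = [E, F] on both sides. -/
theorem IsIsometricIntertwiner.isLieIntertwiner (h : IsIsometricIntertwiner m m₁ m₂ γ) :
    IsLieIntertwiner m m₁ m₂ γ := by
  obtain ⟨hE, hF⟩ := intertwiner_opE_opF h.1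
  refine ⟨hE, hF, ?_⟩
  have c := tens_add_commutator (m₁ := m₁) (m₂ := m₂) (opE m₁) (opF m₁) (opE m₂) (opF m₂)
  simp only [opE_opF_commutator, tens₁_smul, tens₂_smul] at c
  have h2 : (2 : ℂ) • ((tens₁ m₂ (SphericalSU2.opH m₁) + tens₂ m₁ (SphericalSU2.opH m₂)) * γ -
      γ * SphericalSU2.opH m) = 0 := by
    rw [smul_sub, ← Matrix.smul_mul, smul_add, ← c, ← Matrix.mul_smul, ← opE_opF_commutator,
      Matrix.sub_mul, Matrix.mul_sub, Matrix.mul_assoc, hF, Matrix.mul_assoc, hE,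
      ← Matrix.mul_assoc, hE, ← Matrix.mul_assoc, hF, Matrix.mul_assoc, Matrix.mul_assoc, sub_self]
  exact sub_eq_zero.1 ((smul_eq_zero_iff_right two_ne_zero).1 h2)

theorem IsLieIntertwiner.smul_sub_smul (h : IsLieIntertwiner m m₁ m₂ γ)
    (h' : IsLieIntertwiner m m₁ m₂ γ') (c c' : ℂ) :
    IsLieIntertwiner m m₁ m₂ (c • γ - c' • γ') := by
  constructor
  · rw [Matrix.mul_sub, Matrix.mul_smul, Matrix.mul_smul, h.opE, h'.opE, Matrix.sub_mul,
      Matrix.smul_mul, Matrix.smul_mul]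
  · rw [Matrix.mul_sub, Matrix.mul_smul, Matrix.mul_smul, h.opF, h'.opF, Matrix.sub_mul,
      Matrix.smul_mul, Matrix.smul_mul]
  · rw [Matrix.mul_sub, Matrix.mul_smul, Matrix.mul_smul, h.opH, h'.opH, Matrix.sub_mul,
      Matrix.smul_mul, Matrix.smul_mul]

/-- Intertwiners preserve weights, and with m₁ + m₂ = m + 2d the weight of position (a, b) equals
that of n exactly when a + b = n + d. -/
theorem IsLieIntertwiner.apply_eq_zero (h : IsLieIntertwiner m m₁ m₂ γ) {d : ℕ}
    (hd : m₁ + m₂ = m + 2 * d) {a : Fin (m₁ + 1)} {b : Fin (m₂ + 1)} {n : Fin (m + 1)}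
    (hab : (a : ℕ) + b ≠ n + d) : γ (a, b) n = 0 := by
  have e := congrFun (congrFun h.opH (a, b)) n
  rw [Matrix.add_mul, Matrix.add_apply, tens₁_mul_apply, tens₂_mul_apply] at e
  simp only [SphericalSU2.opH, mul_diagonal, diagonal_apply, ite_mul, zero_mul,
    Finset.sum_ite_eq, Finset.mem_univ, if_true] at e
  have hd' : (m₁ : ℂ) + m₂ = m + 2 * d := by exact_mod_cast hd
  have : (((n : ℕ) : ℂ) + d - ((a : ℕ) + (b : ℕ))) * γ (a, b) n = 0 := by
    linear_combination e - γ (a, b) n / 2 * hd'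
  refine (mul_eq_zero.1 this).resolve_left fun h0 => hab ?_
  exact_mod_cast (sub_eq_zero.1 h0).symm

theorem opE_succ_ne_zero (m : ℕ) (i j : Fin (m + 1)) (h : (i : ℕ) + 1 = j) : opE m i j ≠ 0 := by
  rw [opE, if_pos h, Complex.ofReal_ne_zero]
  refine (Real.sqrt_pos.2 ?_).ne'
  have := j.2
  exact_mod_cast Nat.mul_pos (by omega) (by omega)

/-- Highest weight argument. Column 0 is killed by E, which computes its entries at a + 1 from those
at a; at a = 0 the weight leaves only b = d. Applying F then produces each further column from the
preceding one. -/
theorem IsLieIntertwiner.eq_zero (h : IsLieIntertwiner m m₁ m₂ γ) {d : ℕ}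
    (hd : m₁ + m₂ = m + 2 * d) (hd₂ : d ≤ m₂)
    (h0 : γ (0, ⟨d, Nat.lt_succ_of_le hd₂⟩) 0 = 0) : γ = 0 := by
  have col0 : ∀ (a : ℕ) (ha : a < m₁ + 1) (b : Fin (m₂ + 1)), γ (⟨a, ha⟩, b) 0 = 0 := by
    intro a
    induction a with
    | zero =>
      intro ha b
      by_cases hb : (b : ℕ) = d
      · have : b = ⟨d, Nat.lt_succ_of_le hd₂⟩ := Fin.ext hb
        rw [this]; exact h0
      · exact h.apply_eq_zero hd (by simpa using hb)
    | succ a ih =>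
      intro ha b
      have e := congrFun (congrFun h.opE (⟨a, by omega⟩, b)) 0
      rw [Matrix.add_mul, Matrix.add_apply, tens₁_mul_apply, tens₂_mul_apply, Matrix.mul_apply] at e
      rw [Finset.sum_eq_single ⟨a + 1, ha⟩, Finset.sum_eq_zero, Finset.sum_eq_zero, add_zero] at e
      · exact (mul_eq_zero.1 e).resolve_left (opE_succ_ne_zero _ _ _ rfl)
      · intro k _; simp [SphericalSU2.opE]
      · intro k _; rw [ih, mul_zero]
      · intro k _ hk
        rw [SphericalSU2.opE, if_neg, zero_mul]
        intro hk2; exact hk (Fin.ext hk2.symm)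
      · simp
  have col : ∀ (k : ℕ) (hk : k < m + 1) p, γ p ⟨k, hk⟩ = 0 := by
    intro k
    induction k with
    | zero => intro hk p; exact col0 p.1 p.1.2 p.2
    | succ k ih =>
      intro hk p
      have e := congrFun (congrFun h.opF p) ⟨k, by omega⟩
      rw [Matrix.mul_apply, Matrix.mul_apply, Finset.sum_eq_zero,
        Finset.sum_eq_single ⟨k + 1, hk⟩] at e
      · exact (mul_eq_zero.1 e.symm).resolve_right (opE_succ_ne_zero m ⟨k, by omega⟩ ⟨k + 1, hk⟩ rfl)
      · intro b _ hb
        rw [SphericalSU2.opF, transpose_apply, SphericalSU2.opE, if_neg, mul_zero]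
        intro hk2; exact hb (Fin.ext hk2.symm)
      · simp
      · intro q _; rw [ih, mul_zero]
  ext p k
  exact col k k.2 p

/-- Isometric intertwiners are unique up to a phase. -/
theorem IsIsometricIntertwiner.exists_phase (h : IsIsometricIntertwiner m m₁ m₂ γ)
    (h' : IsIsometricIntertwiner m m₁ m₂ γ') {d : ℕ} (hd : m₁ + m₂ = m + 2 * d) (hd₂ : d ≤ m₂) :
    ∃ c : ℂ, star c * c = 1 ∧ γ' = c • γ := by
  set p : Fin (m₁ + 1) × Fin (m₂ + 1) := (0, ⟨d, Nat.lt_succ_of_le hd₂⟩)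
  -- This combination vanishes at the one entry `p` that determines an intertwiner.
  have hz := (h.isLieIntertwiner.smul_sub_smul h'.isLieIntertwiner (γ' p 0) (γ p 0)).eq_zero hd hd₂
    (by simp [p]; ring)
  have hne : γ p 0 ≠ 0 := fun h0 => by
    have := h.isLieIntertwiner.eq_zero hd hd₂ h0
    have h1 := h.2
    rw [this, Matrix.mul_zero] at h1
    exact zero_ne_one h1
  have e : γ' = (γ' p 0 / γ p 0) • γ := by
    have := sub_eq_zero.1 hz
    rw [div_eq_inv_mul, mul_smul, this, smul_smul, inv_mul_cancel₀ hne, one_smul]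
  refine ⟨_, ?_, e⟩
  set c := γ' p 0 / γ p 0
  have h2 := h'.2
  rw [e, conjTranspose_smul, Matrix.smul_mul, Matrix.mul_smul, h.2, smul_smul] at h2
  simpa using congrFun (congrFun h2 0) 0

/-- The phase of the chosen intertwiner cancels against its conjugate, so any isometric intertwiner
computes the spherical function. -/
theorem spherical_eq (h : IsIsometricIntertwiner m m₁ m₂ γ) {d : ℕ}
    (hd : m₁ + m₂ = m + 2 * d) (hd₂ : d ≤ m₂) (u : K × K) :
    spherical m m₁ m₂ u = γᴴ * tensorRep m₁ m₂ u * γ := by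
  have hex : ∃ β, IsIsometricIntertwiner m m₁ m₂ β := ⟨γ, h⟩
  rw [spherical, dif_pos hex]
  obtain ⟨c, hc, e⟩ := h.exists_phase hex.choose_spec hd hd₂
  rw [e, conjTranspose_smul, Matrix.smul_mul, Matrix.smul_mul, Matrix.mul_smul, smul_smul, hc,
    one_smul]

/-! ### Symmetries of the spherical functions -/

theorem tensorRep_swap (m₁ m₂ : ℕ) (u : K × K) :
    tensorRep m₂ m₁ u.swap = (tensorRep m₁ m₂ u).submatrix Prod.swap Prod.swap := by
  ext ⟨a, b⟩ ⟨a', b'⟩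
  simp [tensorRep, mul_comm]

theorem IsIsometricIntertwiner.swap (h : IsIsometricIntertwiner m m₁ m₂ γ) :
    IsIsometricIntertwiner m m₂ m₁ (γ.submatrix Prod.swap id) := by
  constructor
  · intro k
    have := congrArg (fun A => A.submatrix (Prod.swap : _ → Fin (m₁ + 1) × Fin (m₂ + 1)) id) (h.1 k)
    rw [show ((k, k) : K × K) = Prod.swap (k, k) from rfl, tensorRep_swap]
    have e1 := Matrix.submatrix_mul_equiv (tensorRep m₁ m₂ (k, k)) γ Prod.swap
      (Equiv.prodComm (Fin (m₂ + 1)) (Fin (m₁ + 1))) id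
    have e2 := Matrix.submatrix_mul_equiv γ (rep m k)
      (Prod.swap : Fin (m₂ + 1) × Fin (m₁ + 1) → Fin (m₁ + 1) × Fin (m₂ + 1)) (Equiv.refl _) id
    exact e1.trans (this.trans e2.symm)
  · rw [conjTranspose_submatrix]
    have e1 := Matrix.submatrix_mul_equiv γᴴ γ id
      (Equiv.prodComm (Fin (m₂ + 1)) (Fin (m₁ + 1))) id
    exact e1.trans (by rw [h.2]; rfl)

theorem spherical_swap {d : ℕ} (hd : m₁ + m₂ = m + 2 * d) (hd₁ : d ≤ m₁) (hd₂ : d ≤ m₂)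
    (u : K × K) :
    spherical m m₂ m₁ u.swap = spherical m m₁ m₂ u := by
  by_cases hex : ∃ β, IsIsometricIntertwiner m m₁ m₂ β
  · obtain ⟨β, h⟩ := hex
    rw [spherical_eq h hd hd₂, spherical_eq h.swap (by omega) hd₁, tensorRep_swap,
      conjTranspose_submatrix]
    have e1 := Matrix.submatrix_mul_equiv βᴴ (tensorRep m₁ m₂ u) id
      (Equiv.prodComm (Fin (m₂ + 1)) (Fin (m₁ + 1))) Prod.swap
    have e2 := Matrix.submatrix_mul_equiv (βᴴ * tensorRep m₁ m₂ u) β id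
      (Equiv.prodComm (Fin (m₂ + 1)) (Fin (m₁ + 1))) id
    simp only [Equiv.coe_prodComm] at e1 e2
    rw [e1, e2]; rfl
  · have hex' : ¬ ∃ β, IsIsometricIntertwiner m m₂ m₁ β := fun ⟨β, h⟩ => hex ⟨_, h.swap⟩
    rw [spherical, spherical, dif_neg hex, dif_neg hex']

theorem rep_inv (m : ℕ) (k : K) : rep m k⁻¹ = (rep m k)ᴴ := by
  rw [rep_eq_symPow, rep_eq_symPow, ← symPow_conjTranspose]; rfl

theorem tensorRep_mul (m₁ m₂ : ℕ) (u u' : K × K) :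
    tensorRep m₁ m₂ (u * u') = tensorRep m₁ m₂ u * tensorRep m₁ m₂ u' := by
  simp only [tensorRep, Prod.fst_mul, Prod.snd_mul, rep_mul]
  exact Matrix.mul_kronecker_mul _ _ _ _

/-- Unitarity: take adjoints in the intertwining relation at k⁻¹. -/
theorem IsIsometricIntertwiner.conjTranspose_mul (h : IsIsometricIntertwiner m m₁ m₂ γ) (k : K) :
    γᴴ * tensorRep m₁ m₂ (k, k) = rep m k * γᴴ := by
  have e : tensorRep m₁ m₂ (k⁻¹, k⁻¹) = (tensorRep m₁ m₂ (k, k))ᴴ := by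
    rw [tensorRep_eq, tensorRep_eq, Matrix.conjTranspose_mul, tens₁_conjTranspose,
      tens₂_conjTranspose, ← tens_comm]
    simp only [rep_inv]
  have h1 := h.1 k⁻¹
  rw [e, rep_inv] at h1
  have h2 := congrArg conjTranspose h1
  rwa [Matrix.conjTranspose_mul, Matrix.conjTranspose_mul, conjTranspose_conjTranspose,
    conjTranspose_conjTranspose] at h2

/-- A representative of the nontrivial Weyl group element. -/
def weyl : K := mkK 0 1 (by simp)

theorem rep_weyl (m : ℕ) : rep m weyl = Matrix.of fun i j : Fin (m + 1) =>
    if i = Fin.rev j then (-1 : ℂ) ^ (m - (j : ℕ)) else 0 := matrix_ext_of_psiVec fun v => by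
  rw [rep_eq_symPow, psiVec_vecMul_symPow]
  ext j
  have hj : (j : ℕ) ≤ m := Nat.lt_succ_iff.1 j.2
  simp only [Matrix.vecMul, dotProduct, Matrix.of_apply, mul_ite, mul_zero, Finset.sum_ite_eq', Finset.mem_univ,
    if_true]
  simp only [psiVec, weyl, mkK, Fin.val_rev, Nat.reduceSubDiff]
  rw [Nat.choose_symm hj, Nat.sub_sub_self hj]
  simp [Matrix.vecHead, Matrix.vecTail]
  rw [neg_pow]; ring

theorem weyl_mul_torus (t : ℝ) : weyl * torus t = torus (-t) * weyl := by
  apply Subtype.ext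
  ext i j
  fin_cases i <;> fin_cases j <;>
    simp [weyl, mkK, torus]
  · congr 1; ring
  · congr 1; ring

/-- The Weyl element conjugates a_t into a_{-t} and acts on H^ℓ by an antidiagonal matrix of signs.
On a diagonal entry the same sign occurs on both sides and cancels. -/
theorem spherical_rev (m m₁ m₂ : ℕ) (t : ℝ) (j : Fin (m + 1)) :
    spherical m m₁ m₂ (aElt (-t)) (Fin.rev j) (Fin.rev j) = spherical m m₁ m₂ (aElt t) j j := by
  rw [spherical, spherical]
  split_ifs with hex
  · set β := hex.choose
    have h : IsIsometricIntertwiner m m₁ m₂ β := hex.choose_spec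
    have e : βᴴ * tensorRep m₁ m₂ (aElt (-t)) * β * rep m weyl =
        rep m weyl * (βᴴ * tensorRep m₁ m₂ (aElt t) * β) := by
      rw [Matrix.mul_assoc _ β, ← h.1, ← Matrix.mul_assoc, Matrix.mul_assoc βᴴ, ← tensorRep_mul,
        ← Matrix.mul_assoc, ← Matrix.mul_assoc, ← h.conjTranspose_mul, Matrix.mul_assoc βᴴ _
        (tensorRep m₁ m₂ (aElt t)), ← tensorRep_mul]
      congr 3
      rw [aElt, aElt, Prod.mk_mul_mk, Prod.mk_mul_mk, weyl_mul_torus, weyl_mul_torus]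
    have := congrFun (congrFun e (Fin.rev j)) j
    rw [rep_weyl, Matrix.mul_apply, Matrix.mul_apply] at this
    simp only [Matrix.of_apply, mul_ite, mul_zero, ite_mul, zero_mul, Finset.sum_ite_eq', Finset.mem_univ, if_true,
      Fin.rev_inj, Finset.sum_ite_eq] at this
    have h1 : ((-1 : ℂ) ^ (m - (j : ℕ))) ≠ 0 := pow_ne_zero _ (by norm_num)
    rw [mul_comm] at this
    exact mul_left_cancel₀ h1 this
  · rfl

/-- `J Φ_d J = Φ_d` on `A_*`. -/
theorem fullSpherical_rev_rev (m d : ℕ) (t : ℝ) (i j : Fin (m + 1)) :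
    fullSpherical m d (aElt t) (Fin.rev i) (Fin.rev j) = fullSpherical m d (aElt t) i j := by
  have hi : (i : ℕ) ≤ m := Nat.lt_succ_iff.1 i.2
  have e1 : ((Fin.rev i : Fin (m + 1)) : ℕ) = m - i := by rw [Fin.val_rev]; omega
  simp only [fullSpherical, e1, Nat.sub_sub_self hi]
  -- Reversing the row exchanges ℓ₁ and ℓ₂, at the price of t ↦ -t; reversing the column undoes that
  -- sign by `spherical_rev`.
  have := spherical_swap (m := m) (m₁ := d + i) (m₂ := d + (m - i)) (d := d) (by omega) (by omega)
    (by omega) (aElt (-t))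
  rw [← spherical_rev m (d + i) (d + (m - i)), ← this]
  simp [aElt]

/-! ### Spherical functions on the torus -/

theorem tensorRep_aElt_comm_opH (m₁ m₂ : ℕ) (t : ℝ) :
    Commute (tensorRep m₁ m₂ (aElt t)) (tens₁ m₂ (opH m₁)) ∧
      Commute (tensorRep m₁ m₂ (aElt t)) (tens₂ m₁ (opH m₂)) := by
  have h1 : Commute (rep m₁ (torus t)) (opH m₁) := by
    rw [rep_torus, opH]; exact Matrix.commute_diagonal _ _
  have h2 : Commute (rep m₂ (torus (-t))) (opH m₂) := by
    rw [rep_torus, opH]; exact Matrix.commute_diagonal _ _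
  rw [tensorRep_eq]
  constructor
  · refine Commute.mul_left ?_ (tens_comm _ _).symm
    rw [Commute, SemiconjBy, ← tens₁_mul, ← tens₁_mul]; exact congrArg _ h1
  · refine Commute.mul_left (tens_comm _ _) ?_
    rw [Commute, SemiconjBy, ← tens₂_mul, ← tens₂_mul]; exact congrArg _ h2

theorem IsLieIntertwiner.conjTranspose_opE (h : IsLieIntertwiner m m₁ m₂ γ) :
    γᴴ * (tens₁ m₂ (SphericalSU2.opE m₁) + tens₂ m₁ (SphericalSU2.opE m₂)) =
      SphericalSU2.opE m * γᴴ := by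
  have := congrArg conjTranspose h.opF
  simpa only [Matrix.conjTranspose_mul, conjTranspose_add, tens₁_conjTranspose,
    tens₂_conjTranspose, opF_conjTranspose] using this

theorem IsLieIntertwiner.conjTranspose_opF (h : IsLieIntertwiner m m₁ m₂ γ) :
    γᴴ * (tens₁ m₂ (SphericalSU2.opF m₁) + tens₂ m₁ (SphericalSU2.opF m₂)) =
      SphericalSU2.opF m * γᴴ := by
  have := congrArg conjTranspose h.opE
  simpa only [Matrix.conjTranspose_mul, conjTranspose_add, tens₁_conjTranspose,
    tens₂_conjTranspose, opE_conjTranspose] using this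

theorem IsLieIntertwiner.conjTranspose_opH (h : IsLieIntertwiner m m₁ m₂ γ) :
    γᴴ * (tens₁ m₂ (SphericalSU2.opH m₁) + tens₂ m₁ (SphericalSU2.opH m₂)) =
      SphericalSU2.opH m * γᴴ := by
  have := congrArg conjTranspose h.opH
  simpa only [Matrix.conjTranspose_mul, conjTranspose_add, tens₁_conjTranspose,
    tens₂_conjTranspose, opH_conjTranspose] using this

/-- a_t commutes with the weight operators of both factors, so γ^* a_t γ commutes with `opH m`,
whose eigenvalues are distinct. -/
theorem spherical_aElt_apply_eq_zero (m m₁ m₂ : ℕ) (t : ℝ) {i j : Fin (m + 1)} (hij : i ≠ j) :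
    spherical m m₁ m₂ (aElt t) i j = 0 := by
  rw [spherical]
  split_ifs with hex
  · set β := hex.choose
    have h : IsLieIntertwiner m m₁ m₂ β := hex.choose_spec.isLieIntertwiner
    have hc : Commute (tensorRep m₁ m₂ (aElt t)) (tens₁ m₂ (opH m₁) + tens₂ m₁ (opH m₂)) :=
      (tensorRep_aElt_comm_opH m₁ m₂ t).1.add_right (tensorRep_aElt_comm_opH m₁ m₂ t).2
    have e : βᴴ * tensorRep m₁ m₂ (aElt t) * β * opH m =
        opH m * (βᴴ * tensorRep m₁ m₂ (aElt t) * β) := by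
      rw [Matrix.mul_assoc _ β, ← h.opH, ← Matrix.mul_assoc, Matrix.mul_assoc βᴴ, hc.eq,
        ← Matrix.mul_assoc, ← Matrix.mul_assoc, ← Matrix.mul_assoc, h.conjTranspose_opH]
    have := congrFun (congrFun e i) j
    rw [opH, mul_diagonal, diagonal_mul] at this
    have h0 : (((j : ℕ) : ℂ) - (i : ℕ)) * (βᴴ * tensorRep m₁ m₂ (aElt t) * β) i j = 0 := by
      linear_combination -this
    refine (mul_eq_zero.1 h0).resolve_left fun h1 => hij (Fin.ext ?_)
    exact_mod_cast (sub_eq_zero.1 h1).symm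
  · rfl

end

/-! ### The radial part of the Casimir operator -/

/-- The left side involves only the diagonal operators e₁ + e₂ and f₁ + f₂ on either side of a,
which intertwiners turn into operators on H^ℓ. Moving everything to the right of a, the weights u
and v are such that all mixed terms and all terms of the second factor cancel. -/
theorem radial_part_aux {R : Type*} [Ring R] [Algebra ℂ R] {a e₁ e₂ f₁ f₂ h₁ h₂ : R} {u v : ℂ}
    (huv : u * v = 1)
    (he₁ : e₁ * a = v • (a * e₁)) (he₂ : e₂ * a = u • (a * e₂))
    (hf₁ : f₁ * a = u • (a * f₁)) (hf₂ : f₂ * a = v • (a * f₂))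
    (c₁ : e₁ * f₁ = f₁ * e₁ + (2 : ℂ) • h₁) (c₂ : e₂ * f₂ = f₂ * e₂ + (2 : ℂ) • h₂)
    (c₁₂ : e₁ * f₂ = f₂ * e₁) (c₂₁ : e₂ * f₁ = f₁ * e₂) :
    (f₁ + f₂) * ((e₁ + e₂) * a) - u • ((f₁ + f₂) * a * (e₁ + e₂)) -
      v • ((e₁ + e₂) * a * (f₁ + f₂)) + a * (e₁ + e₂) * (f₁ + f₂) =
      (2 - u ^ 2 - v ^ 2) • (a * (f₁ * e₁)) + (2 - 2 * v ^ 2) • (a * h₁) := by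
  have r : ∀ x y z : R, ∀ c : ℂ, x * a = c • (a * y) → x * (a * z) = c • (a * (y * z)) :=
    fun x y z c h => by rw [← mul_assoc, h, smul_mul_assoc, mul_assoc]
  have ff : ∀ z, f₁ * (a * z) = u • (a * (f₁ * z)) := fun z => r _ _ _ _ hf₁
  have ff' : ∀ z, f₂ * (a * z) = v • (a * (f₂ * z)) := fun z => r _ _ _ _ hf₂
  simp only [add_mul, mul_add, he₁, he₂, hf₁, hf₂, mul_smul_comm, smul_mul_assoc, mul_assoc, ff, ff',
    c₁, c₂, c₁₂, c₂₁, smul_add, smul_smul]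
  match_scalars <;> first | ring1 | linear_combination huv | linear_combination -huv |
    linear_combination 2 * huv | linear_combination -2 * huv

/-- The Casimir identity for `a = a_t`, in terms of the action of the diagonal subalgebra. -/
theorem radial_part {R : Type*} [Ring R] [Algebra ℂ R] {a e₁ e₂ f₁ f₂ h₁ h₂ : R} {u v s c κ : ℂ}
    (hu : u = c + Complex.I * s) (hv : v = c - Complex.I * s) (hcs : c ^ 2 + s ^ 2 = 1)
    (he₁ : e₁ * a = v • (a * e₁)) (he₂ : e₂ * a = u • (a * e₂))
    (hf₁ : f₁ * a = u • (a * f₁)) (hf₂ : f₂ * a = v • (a * f₂))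
    (c₁ : e₁ * f₁ = f₁ * e₁ + (2 : ℂ) • h₁) (c₂ : e₂ * f₂ = f₂ * e₂ + (2 : ℂ) • h₂)
    (c₁₂ : e₁ * f₂ = f₂ * e₁) (c₂₁ : e₂ * f₁ = f₁ * e₂) (ch : h₁ * h₂ = h₂ * h₁)
    (hκ : h₁ * h₁ + h₁ + f₁ * e₁ = κ • 1) :
    (4 * κ * s ^ 2) • a =
      (s ^ 2) • (a * (h₁ - h₂) * (h₁ - h₂)) - (2 * Complex.I * s * c) • (a * (h₁ - h₂)) +
      (2 * s ^ 2) • (a * (h₁ - h₂) * (h₁ + h₂)) - (2 * Complex.I * s * c) • (a * (h₁ + h₂)) +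
      (s ^ 2) • (a * (h₁ + h₂) * (h₁ + h₂)) +
      ((f₁ + f₂) * ((e₁ + e₂) * a) - u • ((f₁ + f₂) * a * (e₁ + e₂)) -
      v • ((e₁ + e₂) * a * (f₁ + f₂)) + a * (e₁ + e₂) * (f₁ + f₂)) := by
  have hI := Complex.I_sq
  have huv : u * v = 1 := by rw [hu, hv]; linear_combination hcs - s ^ 2 * hI
  rw [radial_part_aux huv he₁ he₂ hf₁ hf₂ c₁ c₂ c₁₂ c₂₁]
  have e1 : (2 - u ^ 2 - v ^ 2) = 4 * s ^ 2 := by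
    rw [hu, hv]; linear_combination -2 * hcs - 2 * s ^ 2 * hI
  have e2 : (2 - 2 * v ^ 2) = 4 * s ^ 2 + 4 * Complex.I * s * c := by
    rw [hv]; linear_combination -2 * hcs - 2 * s ^ 2 * hI
  have e3 : (4 * κ * s ^ 2) • a = (4 * s ^ 2) • (a * (κ • (1 : R))) := by
    rw [mul_smul_comm, mul_one, smul_smul]; congr 1; ring
  rw [e1, e2, e3, ← hκ]
  -- Put D = h₁ - h₂ and H = h₁ + h₂. Then 2h₁ = D + H and 4h₁² = (D + H)²; D becomes d/dt up to a
  -- factor i, while H passes through the intertwiner.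
  simp only [mul_add, add_mul, mul_sub, sub_mul, mul_assoc, ch]
  module

theorem rep_torus_opE (m : ℕ) (t : ℝ) :
    opE m * rep m (torus t) = Complex.exp (-(Complex.I * t)) • (rep m (torus t) * opE m) := by
  rw [rep_torus]
  ext i j
  rw [mul_diagonal, Matrix.smul_apply, diagonal_mul, opE]
  split_ifs with h
  · have : ((j : ℕ) : ℂ) = (i : ℕ) + 1 := by exact_mod_cast h.symm
    rw [smul_eq_mul, ← mul_assoc, ← Complex.exp_add, mul_comm]
    congr 2
    rw [this]; ring
  · simp

theorem rep_torus_opF (m : ℕ) (t : ℝ) :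
    opF m * rep m (torus t) = Complex.exp (Complex.I * t) • (rep m (torus t) * opF m) := by
  rw [rep_torus]
  ext i j
  rw [mul_diagonal, Matrix.smul_apply, diagonal_mul, opF, transpose_apply, opE]
  split_ifs with h
  · have : ((i : ℕ) : ℂ) = (j : ℕ) + 1 := by exact_mod_cast h.symm
    rw [smul_eq_mul, ← mul_assoc, ← Complex.exp_add, mul_comm]
    congr 2
    rw [this]; ring
  · simp

theorem radial_tensorRep (m₁ m₂ : ℕ) (t : ℝ) :
    let a := tensorRep m₁ m₂ (aElt t)
    let E := tens₁ m₂ (opE m₁) + tens₂ m₁ (opE m₂)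
    let F := tens₁ m₂ (opF m₁) + tens₂ m₁ (opF m₂)
    let H := tens₁ m₂ (opH m₁) + tens₂ m₁ (opH m₂)
    let D := tens₁ m₂ (opH m₁) - tens₂ m₁ (opH m₂)
    let s : ℂ := (Real.sin t : ℝ)
    let c : ℂ := (Real.cos t : ℝ)
    (4 * ((m₁ : ℂ) / 2 * (m₁ / 2 + 1)) * s ^ 2) • a =
      (s ^ 2) • (a * D * D) - (2 * Complex.I * s * c) • (a * D) +
      (2 * s ^ 2) • (a * D * H) - (2 * Complex.I * s * c) • (a * H) + (s ^ 2) • (a * H * H) +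
      (F * (E * a) - Complex.exp (Complex.I * t) • (F * a * E) -
        Complex.exp (-(Complex.I * t)) • (E * a * F) + a * E * F) := by
  intro a E F H D s c
  have ha : a = tens₁ m₂ (rep m₁ (torus t)) * tens₂ m₁ (rep m₂ (torus (-t))) := tensorRep_eq _ _ _
  have left : ∀ (X Y : Matrix (Fin (m₁ + 1)) (Fin (m₁ + 1)) ℂ) (z : ℂ),
      X * rep m₁ (torus t) = z • (rep m₁ (torus t) * Y) → tens₁ m₂ X * a = z • (a * tens₁ m₂ Y) := by
    intro X Y z h
    rw [ha, ← mul_assoc, ← tens₁_mul, h, tens₁_smul, tens₁_mul, smul_mul_assoc, mul_assoc, tens_comm,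
      mul_assoc]
  have right : ∀ (X Y : Matrix (Fin (m₂ + 1)) (Fin (m₂ + 1)) ℂ) (z : ℂ),
      X * rep m₂ (torus (-t)) = z • (rep m₂ (torus (-t)) * Y) →
        tens₂ m₁ X * a = z • (a * tens₂ m₁ Y) := by
    intro X Y z h
    rw [ha, ← mul_assoc, ← tens_comm, mul_assoc, ← tens₂_mul, h, tens₂_smul, tens₂_mul,
      mul_smul_comm, mul_assoc]
  have hexp : Complex.exp (Complex.I * t) = c + Complex.I * s := by
    rw [mul_comm, Complex.exp_mul_I]; simp [c, s, mul_comm]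
  have hexp' : Complex.exp (-(Complex.I * t)) = c - Complex.I * s := by
    rw [show -(Complex.I * (t : ℂ)) = ((-t : ℝ) : ℂ) * Complex.I by push_cast; ring, Complex.exp_mul_I]
    simp [c, s]; ring
  refine radial_part hexp hexp' (cos_sq_add_sin_sq_cast t) (left _ _ _ (rep_torus_opE _ _))
    (right _ _ _ ?_) (left _ _ _ (rep_torus_opF _ _)) (right _ _ _ ?_) ?_ ?_ (tens_comm _ _)
    (tens_comm _ _).symm (tens_comm _ _) ?_
  · rw [rep_torus_opE]; simp
  · rw [rep_torus_opF]; simp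
  · rw [← tens₁_mul, ← tens₁_mul, ← tens₁_smul, ← tens₁_add, ← opE_opF_commutator]; simp
  · rw [← tens₂_mul, ← tens₂_mul, ← tens₂_smul, ← tens₂_add, ← opE_opF_commutator]; simp
  · rw [← tens₁_mul, ← tens₁_mul, ← tens₁_add, ← tens₁_add, casimir, tens₁_smul, tens₁_one]

/-! ### Orthogonality of spherical functions on the torus -/

theorem hasEntryDerivAt_rep_torus (m : ℕ) (t : ℝ) :
    HasEntryDerivAt (fun t => rep m (torus t)) (rep m (torus t) * (Complex.I • opH m)) t := by
  intro i j
  have h : rep m (torus t) * (Complex.I • opH m) = diagonal fun i : Fin (m + 1) =>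
      Complex.exp (Complex.I * t * (((m : ℂ) - 2 * (i : ℕ)) / 2)) *
        (Complex.I * (((m : ℂ) - 2 * (i : ℕ)) / 2)) := by
    rw [rep_torus, opH, ← diagonal_smul, diagonal_mul_diagonal]; rfl
  rw [h]
  simp only [rep_torus, diagonal_apply]
  split_ifs with hij
  · have h1 : HasDerivAt (fun s : ℝ => Complex.I * (s : ℂ) * (((m : ℂ) - 2 * (i : ℕ)) / 2))
        (Complex.I * (((m : ℂ) - 2 * (i : ℕ)) / 2)) t := by
      simpa using ((Complex.ofRealCLM.hasDerivAt (x := t)).const_mul Complex.I).mul_const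
        (((m : ℂ) - 2 * (i : ℕ)) / 2)
    exact h1.cexp
  · exact hasDerivAt_const _ _

theorem hasEntryDerivAt_rep_torus_neg (m : ℕ) (t : ℝ) :
    HasEntryDerivAt (fun t => rep m (torus (-t))) (-(rep m (torus (-t)) * (Complex.I • opH m))) t := by
  intro i j
  have h := (hasEntryDerivAt_rep_torus m (-t) i j).scomp t (hasDerivAt_neg t)
  simpa [Function.comp_def] using h

theorem hasEntryDerivAt_tensorRep_aElt (m₁ m₂ : ℕ) (t : ℝ) :
    HasEntryDerivAt (fun t => tensorRep m₁ m₂ (aElt t))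
      (Complex.I • (tensorRep m₁ m₂ (aElt t) * (tens₁ m₂ (opH m₁) - tens₂ m₁ (opH m₂)))) t := by
  have h := (hasEntryDerivAt_rep_torus m₁ t).kronecker (hasEntryDerivAt_rep_torus_neg m₂ t)
  have e : kroneckerMap (· * ·) (rep m₁ (torus t) * (Complex.I • opH m₁)) (rep m₂ (torus (-t))) +
      kroneckerMap (· * ·) (rep m₁ (torus t)) (-(rep m₂ (torus (-t)) * (Complex.I • opH m₂))) =
      Complex.I • (tensorRep m₁ m₂ (aElt t) * (tens₁ m₂ (opH m₁) - tens₂ m₁ (opH m₂))) := by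
    rw [← neg_one_smul ℂ (rep m₂ (torus (-t)) * _), ← tens₁_mul_tens₂, ← tens₁_mul_tens₂, tensorRep_eq, tens₁_mul, tens₂_smul,
      tens₂_mul, tens₁_smul, tens₂_smul, mul_sub, mul_assoc (tens₁ m₂ _) (tens₂ m₁ _) (tens₁ m₂ _),
      ← tens_comm]
    simp only [aElt, smul_mul_assoc, mul_smul_comm, mul_assoc, smul_sub]
    module
  rw [e] at h
  exact h

/-- E, F and H slide through γ and γ^* onto H^ℓ. D does not; its powers stay next to a, where they
will be derivatives in t. -/
theorem sandwich_radial {N n : Type*} [Fintype N] [Fintype n] {γ : Matrix N n ℂ}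
    {a D E F H : Matrix N N ℂ} {E' F' H' : Matrix n n ℂ} {k s c s' u v : ℂ}
    (hE : E * γ = γ * E') (hF : F * γ = γ * F') (hH : H * γ = γ * H')
    (hE' : γᴴ * E = E' * γᴴ) (hF' : γᴴ * F = F' * γᴴ)
    (key : k • a = s • (a * D * D) - c • (a * D) + s' • (a * D * H) - c • (a * H) + s • (a * H * H) +
      (F * (E * a) - u • (F * a * E) - v • (E * a * F) + a * E * F)) :
    k • (γᴴ * a * γ) = s • (γᴴ * (a * (D * D)) * γ) - c • (γᴴ * (a * D) * γ) +
      s' • (γᴴ * (a * D) * γ * H') - c • (γᴴ * a * γ * H') + s • (γᴴ * a * γ * H' * H') +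
      (F' * (E' * (γᴴ * a * γ)) - u • (F' * (γᴴ * a * γ) * E') - v • (E' * (γᴴ * a * γ) * F') +
        γᴴ * a * γ * E' * F') := by
  have key := congrArg (fun M => γᴴ * M * γ) key
  simp only [Matrix.mul_add, Matrix.add_mul, Matrix.mul_sub, Matrix.sub_mul, Matrix.mul_smul,
    Matrix.smul_mul] at key
  rw [key]
  have l : ∀ {X : Matrix N N ℂ} {X' : Matrix n n ℂ}, γᴴ * X = X' * γᴴ →
      ∀ M : Matrix N n ℂ, γᴴ * (X * M) = X' * (γᴴ * M) := fun h M => by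
    rw [← Matrix.mul_assoc, h, Matrix.mul_assoc]
  have r : ∀ {X : Matrix N N ℂ} {X' : Matrix n n ℂ}, X * γ = γ * X' →
      ∀ M : Matrix n n ℂ, X * (γ * M) = γ * (X' * M) := fun h M => by
    rw [← Matrix.mul_assoc, h, Matrix.mul_assoc]
  simp only [Matrix.mul_assoc, hE, hF, hH, l hE', l hF', r hE, r hH]

section Orthogonality
variable {m m₁ m₂ : ℕ} (γ : Matrix (Fin (m₁ + 1) × Fin (m₂ + 1)) (Fin (m + 1)) ℂ)

/-- `γ^* (a_t D^k) γ`, where `D = H ⊗ 1 - 1 ⊗ H`. -/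
def sandwich (k : ℕ) (t : ℝ) : Matrix (Fin (m + 1)) (Fin (m + 1)) ℂ :=
  γᴴ * (tensorRep m₁ m₂ (aElt t) * (tens₁ m₂ (opH m₁) - tens₂ m₁ (opH m₂)) ^ k) * γ

theorem hasEntryDerivAt_sandwich (k : ℕ) (t : ℝ) :
    HasEntryDerivAt (sandwich γ k) (Complex.I • sandwich γ (k + 1) t) t := by
  have := (((hasEntryDerivAt_tensorRep_aElt m₁ m₂ t).mul_const
    ((tens₁ m₂ (opH m₁) - tens₂ m₁ (opH m₂)) ^ k)).const_mul γᴴ).mul_const γ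
  have e : Complex.I • sandwich γ (k + 1) t = γᴴ * (Complex.I • (tensorRep m₁ m₂ (aElt t) *
      (tens₁ m₂ (opH m₁) - tens₂ m₁ (opH m₂))) * (tens₁ m₂ (opH m₁) - tens₂ m₁ (opH m₂)) ^ k) * γ := by
    rw [sandwich, pow_succ', ← Matrix.mul_assoc (tensorRep m₁ m₂ (aElt t)), Matrix.smul_mul,
      Matrix.mul_smul, Matrix.smul_mul]
  rw [e]
  exact this

variable {γ}

/-- By `hasEntryDerivAt_sandwich`, d/dt acts as i times k ↦ k + 1, so this is a second order linear
differential equation for t ↦ γ^* a_t γ. -/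
theorem IsLieIntertwiner.radial_ode (h : IsLieIntertwiner m m₁ m₂ γ) (t : ℝ) :
    let s : ℂ := (Real.sin t : ℝ)
    let c : ℂ := (Real.cos t : ℝ)
    (4 * ((m₁ : ℂ) / 2 * (m₁ / 2 + 1)) * s ^ 2) • sandwich γ 0 t =
      (s ^ 2) • sandwich γ 2 t - (2 * Complex.I * s * c) • sandwich γ 1 t +
      (2 * s ^ 2) • (sandwich γ 1 t * SphericalSU2.opH m) -
      (2 * Complex.I * s * c) • (sandwich γ 0 t * SphericalSU2.opH m) +
      (s ^ 2) • (sandwich γ 0 t * SphericalSU2.opH m * SphericalSU2.opH m) +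
      (SphericalSU2.opF m * (SphericalSU2.opE m * sandwich γ 0 t) -
        Complex.exp (Complex.I * t) • (SphericalSU2.opF m * sandwich γ 0 t * SphericalSU2.opE m) -
        Complex.exp (-(Complex.I * t)) •
          (SphericalSU2.opE m * sandwich γ 0 t * SphericalSU2.opF m) +
        sandwich γ 0 t * SphericalSU2.opE m * SphericalSU2.opF m) := by
  have := sandwich_radial h.opE h.opF h.opH h.conjTranspose_opE h.conjTranspose_opF
    (radial_tensorRep m₁ m₂ t)
  simpa only [sandwich, pow_zero, pow_one, pow_two (tens₁ m₂ _ - _), Matrix.mul_one] using this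

end Orthogonality

section Orthogonality
variable {m m₁ m₂ m₁' m₂' : ℕ} {γ : Matrix (Fin (m₁ + 1) × Fin (m₂ + 1)) (Fin (m + 1)) ℂ}
  {γ' : Matrix (Fin (m₁' + 1) × Fin (m₂' + 1)) (Fin (m + 1)) ℂ}

/-- Pair the equation of f with g^* and subtract the adjoint equation of g paired with f. Cyclicity
of the trace, F = E^* and v = ū cancel all terms in E and F; what remains is assembled into a
derivative in `hasDerivAt_green`. -/
theorem trace_green {n : Type*} [Fintype n] {f₀ f₁ f₂ g₀ g₁ g₂ E F H : Matrix n n ℂ}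
    {k k' s c u v : ℂ} (hs : star s = s) (hc : star c = c) (hu : star u = v) (hk' : star k' = k')
    (hE : Eᴴ = F) (hH : Hᴴ = H)
    (hf : (k * s ^ 2) • f₀ = (s ^ 2) • f₂ - (2 * Complex.I * s * c) • f₁ +
      (2 * s ^ 2) • (f₁ * H) - (2 * Complex.I * s * c) • (f₀ * H) + (s ^ 2) • (f₀ * H * H) +
      (F * (E * f₀) - u • (F * f₀ * E) - v • (E * f₀ * F) + f₀ * E * F))
    (hg : (k' * s ^ 2) • g₀ = (s ^ 2) • g₂ - (2 * Complex.I * s * c) • g₁ +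
      (2 * s ^ 2) • (g₁ * H) - (2 * Complex.I * s * c) • (g₀ * H) + (s ^ 2) • (g₀ * H * H) +
      (F * (E * g₀) - u • (F * g₀ * E) - v • (E * g₀ * F) + g₀ * E * F)) :
    (k - k') * s ^ 2 * (f₀ * g₀ᴴ).trace =
      -(2 * Complex.I * s * c) * ((f₁ * g₀ᴴ).trace + (f₀ * g₁ᴴ).trace + 2 * (f₀ * H * g₀ᴴ).trace) +
      s ^ 2 * ((f₂ * g₀ᴴ).trace - (f₀ * g₂ᴴ).trace +
        2 * (f₁ * H * g₀ᴴ).trace - 2 * (f₀ * H * g₁ᴴ).trace) := by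
  have hF : Fᴴ = E := by rw [← hE, conjTranspose_conjTranspose]
  have hv : star v = u := by rw [← hu, star_star]
  have p := congrArg (fun M => (M * g₀ᴴ).trace) hf
  have q := congrArg (fun M => (f₀ * Mᴴ).trace) hg
  have t1 : (F * (E * f₀) * g₀ᴴ).trace = (f₀ * g₀ᴴ * F * E).trace := by
    rw [← Matrix.mul_assoc, Matrix.mul_assoc, Matrix.trace_mul_comm, ← Matrix.mul_assoc]
  have t2 : (F * f₀ * E * g₀ᴴ).trace = (f₀ * E * g₀ᴴ * F).trace := by
    rw [Matrix.mul_assoc, Matrix.mul_assoc, Matrix.trace_mul_comm, ← Matrix.mul_assoc]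
  have t3 : (E * f₀ * F * g₀ᴴ).trace = (f₀ * F * g₀ᴴ * E).trace := by
    rw [Matrix.mul_assoc, Matrix.mul_assoc, Matrix.trace_mul_comm, ← Matrix.mul_assoc]
  simp only [conjTranspose_add, conjTranspose_sub, conjTranspose_smul, Matrix.conjTranspose_mul, hE,
    hF, hH, star_mul', star_pow, hs, hc, hu, hv, hk', Complex.star_def, Complex.conj_I,
    map_ofNat] at q
  simp only [Matrix.add_mul, Matrix.sub_mul, Matrix.mul_add, Matrix.mul_sub, Matrix.smul_mul, Matrix.mul_smul, trace_add,
    trace_sub, trace_smul, smul_eq_mul, t1, t2, t3] at p q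
  simp only [← Matrix.mul_assoc] at p q ⊢
  linear_combination p - q

theorem HasEntryDerivAt.trace_mul_conjTranspose {n : Type*} [Fintype n]
    {f g : ℝ → Matrix n n ℂ} {f' g' : Matrix n n ℂ} {t : ℝ}
    (hf : HasEntryDerivAt f (Complex.I • f') t) (hg : HasEntryDerivAt g (Complex.I • g') t) :
    HasDerivAt (fun t => (f t * (g t)ᴴ).trace)
      (Complex.I * ((f' * (g t)ᴴ).trace - (f t * g'ᴴ).trace)) t := by
  refine ((hf.mul hg.conjTranspose).trace).congr_deriv ?_
  rw [trace_add, conjTranspose_smul, Matrix.smul_mul, Matrix.mul_smul, trace_smul, trace_smul]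
  simp only [smul_eq_mul, Complex.star_def, Complex.conj_I]
  ring

/-- Green's identity. The differentiated expression plays the role of the Wronskian, and its factor
sin² t makes the boundary terms vanish at multiples of π. -/
theorem hasDerivAt_green (h : IsLieIntertwiner m m₁ m₂ γ) (h' : IsLieIntertwiner m m₁' m₂' γ')
    (t : ℝ) :
    HasDerivAt (fun t : ℝ => -(Complex.I * ((Real.sin t : ℝ) : ℂ) ^ 2) *
        ((sandwich γ 1 t * (sandwich γ' 0 t)ᴴ).trace + (sandwich γ 0 t * (sandwich γ' 1 t)ᴴ).trace +
          2 * (sandwich γ 0 t * opH m * (sandwich γ' 0 t)ᴴ).trace))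
      ((4 * ((m₁ : ℂ) / 2 * (m₁ / 2 + 1)) - 4 * ((m₁' : ℂ) / 2 * (m₁' / 2 + 1))) *
        ((Real.sin t : ℝ) : ℂ) ^ 2 * (sandwich γ 0 t * (sandwich γ' 0 t)ᴴ).trace) t := by
  have d0 := hasEntryDerivAt_sandwich γ 0 t
  have d1 := hasEntryDerivAt_sandwich γ 1 t
  have e0 := hasEntryDerivAt_sandwich γ' 0 t
  have e1 := hasEntryDerivAt_sandwich γ' 1 t
  have dH : HasEntryDerivAt (fun t => sandwich γ 0 t * opH m)
      (Complex.I • (sandwich γ (0 + 1) t * opH m)) t := by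
    simpa only [Matrix.smul_mul] using d0.mul_const (opH m)
  have hs : HasDerivAt (fun t : ℝ => -(Complex.I * ((Real.sin t : ℝ) : ℂ) ^ 2))
      (-(Complex.I * (2 * ((Real.sin t : ℝ) : ℂ) * ((Real.cos t : ℝ) : ℂ)))) t := by
    have := (((Real.hasDerivAt_sin t).ofReal_comp.fun_pow 2).const_mul Complex.I).fun_neg
    refine this.congr_deriv ?_
    simp
  have key := hs.mul (((d1.trace_mul_conjTranspose e0).add (d0.trace_mul_conjTranspose e1)).add
    ((dH.trace_mul_conjTranspose e0).const_mul 2))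
  refine key.congr_deriv ?_
  have g := trace_green (u := Complex.exp (Complex.I * t)) (v := Complex.exp (-(Complex.I * t)))
    (s := ((Real.sin t : ℝ) : ℂ)) (c := ((Real.cos t : ℝ) : ℂ))
    (Complex.conj_ofReal _) (Complex.conj_ofReal _)
    (by simp [← Complex.exp_conj])
    (by simp) (opE_conjTranspose m) (opH_conjTranspose m) (h.radial_ode t) (h'.radial_ode t)
  rw [g]
  simp only [Pi.add_apply, zero_add, one_add_one_eq_two]
  linear_combination (-((Real.sin t : ℝ) : ℂ) ^ 2 * ((sandwich γ 2 t * (sandwich γ' 0 t)ᴴ).trace -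
    (sandwich γ 0 t * (sandwich γ' 2 t)ᴴ).trace + 2 * (sandwich γ 1 t * opH m * (sandwich γ' 0 t)ᴴ).trace
    - 2 * (sandwich γ 0 t * opH m * (sandwich γ' 1 t)ᴴ).trace)) * Complex.I_sq

theorem continuous_sandwich_trace (k l : ℕ) :
    Continuous fun t => (sandwich γ k t * (sandwich γ' l t)ᴴ).trace :=
  continuous_iff_continuousAt.2 fun t => ((hasEntryDerivAt_sandwich γ k t).trace_mul_conjTranspose
    (hasEntryDerivAt_sandwich γ' l t)).continuousAt

theorem integral_sandwich_eq_zero (h : IsLieIntertwiner m m₁ m₂ γ)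
    (h' : IsLieIntertwiner m m₁' m₂' γ') (hne : m₁ ≠ m₁') {A B : ℝ} (hA : Real.sin A = 0)
    (hB : Real.sin B = 0) :
    ∫ t in A..B, ((Real.sin t : ℝ) : ℂ) ^ 2 * (sandwich γ 0 t * (sandwich γ' 0 t)ᴴ).trace = 0 := by
  set κ : ℂ := 4 * ((m₁ : ℂ) / 2 * (m₁ / 2 + 1)) - 4 * ((m₁' : ℂ) / 2 * (m₁' / 2 + 1)) with hκ
  have hκ0 : κ ≠ 0 := by
    have : κ = ((m₁ : ℂ) - m₁') * (m₁ + m₁' + 2) := by rw [hκ]; ring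
    rw [this]
    refine mul_ne_zero (sub_ne_zero.2 (by exact_mod_cast hne)) ?_
    exact_mod_cast (by omega : m₁ + m₁' + 2 ≠ 0)
  have hc : Continuous fun t : ℝ => κ * ((Real.sin t : ℝ) : ℂ) ^ 2 *
      (sandwich γ 0 t * (sandwich γ' 0 t)ᴴ).trace :=
    (continuous_const.mul ((Complex.continuous_ofReal.comp Real.continuous_sin).pow 2)).mul
      (continuous_sandwich_trace 0 0)
  have key := intervalIntegral.integral_eq_sub_of_hasDerivAt
    (fun t _ => hasDerivAt_green h h' t) (hc.intervalIntegrable A B)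
  simp only [hA, hB, Complex.ofReal_zero, ne_eq, OfNat.ofNat_ne_zero, not_false_eq_true, zero_pow,
    mul_zero, neg_zero, zero_mul, sub_zero] at key
  have e : ∀ t : ℝ, κ * ((Real.sin t : ℝ) : ℂ) ^ 2 * (sandwich γ 0 t * (sandwich γ' 0 t)ᴴ).trace =
      κ * (((Real.sin t : ℝ) : ℂ) ^ 2 * (sandwich γ 0 t * (sandwich γ' 0 t)ᴴ).trace) :=
    fun t => mul_assoc _ _ _
  simp only [← hκ, e] at key
  rw [intervalIntegral.integral_const_mul] at key
  exact (mul_eq_zero.1 key).resolve_left hκ0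

theorem sandwich_swap (t : ℝ) :
    sandwich (m₁ := m₂) (m₂ := m₁) (γ.submatrix Prod.swap id) 0 t = sandwich γ 0 (-t) := by
  have e0 : aElt t = (aElt (-t)).swap := by simp [aElt]
  have e1 := Matrix.submatrix_mul_equiv γᴴ (tensorRep m₁ m₂ (aElt (-t))) id
    (Equiv.prodComm (Fin (m₂ + 1)) (Fin (m₁ + 1))) Prod.swap
  have e2 := Matrix.submatrix_mul_equiv (γᴴ * tensorRep m₁ m₂ (aElt (-t))) γ id
    (Equiv.prodComm (Fin (m₂ + 1)) (Fin (m₁ + 1))) id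
  simp only [Equiv.coe_prodComm] at e1 e2
  rw [sandwich, sandwich, pow_zero, pow_zero, mul_one, mul_one, e0, tensorRep_swap,
    conjTranspose_submatrix, e1, e2]
  rfl

/-- The differential equation sees only ℓ₁. When it is the ℓ₂ that differ, exchanging the tensor
factors and substituting t ↦ -t brings back the first case. -/
theorem integral_sandwich_eq_zero' (h : IsIsometricIntertwiner m m₁ m₂ γ)
    (h' : IsIsometricIntertwiner m m₁' m₂' γ') (hne : m₁ ≠ m₁' ∨ m₂ ≠ m₂') :
    ∫ t in (0 : ℝ)..(4 * Real.pi), ((Real.sin t : ℝ) : ℂ) ^ 2 *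
      (sandwich γ 0 t * (sandwich γ' 0 t)ᴴ).trace = 0 := by
  have h4 : Real.sin (4 * Real.pi) = 0 := by
    exact_mod_cast Real.sin_nat_mul_pi 4
  rcases hne with hne | hne
  · exact integral_sandwich_eq_zero h.isLieIntertwiner h'.isLieIntertwiner hne Real.sin_zero h4
  · have key := integral_sandwich_eq_zero h.swap.isLieIntertwiner h'.swap.isLieIntertwiner hne
      (A := -(4 * Real.pi)) (B := -0) (by rw [Real.sin_neg, h4, neg_zero]) (by simp)
    simp only [sandwich_swap] at key
    rw [← intervalIntegral.integral_comp_neg] at key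
    simpa using key

end Orthogonality

theorem spherical_eq_sandwich {m m₁ m₂ : ℕ} (hex : ∃ β, IsIsometricIntertwiner m m₁ m₂ β) (t : ℝ) :
    spherical m m₁ m₂ (aElt t) = sandwich hex.choose 0 t := by
  rw [spherical, dif_pos hex, sandwich, pow_zero, mul_one]

theorem hasEntryDerivAt_spherical (m m₁ m₂ : ℕ) (t : ℝ) :
    ∃ S', HasEntryDerivAt (fun t => spherical m m₁ m₂ (aElt t)) S' t := by
  by_cases hex : ∃ β, IsIsometricIntertwiner m m₁ m₂ β
  · simp only [spherical_eq_sandwich hex]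
    exact ⟨_, hasEntryDerivAt_sandwich _ 0 t⟩
  · simp only [spherical, dif_neg hex]
    exact ⟨0, hasEntryDerivAt_const 0⟩

theorem continuous_fullSpherical (m d : ℕ) (i j : Fin (m + 1)) :
    Continuous fun t => fullSpherical m d (aElt t) i j :=
  continuous_iff_continuousAt.2 fun t =>
    ((hasEntryDerivAt_spherical m (d + i) (d + (m - i)) t).choose_spec j j).continuousAt

theorem integral_spherical_eq_zero (m : ℕ) {m₁ m₂ m₁' m₂' : ℕ} (hne : m₁ ≠ m₁' ∨ m₂ ≠ m₂') :
    ∫ t in (0 : ℝ)..(4 * Real.pi), ((Real.sin t : ℝ) : ℂ) ^ 2 *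
      (spherical m m₁ m₂ (aElt t) * (spherical m m₁' m₂' (aElt t))ᴴ).trace = 0 := by
  by_cases hex : ∃ β, IsIsometricIntertwiner m m₁ m₂ β
  · by_cases hex' : ∃ β, IsIsometricIntertwiner m m₁' m₂' β
    · simp only [spherical_eq_sandwich hex, spherical_eq_sandwich hex']
      exact integral_sandwich_eq_zero' hex.choose_spec hex'.choose_spec hne
    · simp [spherical, dif_neg hex']
  · simp [spherical, dif_neg hex]

/-- A row of Φ_d is the diagonal of a spherical function, which is a diagonal matrix on A_*; so a
product of rows is a trace. -/
theorem fullSpherical_mul_conjTranspose_apply (m d e : ℕ) (t : ℝ) (i j : Fin (m + 1)) :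
    (fullSpherical m d (aElt t) * (fullSpherical m e (aElt t))ᴴ) i j =
      (spherical m (d + i) (d + (m - i)) (aElt t) *
        (spherical m (e + j) (e + (m - j)) (aElt t))ᴴ).trace := by
  rw [Matrix.mul_apply, Matrix.trace]
  refine Finset.sum_congr rfl fun q _ => ?_
  rw [diag_apply, Matrix.mul_apply, Finset.sum_eq_single q]
  · rfl
  · intro b _ hb
    rw [spherical_aElt_apply_eq_zero _ _ _ _ hb.symm, zero_mul]
  · simp

/-- Orthogonality of the full spherical functions on `A_*`. -/
theorem integral_fullSpherical_eq_zero (m : ℕ) {d e : ℕ} (hde : d ≠ e) (i j : Fin (m + 1)) :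
    ∫ t in (0 : ℝ)..(4 * Real.pi), ((Real.sin t : ℝ) : ℂ) ^ 2 *
      (fullSpherical m d (aElt t) * (fullSpherical m e (aElt t))ᴴ) i j = 0 := by
  simp only [fullSpherical_mul_conjTranspose_apply]
  -- The two pairs of parameters have sums 2d + m and 2e + m, so at least one of their members
  -- differs.
  refine integral_spherical_eq_zero m ?_
  have := i.2
  have := j.2
  omega

/-! ### The function `Φ_0` -/

theorem matrix_ext_of_psiVec_bilin {m : ℕ} {A B : Matrix (Fin (m + 1)) (Fin (m + 1)) ℂ}
    (h : ∀ v w, psiVec m v ⬝ᵥ (A *ᵥ psiVec m w) = psiVec m v ⬝ᵥ (B *ᵥ psiVec m w)) : A = B :=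
  matrix_ext_of_psiVec_right fun w => sub_eq_zero.1 <| eq_zero_of_psiVec_dotProduct fun v => by
    rw [dotProduct_sub, h, sub_self]

/-- The intertwiner `H^{ℓ₁+ℓ₂} → H^{ℓ₁} ⊗ H^{ℓ₂}` adjoint to the multiplication of polynomials. -/
def polarization (m m₁ m₂ : ℕ) : Matrix (Fin (m₁ + 1) × Fin (m₂ + 1)) (Fin (m + 1)) ℂ :=
  fun p n => if (p.1 : ℕ) + p.2 = n then
    ((Real.sqrt (m₁.choose p.1) * Real.sqrt (m₂.choose p.2) / Real.sqrt (m.choose n) : ℝ) : ℂ) else 0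

/-! ### The explicit intertwiner for ℓ = ℓ₁ + ℓ₂. -/

section Polarization
variable {m m₁ m₂ : ℕ}

theorem polarization_conjTranspose : (polarization m m₁ m₂)ᴴ = (polarization m m₁ m₂)ᵀ := by
  ext i j
  simp only [conjTranspose_apply, transpose_apply, polarization]
  split_ifs
  · exact Complex.conj_ofReal _
  · simp

/-- The vector of values at v goes to the tensor product of the vectors of values at v. Together
with `psiVec_dotProduct_psiVec` this gives equivariance and isometry at once, since v^{m₁} v^{m₂} =
v^m on kernels. -/
theorem polarization_mulVec_psiVec (hm : m₁ + m₂ = m) (v : Fin 2 → ℂ) :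
    polarization m m₁ m₂ *ᵥ psiVec m v = fun p => psiVec m₁ v p.1 * psiVec m₂ v p.2 := by
  ext ⟨a, b⟩
  have ha := a.2
  have hb := b.2
  simp only [Matrix.mulVec, dotProduct]
  rw [Finset.sum_eq_single ⟨a + b, by omega⟩]
  · simp only [polarization, if_true, psiVec]
    have hne := sqrt_choose_ne_zero m ⟨a + b, by omega⟩
    have e : m - ((a : ℕ) + b) = (m₁ - a) + (m₂ - b) := by omega
    simp only [e, pow_add] at hne ⊢
    push_cast
    field_simp
  · intro n _ hn
    rw [polarization, if_neg, zero_mul]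
    intro h; exact hn (Fin.ext h.symm)
  · simp

theorem kroneckerMap_mulVec_mul {p q r s : Type*} [Fintype q] [Fintype s] (A : Matrix p q ℂ)
    (B : Matrix r s ℂ) (f : q → ℂ) (g : s → ℂ) :
    kroneckerMap (· * ·) A B *ᵥ (fun x => f x.1 * g x.2) =
      fun x => (A *ᵥ f) x.1 * (B *ᵥ g) x.2 := by
  ext x
  simp only [Matrix.mulVec, dotProduct, Fintype.sum_prod_type, kroneckerMap_apply,
    Finset.sum_mul_sum]
  refine Finset.sum_congr rfl fun _ _ => Finset.sum_congr rfl fun _ _ => ?_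
  ring

theorem mul_dotProduct_mul {q s : Type*} [Fintype q] [Fintype s] (f f' : q → ℂ) (g g' : s → ℂ) :
    (fun x : q × s => f x.1 * g x.2) ⬝ᵥ (fun x => f' x.1 * g' x.2) = (f ⬝ᵥ f') * (g ⬝ᵥ g') := by
  simp only [dotProduct, Fintype.sum_prod_type, Finset.sum_mul_sum]
  refine Finset.sum_congr rfl fun _ _ => Finset.sum_congr rfl fun _ _ => ?_
  ring

theorem tensorRep_mulVec_psiVec (u : K × K) (v : Fin 2 → ℂ) :
    tensorRep m₁ m₂ u *ᵥ (fun p => psiVec m₁ v p.1 * psiVec m₂ v p.2) =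
      fun p => psiVec m₁ ((u.1 : Matrix (Fin 2) (Fin 2) ℂ) *ᵥ v) p.1 *
        psiVec m₂ ((u.2 : Matrix (Fin 2) (Fin 2) ℂ) *ᵥ v) p.2 := by
  rw [tensorRep, kroneckerMap_mulVec_mul, rep_eq_symPow, rep_eq_symPow, symPow_mulVec_psiVec,
    symPow_mulVec_psiVec]

theorem isIsometricIntertwiner_polarization (hm : m₁ + m₂ = m) :
    IsIsometricIntertwiner m m₁ m₂ (polarization m m₁ m₂) := by
  constructor
  · refine fun k => matrix_ext_of_psiVec_right fun v => ?_
    rw [← mulVec_mulVec, ← mulVec_mulVec, polarization_mulVec_psiVec hm, tensorRep_mulVec_psiVec,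
      rep_eq_symPow, symPow_mulVec_psiVec, polarization_mulVec_psiVec hm]
  · refine matrix_ext_of_psiVec_bilin fun v w => ?_
    rw [polarization_conjTranspose, ← mulVec_mulVec, dotProduct_mulVec, vecMul_transpose,
      polarization_mulVec_psiVec hm, polarization_mulVec_psiVec hm, mul_dotProduct_mul, one_mulVec,
      psiVec_dotProduct_psiVec, psiVec_dotProduct_psiVec, psiVec_dotProduct_psiVec, ← hm, pow_add]

theorem spherical_bilin (hm : m₁ + m₂ = m) (u : K × K) (v w : Fin 2 → ℂ) :
    psiVec m v ⬝ᵥ (spherical m m₁ m₂ u *ᵥ psiVec m w) =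
      (v ⬝ᵥ ((u.1 : Matrix (Fin 2) (Fin 2) ℂ) *ᵥ w)) ^ m₁ *
        (v ⬝ᵥ ((u.2 : Matrix (Fin 2) (Fin 2) ℂ) *ᵥ w)) ^ m₂ := by
  rw [spherical_eq (d := 0) (isIsometricIntertwiner_polarization hm) (by omega) (by omega),
    polarization_conjTranspose, ← mulVec_mulVec, ← mulVec_mulVec, dotProduct_mulVec,
    vecMul_transpose, polarization_mulVec_psiVec hm, polarization_mulVec_psiVec hm,
    tensorRep_mulVec_psiVec, mul_dotProduct_mul, psiVec_dotProduct_psiVec,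
    psiVec_dotProduct_psiVec]

end Polarization

/-- The `2 × 2` matrix whose symmetric power is `Φ_0(a_t)`, up to diagonal factors. -/
def gMat (t : ℝ) : Matrix (Fin 2) (Fin 2) ℂ :=
  !![Complex.exp (-(Complex.I * (t / 2))), Complex.exp (Complex.I * (t / 2));
     Complex.exp (Complex.I * (t / 2)), Complex.exp (-(Complex.I * (t / 2)))]

/-- The diagonal matrix of the inverses of the norms of the monomials. -/
def normInv (m : ℕ) : Matrix (Fin (m + 1)) (Fin (m + 1)) ℂ :=
  diagonal fun i => (((Real.sqrt (m.choose i) : ℝ) : ℂ))⁻¹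

/-- Put v = (1, 1) in `spherical_bilin`. The spherical function is diagonal, so the left side is a
generating function of row i of Φ_0, and the right side is (w g)₁^i (w g)₀^{m-i}, which is ψ_i at w
g up to its norm. -/
theorem fullSpherical_zero (m : ℕ) (t : ℝ) :
    fullSpherical m 0 (aElt t) = normInv m * symPow m (gMat t) * normInv m := by
  have hsymm : (symPow m (gMat t))ᵀ = symPow m (gMat t) := by
    rw [← symPow_transpose]
    congr 1
    ext i j; fin_cases i <;> fin_cases j <;> rfl
  ext i j
  have hi : (i : ℕ) ≤ m := Nat.lt_succ_iff.1 i.2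
  have key : (fun j : Fin (m + 1) => ((Real.sqrt (m.choose j) : ℝ) : ℂ) * fullSpherical m 0 (aElt t) i j -
      symPow m (gMat t) j i / ((Real.sqrt (m.choose i) : ℝ) : ℂ)) = 0 := by
    refine eq_zero_of_psiVec_dotProduct fun w => ?_
    have h1 := spherical_bilin (m := m) (m₁ := 0 + i) (m₂ := 0 + (m - i)) (by omega) (aElt t) ![1, 1] w
    have h2 := congrFun (psiVec_vecMul_symPow m (gMat t) w) i
    have h3 : psiVec m ![1, 1] ⬝ᵥ (spherical m (0 + i) (0 + (m - i)) (aElt t) *ᵥ psiVec m w) =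
        ∑ j : Fin (m + 1), psiVec m w j *
          (((Real.sqrt (m.choose j) : ℝ) : ℂ) * fullSpherical m 0 (aElt t) i j) := by
      refine Finset.sum_congr rfl fun j _ => ?_
      rw [Matrix.mulVec, dotProduct, Finset.sum_eq_single j]
      · simp [psiVec, fullSpherical]; ring
      · intro b _ hb
        rw [spherical_aElt_apply_eq_zero _ _ _ _ hb.symm, zero_mul]
      · simp
    have h4 : psiVec m (w ᵥ* gMat t) i / ((Real.sqrt (m.choose i) : ℝ) : ℂ) =
        ∑ j, psiVec m w j * (symPow m (gMat t) j i / ((Real.sqrt (m.choose i) : ℝ) : ℂ)) := by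
      rw [← h2, Matrix.vecMul, dotProduct, Finset.sum_div]
      exact Finset.sum_congr rfl fun j _ => mul_div_assoc _ _ _
    simp only [dotProduct, mul_sub, Finset.sum_sub_distrib]
    rw [← h3, ← h4, h1, psiVec]
    have e0 : (![1, 1] ⬝ᵥ ((aElt t).1 : Matrix (Fin 2) (Fin 2) ℂ) *ᵥ w) = (w ᵥ* gMat t) 1 := by
      simp [aElt, torus, gMat, dotProduct, Matrix.mulVec, Fin.sum_univ_two, Matrix.vecHead,
        Matrix.vecTail]
      ring
    have e1 : (![1, 1] ⬝ᵥ ((aElt t).2 : Matrix (Fin 2) (Fin 2) ℂ) *ᵥ w) = (w ᵥ* gMat t) 0 := by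
      simp [aElt, torus, gMat, dotProduct, Matrix.mulVec, Fin.sum_univ_two, Matrix.vecHead,
        Matrix.vecTail, neg_div]
      ring
    rw [e0, e1, zero_add, zero_add]
    have := sqrt_choose_ne_zero m i
    field_simp
    ring
  have h := sub_eq_zero.1 (congrFun key j)
  rw [normInv, mul_diagonal, diagonal_mul, ← hsymm, transpose_apply]
  have hi0 := sqrt_choose_ne_zero m i
  have hj0 := sqrt_choose_ne_zero m j
  field_simp at h ⊢
  linear_combination h

theorem isUnit_normInv (m : ℕ) : IsUnit (normInv m) := by
  rw [Matrix.isUnit_iff_isUnit_det, normInv, det_diagonal, isUnit_iff_ne_zero]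
  exact Finset.prod_ne_zero_iff.2 fun i _ => inv_ne_zero (sqrt_choose_ne_zero m i)

theorem normInv_conjTranspose (m : ℕ) : (normInv m)ᴴ = normInv m := by
  rw [normInv, diagonal_conjTranspose]
  congr 1; ext i
  simp

theorem isUnit_symPow (m : ℕ) {g : Matrix (Fin 2) (Fin 2) ℂ} (hg : IsUnit g.det) :
    IsUnit (symPow m g) :=
  IsUnit.of_mul_eq_one (symPow m g⁻¹) (by rw [← symPow_mul, mul_nonsing_inv _ hg, symPow_one])

theorem det_gMat (t : ℝ) : (gMat t).det = -2 * Complex.I * (Real.sin t : ℝ) := by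
  rw [gMat, det_fin_two_of, ← Complex.exp_add, ← Complex.exp_add, Complex.ofReal_sin, Complex.sin]
  rw [show -(Complex.I * (t / 2)) + -(Complex.I * (t / 2)) = -(t : ℂ) * Complex.I by ring,
    show Complex.I * ((t : ℂ) / 2) + Complex.I * (t / 2) = t * Complex.I by ring]
  linear_combination (Complex.exp (-(t : ℂ) * Complex.I) - Complex.exp (t * Complex.I)) * Complex.I_sq

theorem isUnit_fullSpherical_zero (m : ℕ) {t : ℝ} (ht : Real.sin t ≠ 0) :
    IsUnit (fullSpherical m 0 (aElt t)) := by
  rw [fullSpherical_zero]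
  refine ((isUnit_normInv m).mul (isUnit_symPow m ?_)).mul (isUnit_normInv m)
  rw [det_gMat, isUnit_iff_ne_zero]
  exact mul_ne_zero (mul_ne_zero (by norm_num) Complex.I_ne_zero) (Complex.ofReal_ne_zero.2 ht)

/-! ### The flip `J` -/

/-- The matrix of `J : ψ_j ↦ ψ_{-j}`. -/
def flip (m : ℕ) : Matrix (Fin (m + 1)) (Fin (m + 1)) ℂ :=
  Matrix.of fun i j => if i = Fin.rev j then 1 else 0

theorem mul_flip_apply {m : ℕ} {n : Type*} (A : Matrix n (Fin (m + 1)) ℂ) (i : n)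
    (j : Fin (m + 1)) : (A * flip m) i j = A i (Fin.rev j) := by
  simp [Matrix.mul_apply, flip]

theorem flip_mul_apply {m : ℕ} {n : Type*} (A : Matrix (Fin (m + 1)) n ℂ) (i : Fin (m + 1))
    (j : n) : (flip m * A) i j = A (Fin.rev i) j := by
  rw [Matrix.mul_apply, Finset.sum_eq_single (Fin.rev i)]
  · simp [flip]
  · intro b _ hb
    rw [flip, Matrix.of_apply, if_neg, zero_mul]
    intro h; exact hb (by rw [h, Fin.rev_rev])
  · simp

theorem flip_mul_flip (m : ℕ) : flip m * flip m = 1 := by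
  ext i j
  rw [flip_mul_apply, flip, Matrix.of_apply, Matrix.one_apply]
  simp

/-- Realizing J as a symmetric power reduces its relations with Φ_0 to identities of 2 × 2 matrices.
-/
theorem symPow_swap (m : ℕ) : symPow m !![0, 1; 1, 0] = flip m := matrix_ext_of_psiVec fun v => by
  rw [psiVec_vecMul_symPow]
  ext j
  have hj : (j : ℕ) ≤ m := Nat.lt_succ_iff.1 j.2
  have : (psiVec m v ᵥ* flip m) j = psiVec m v (Fin.rev j) := by simp [Matrix.vecMul, dotProduct, flip]
  rw [this]
  have e1 : ((Fin.rev j : Fin (m + 1)) : ℕ) = m - j := by rw [Fin.val_rev]; omega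
  simp only [psiVec, e1, Nat.choose_symm hj, Nat.sub_sub_self hj]
  simp [Matrix.vecHead, Matrix.vecTail]
  ring

theorem flip_mul_normInv (m : ℕ) : flip m * normInv m = normInv m * flip m := by
  ext i j
  rw [flip_mul_apply, mul_flip_apply, normInv, diagonal_apply, diagonal_apply]
  have hi : (i : ℕ) ≤ m := Nat.lt_succ_iff.1 i.2
  have e1 : ((Fin.rev i : Fin (m + 1)) : ℕ) = m - i := by rw [Fin.val_rev]; omega
  simp only [e1, Nat.choose_symm hi, Fin.rev_eq_iff]

/-- The matrix `S(t) = Φ_0(a_t) Φ_0(a_t)^*`. -/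
def gram (m : ℕ) (t : ℝ) : Matrix (Fin (m + 1)) (Fin (m + 1)) ℂ :=
  fullSpherical m 0 (aElt t) * (fullSpherical m 0 (aElt t))ᴴ

theorem fullSpherical_comm_flip (m d : ℕ) (t : ℝ) :
    fullSpherical m d (aElt t) * flip m = flip m * fullSpherical m d (aElt t) := by
  ext i j
  rw [mul_flip_apply, flip_mul_apply, ← fullSpherical_rev_rev, Fin.rev_rev]

theorem flip_conjTranspose (m : ℕ) : (flip m)ᴴ = flip m := by
  ext i j
  simp only [flip, conjTranspose_apply, Matrix.of_apply, eq_comm (a := j), Fin.rev_eq_iff]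
  split_ifs <;> simp

theorem gram_comm_flip (m : ℕ) (t : ℝ) : gram m t * flip m = flip m * gram m t := by
  have h := congrArg conjTranspose (fullSpherical_comm_flip m 0 t)
  rw [Matrix.conjTranspose_mul, Matrix.conjTranspose_mul, flip_conjTranspose] at h
  rw [gram, mul_assoc, ← h, ← mul_assoc, fullSpherical_comm_flip, mul_assoc]

theorem gram_posDef (m : ℕ) {t : ℝ} (ht : Real.sin t ≠ 0) : (gram m t).PosDef := by
  have hu := isUnit_fullSpherical_zero m ht
  rw [gram]
  exact Matrix.PosDef.mul_conjTranspose_self _ (Matrix.vecMul_injective_of_isUnit hu)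

/-! ### Positivity of the Gram matrix in the basis adapted to `t = 0` -/

/-- The matrix `(1 y; y 1)`. -/
def symMat (y : ℂ) : Matrix (Fin 2) (Fin 2) ℂ := !![1, y; y, 1]

-- Evaluated at (1, z), column j is the polynomial (1 + yz)^{m-j} (y + z)^j. Working over `NNReal`
-- makes the nonnegativity of its coefficients automatic.
open Polynomial in
theorem symPow_symMat_apply (m : ℕ) (y : NNReal) (i j : Fin (m + 1)) :
    symPow m (symMat ((y : ℝ) : ℂ)) i j =
      ((Real.sqrt (m.choose j) / Real.sqrt (m.choose i) *
        ((((1 + C y * X) ^ (m - (j : ℕ)) * (C y + X) ^ (j : ℕ) : NNReal[X]).coeff i : NNReal) : ℝ) :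
          ℝ) : ℂ) := by
  set q : NNReal[X] := (1 + C y * X) ^ (m - (j : ℕ)) * (C y + X) ^ (j : ℕ) with hq
  let φ : NNReal →+* ℂ := Complex.ofRealHom.comp NNReal.toRealHom
  have hdeg : (q.map φ).natDegree < m + 1 := by
    have h1 : (1 + C y * X : NNReal[X]).natDegree ≤ 1 := by
      refine (natDegree_add_le _ _).trans (max_le (by simp) ((natDegree_C_mul_le _ _).trans natDegree_X_le))
    have h2 : (C y + X : NNReal[X]).natDegree ≤ 1 :=
      (natDegree_add_le _ _).trans (max_le (by simp) natDegree_X_le)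
    have h3 : q.natDegree ≤ (m - (j : ℕ)) * 1 + (j : ℕ) * 1 :=
      natDegree_mul_le_of_le (natDegree_pow_le_of_le _ h1) (natDegree_pow_le_of_le _ h2)
    have := natDegree_map_le (f := φ) (p := q)
    have := j.2
    omega
  have key : (fun i : Fin (m + 1) => ((Real.sqrt (m.choose i) : ℝ) : ℂ) *
      symPow m (symMat ((y : ℝ) : ℂ)) i j - ((Real.sqrt (m.choose j) : ℝ) : ℂ) * φ (q.coeff i)) = 0 := by
    have : (fun i : Fin (m + 1) => symPow m (symMat ((y : ℝ) : ℂ)) i j -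
        ((Real.sqrt (m.choose j) : ℝ) : ℂ) * φ (q.coeff i) / ((Real.sqrt (m.choose i) : ℝ) : ℂ)) = 0 := by
      refine eq_zero_of_psiVec_one_dotProduct fun z => ?_
      have h1 := congrFun (psiVec_vecMul_symPow m (symMat ((y : ℝ) : ℂ)) ![1, z]) j
      have h2 : psiVec m (![1, z] ᵥ* symMat ((y : ℝ) : ℂ)) j =
          ((Real.sqrt (m.choose j) : ℝ) : ℂ) * (q.map φ).eval z := by
        simp [psiVec, symMat, hq, φ, Matrix.vecMul, dotProduct, Fin.sum_univ_two]
        ring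
      rw [eval_eq_sum_range' hdeg, Finset.sum_range] at h2
      simp only [dotProduct, mul_sub, Finset.sum_sub_distrib]
      rw [Matrix.vecMul, dotProduct] at h1
      rw [h1, h2, Finset.mul_sum, sub_eq_zero]
      refine Finset.sum_congr rfl fun k _ => ?_
      have := sqrt_choose_ne_zero m k
      simp only [psiVec, coeff_map]
      field_simp
      simp
    ext i
    have := congrFun this i
    have h0 := sqrt_choose_ne_zero m i
    rw [Pi.zero_apply, sub_eq_zero] at this ⊢
    rw [this]
    field_simp
  have h := sub_eq_zero.1 (congrFun key i)
  have h0 := sqrt_choose_ne_zero m i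
  have hφ : φ (q.coeff i) = (((q.coeff i : NNReal) : ℝ) : ℂ) := rfl
  rw [hφ] at h
  push_cast
  field_simp
  linear_combination h

/-- Conjugation by diag(1, -1) replaces y by -y. -/
theorem symPow_symMat_neg (m : ℕ) (y : ℂ) (i j : Fin (m + 1)) :
    symPow m (symMat (-y)) i j = (-1) ^ ((i : ℕ) + j) * symPow m (symMat y) i j := by
  have : symMat (-y) = diagonal ![1, -1] * symMat y * diagonal ![1, -1] := by
    ext i j; fin_cases i <;> fin_cases j <;> simp [symMat]
  rw [this, symPow_mul, symPow_mul, symPow_diagonal, mul_diagonal, diagonal_mul]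
  simp [pow_add]
  ring

/-- A real version of the entries of `symPow m (symMat y)`. -/
def symEntry (m : ℕ) (i j : Fin (m + 1)) (y : ℝ) : ℝ := (symPow m (symMat (y : ℂ)) i j).re

theorem symEntry_neg (m : ℕ) {i j : Fin (m + 1)} (hij : Even ((i : ℕ) + j)) (y : ℝ) :
    symEntry m i j (-y) = symEntry m i j y := by
  rw [symEntry, Complex.ofReal_neg, symPow_symMat_neg, hij.neg_one_pow, one_mul, symEntry]

/-- For y ≥ 0 the coefficients are nonnegative; negative y is covered because the entry is even in y
when i + j is even. -/
theorem symEntry_nonneg (m : ℕ) {i j : Fin (m + 1)} (hij : Even ((i : ℕ) + j)) (y : ℝ) :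
    0 ≤ symEntry m i j y := by
  have h : ∀ y : ℝ, 0 ≤ y → 0 ≤ symEntry m i j y := fun y hy => by
    lift y to NNReal using hy
    rw [symEntry, symPow_symMat_apply, Complex.ofReal_re]
    positivity
  rcases le_total 0 y with hy | hy
  · exact h y hy
  · rw [← symEntry_neg m hij]; exact h _ (by linarith)

theorem symEntry_one_pos (m : ℕ) (i j : Fin (m + 1)) : 0 < symEntry m i j 1 := by
  have := symPow_symMat_apply m 1 i j
  simp only [NNReal.coe_one] at this
  rw [symEntry, this, Complex.ofReal_re]
  have hj := j.2
  have hi := i.2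
  have e : ((1 + Polynomial.C 1 * Polynomial.X) ^ (m - (j : ℕ)) *
      (Polynomial.C 1 + Polynomial.X) ^ (j : ℕ) : Polynomial NNReal) = (1 + Polynomial.X) ^ m := by
    rw [map_one, one_mul, ← pow_add]; congr 1; omega
  rw [e, Polynomial.coeff_one_add_X_pow]
  have h1 := sqrt_choose_pos m i
  have h2 := sqrt_choose_pos m j
  have h3 : (0 : ℝ) < m.choose i := by exact_mod_cast Nat.choose_pos (by omega)
  have : (((m.choose i : ℕ) : NNReal) : ℝ) = (m.choose i : ℝ) := by simp
  rw [this]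
  positivity

theorem symPow_symMat_eq_symEntry (m : ℕ) (i j : Fin (m + 1)) (y : ℝ) :
    symPow m (symMat (y : ℂ)) i j = (symEntry m i j y : ℂ) := by
  have h : ∀ y : ℝ, 0 ≤ y → symPow m (symMat (y : ℂ)) i j = (symEntry m i j y : ℂ) := fun y hy => by
    lift y to NNReal using hy
    rw [symEntry, symPow_symMat_apply, Complex.ofReal_re]
  rcases le_total 0 y with hy | hy
  · exact h y hy
  · have e : (y : ℂ) = -(((-y : ℝ)) : ℂ) := by push_cast; ring
    rw [symEntry, e, symPow_symMat_neg, h _ (by linarith)]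
    rw [show ((-1 : ℂ) ^ ((i : ℕ) + j)) = (((-1 : ℝ) ^ ((i : ℕ) + j) : ℝ) : ℂ) by push_cast; rfl,
      ← Complex.ofReal_mul, Complex.ofReal_re]

theorem continuous_symEntry (m : ℕ) (i j : Fin (m + 1)) : Continuous (symEntry m i j) := by
  have e : ∀ y : ℝ, symPow m (symMat (y : ℂ)) i j =
      ∑ k, (psiSample m)⁻¹ i k * psiVec m (![1, ((k : ℕ) : ℂ)] ᵥ* symMat (y : ℂ)) j := fun y => by
    rw [← nonsing_inv_mul_cancel_left (psiSample m) (symPow m (symMat (y : ℂ))) (isUnit_psiSample m),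
      Matrix.mul_apply]
    simp only [← psiVec_vecMul_symPow]
    rfl
  change Continuous fun y : ℝ => (symPow m (symMat (y : ℂ)) i j).re
  simp only [e]
  refine Complex.continuous_re.comp (continuous_finsetSum _ fun k _ => continuous_const.mul ?_)
  have h0 : ∀ y : ℝ, (![1, ((k : ℕ) : ℂ)] ᵥ* symMat (y : ℂ)) 0 = 1 + k * y := fun y => by
    simp [symMat, Matrix.vecMul, dotProduct, Fin.sum_univ_two]
  have h1 : ∀ y : ℝ, (![1, ((k : ℕ) : ℂ)] ᵥ* symMat (y : ℂ)) 1 = y + k := fun y => by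
    simp [symMat, Matrix.vecMul, dotProduct, Fin.sum_univ_two]
  simp only [psiVec, h0, h1]
  fun_prop

/-- The inverse binomials are beta integrals. This exhibits the diagonal matrix `normInv m * normInv
m` as an average of symmetric powers of diag(1 - s, s). -/
theorem integral_beta_nat (m : ℕ) (n : Fin (m + 1)) :
    ((m : ℂ) + 1) * ∫ s in (0 : ℝ)..1, (1 - (s : ℂ)) ^ (m - (n : ℕ)) * (s : ℂ) ^ (n : ℕ) =
      ((m.choose n : ℕ) : ℂ)⁻¹ := by
  have hn : (n : ℕ) ≤ m := Nat.lt_succ_iff.1 n.2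
  have key := Complex.Gamma_mul_Gamma_eq_betaIntegral (s := ((n : ℕ) : ℂ) + 1)
    (t := ((m - (n : ℕ) : ℕ) : ℂ) + 1)
    (by simp; positivity) (by rw [Complex.add_re, Complex.natCast_re, Complex.one_re]; positivity)
  have e : ((n : ℕ) : ℂ) + 1 + (((m - (n : ℕ) : ℕ) : ℂ) + 1) = ((m + 1 : ℕ) : ℂ) + 1 := by
    push_cast [Nat.cast_sub hn]; ring
  rw [e, Complex.Gamma_nat_eq_factorial, Complex.Gamma_nat_eq_factorial,
    Complex.Gamma_nat_eq_factorial, Complex.betaIntegral] at key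
  simp only [add_sub_cancel_right, Complex.cpow_natCast] at key
  have hc : ((m.choose n : ℕ) : ℂ) * ((n : ℕ).factorial * (m - (n : ℕ)).factorial) = m.factorial := by
    have := Nat.choose_mul_factorial_mul_factorial hn
    rw [← mul_assoc]; exact_mod_cast this
  have hc0 : ((m.choose n : ℕ) : ℂ) ≠ 0 := by exact_mod_cast (Nat.choose_pos hn).ne'
  have hf : ((m.factorial : ℕ) : ℂ) ≠ 0 := by exact_mod_cast m.factorial_ne_zero
  rw [key, Nat.factorial_succ] at hc
  push_cast at hc
  simp only [mul_comm ((1 - _ : ℂ) ^ _)]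
  field_simp
  refine mul_right_cancel₀ hf ?_
  linear_combination hc

/-- The unnormalized Hadamard matrix. -/
def hadamard : Matrix (Fin 2) (Fin 2) ℂ := !![1, 1; 1, -1]

theorem hadamard_mul_diagonal_mul_hadamard (a b : ℂ) :
    hadamard * diagonal ![a, b] * hadamard = !![a + b, a - b; a - b, a + b] := by
  have : diagonal ![a, b] = !![a, 0; 0, b] := by
    ext i j; fin_cases i <;> fin_cases j <;> rfl
  rw [this, hadamard, Matrix.mul_fin_two, Matrix.mul_fin_two]
  ext i j; fin_cases i <;> fin_cases j <;> simp <;> ring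

/-- The Gram matrix of `Φ_0`, in the basis adapted to `t = 0`, without its scalar factors. -/
def gramCore (m : ℕ) : Matrix (Fin (m + 1)) (Fin (m + 1)) ℂ :=
  symPow m hadamard * (normInv m * normInv m) * symPow m hadamard

/-- Conjugating diag(1 - s, s) by the Hadamard matrix gives `symMat (1 - 2 * s)`, so the beta
average becomes an average of entries of its symmetric powers. -/
theorem gramCore_apply (m : ℕ) (i j : Fin (m + 1)) :
    gramCore m i j = ((m : ℂ) + 1) * ∫ s in (0 : ℝ)..1, (symEntry m i j (1 - 2 * s) : ℂ) := by
  have e : ∀ s : ℝ, (symEntry m i j (1 - 2 * s) : ℂ) = ∑ n, symPow m hadamard i n *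
      symPow m hadamard n j * ((1 - (s : ℂ)) ^ (m - (n : ℕ)) * (s : ℂ) ^ (n : ℕ)) := fun s => by
    rw [← symPow_symMat_eq_symEntry]
    have : symMat (((1 - 2 * s : ℝ)) : ℂ) = hadamard * diagonal ![1 - (s : ℂ), (s : ℂ)] * hadamard := by
      rw [hadamard_mul_diagonal_mul_hadamard]
      ext i j; fin_cases i <;> fin_cases j <;> simp [symMat] <;> ring
    rw [this, symPow_mul, symPow_mul, symPow_diagonal, Matrix.mul_apply]
    refine Finset.sum_congr rfl fun n _ => ?_
    rw [mul_diagonal]; ring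
  simp only [e]
  rw [intervalIntegral.integral_finsetSum]
  · rw [gramCore, normInv, diagonal_mul_diagonal, Matrix.mul_apply, Finset.mul_sum]
    refine Finset.sum_congr rfl fun n _ => ?_
    rw [intervalIntegral.integral_const_mul, mul_left_comm, integral_beta_nat, mul_diagonal,
      ← sqrt_choose_mul_self, mul_inv]
    ring
  · intro n _
    exact Continuous.intervalIntegrable (by fun_prop) _ _

/-- The integrand is continuous and nonnegative, and positive at s = 0, where y = 1. -/
theorem gramCore_ne_zero (m : ℕ) {i j : Fin (m + 1)} (hij : Even ((i : ℕ) + j)) :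
    gramCore m i j ≠ 0 := by
  rw [gramCore_apply, intervalIntegral.integral_ofReal]
  refine mul_ne_zero (by exact_mod_cast m.succ_ne_zero) (Complex.ofReal_ne_zero.2 (ne_of_gt ?_))
  refine intervalIntegral.integral_pos zero_lt_one ?_ (fun s _ => symEntry_nonneg m hij _)
    ⟨0, by simp, by simpa using symEntry_one_pos m i j⟩
  have := continuous_symEntry m i j
  exact Continuous.continuousOn (by fun_prop)

/-! ### The commutant -/

/-- The change of basis to the basis adapted to `t = 0`. -/
def adapt (m : ℕ) : Matrix (Fin (m + 1)) (Fin (m + 1)) ℂ := normInv m * symPow m hadamard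

/-- The diagonal matrix of the signs `(-1)^n`. -/
def signs (m : ℕ) : Matrix (Fin (m + 1)) (Fin (m + 1)) ℂ := diagonal fun i => (-1) ^ (i : ℕ)

theorem isUnit_adapt (m : ℕ) : IsUnit (adapt m) :=
  (isUnit_normInv m).mul (isUnit_symPow m (by
    rw [hadamard, det_fin_two_of, isUnit_iff_ne_zero]; norm_num))

/-- In the adapted basis J is diagonal with entries (-1)^n, because the Hadamard matrix diagonalizes
the swap of the two variables. -/
theorem flip_mul_adapt (m : ℕ) : flip m * adapt m = adapt m * signs m := by
  have h1 : signs m = symPow m (diagonal ![1, -1]) := by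
    rw [symPow_diagonal, signs]; simp
  rw [adapt, ← mul_assoc, flip_mul_normInv, mul_assoc, mul_assoc, h1, ← symPow_swap, ← symPow_mul,
    ← symPow_mul]
  congr 2
  ext i j; fin_cases i <;> fin_cases j <;> simp [hadamard, Matrix.mul_apply, Fin.sum_univ_two]

/-- g_t = h diag(cos(t/2), -i sin(t/2)) h with h the Hadamard matrix, so all dependence on t sits in
the diagonal factor Λ and the rest is constant. -/
theorem gram_eq (m : ℕ) (t : ℝ) :
    let Λ : Matrix (Fin (m + 1)) (Fin (m + 1)) ℂ := diagonal fun i =>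
      ((Real.cos (t / 2) : ℝ) : ℂ) ^ (m - (i : ℕ)) *
        (-Complex.I * ((Real.sin (t / 2) : ℝ) : ℂ)) ^ (i : ℕ)
    gram m t = adapt m * (Λ * gramCore m * Λᴴ) * (adapt m)ᴴ := by
  intro Λ
  have hΛ : Λ = symPow m (diagonal ![((Real.cos (t / 2) : ℝ) : ℂ),
      -Complex.I * ((Real.sin (t / 2) : ℝ) : ℂ)]) := by rw [symPow_diagonal]
  have hg : gMat t = hadamard * diagonal ![((Real.cos (t / 2) : ℝ) : ℂ),
      -Complex.I * ((Real.sin (t / 2) : ℝ) : ℂ)] * hadamard := by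
    have h1 : Complex.exp (Complex.I * (t / 2)) = ((Real.cos (t / 2) : ℝ) : ℂ) +
        Complex.I * ((Real.sin (t / 2) : ℝ) : ℂ) := by
      rw [mul_comm, Complex.exp_mul_I]; push_cast; ring
    have h2 : Complex.exp (-(Complex.I * (t / 2))) = ((Real.cos (t / 2) : ℝ) : ℂ) -
        Complex.I * ((Real.sin (t / 2) : ℝ) : ℂ) := by
      rw [show -(Complex.I * ((t : ℂ) / 2)) = (-(t / 2)) * Complex.I by ring, Complex.exp_mul_I]
      push_cast; rw [Complex.cos_neg, Complex.sin_neg]; ring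
    rw [hadamard_mul_diagonal_mul_hadamard, gMat, h1, h2]
    ext i j; fin_cases i <;> fin_cases j <;> simp <;> ring
  have hK : (symPow m hadamard)ᴴ = symPow m hadamard := by
    rw [← symPow_conjTranspose]
    congr 1
    ext i j; fin_cases i <;> fin_cases j <;> simp [hadamard]
  rw [gram, fullSpherical_zero, hg, symPow_mul, symPow_mul, ← hΛ]
  simp only [Matrix.conjTranspose_mul, normInv_conjTranspose, hK, adapt, gramCore, mul_assoc]

/-- The matrices that commute with `J` and are self-adjoint with respect to all the `S(t)` are the
linear combinations of `1` and `J`. -/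
theorem eq_smul_one_add_smul_flip {m : ℕ} {T : Matrix (Fin (m + 1)) (Fin (m + 1)) ℂ}
    (hJ : T * flip m = flip m * T)
    (hT : ∀ t ∈ Ioo 0 Real.pi, T * gram m t = gram m t * Tᴴ) :
    ∃ a b : ℂ, T = a • 1 + b • flip m := by
  have hL : IsUnit (adapt m).det := (Matrix.isUnit_iff_isUnit_det _).1 (isUnit_adapt m)
  set L := adapt m with hLdef
  set T' := L⁻¹ * T * L with hT'
  have hTL : T * L = L * T' := by rw [hT', ← mul_assoc, ← mul_assoc, mul_nonsing_inv _ hL, one_mul]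
  clear_value T'
  have hsigns : T' * signs m = signs m * T' := by
    have h1 : L * (T' * signs m) = L * (signs m * T') := by
      rw [← mul_assoc, ← hTL, mul_assoc, ← flip_mul_adapt, ← mul_assoc, hJ, mul_assoc, hTL,
        ← mul_assoc, flip_mul_adapt, mul_assoc]
    have := congrArg (L⁻¹ * ·) h1
    simpa only [nonsing_inv_mul_cancel_left _ _ hL] using this
  -- Commuting with the signs makes T' preserve parity.
  have hpar : ∀ i k : Fin (m + 1), T' i k ≠ 0 → Even ((i : ℕ) + k) := by
    intro i k hne
    have := congrFun (congrFun hsigns i) k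
    rw [signs, mul_diagonal, diagonal_mul, mul_comm] at this
    have h1 := mul_right_cancel₀ hne this
    by_contra hodd
    rw [Nat.not_even_iff_odd] at hodd
    have h2 : (-1 : ℂ) ^ ((i : ℕ) + k) = -1 := hodd.neg_one_pow
    rw [pow_add, ← h1, ← pow_add, ← two_mul, pow_mul] at h2
    norm_num at h2
  -- With t = 2 arctan τ, Λ is c^m times the diagonal matrix of the powers of -iτ, where c =
  -- cos(t/2) ≠ 0; the scalar cancels and an identity polynomial in τ remains.
  have hcore : ∀ τ : ℝ, 0 < τ → ∀ i j : Fin (m + 1),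
      ∑ k, T' i k * gramCore m k j * ((-Complex.I * τ) ^ (k : ℕ) * (Complex.I * τ) ^ (j : ℕ)) =
        ∑ k, gramCore m i k * star (T' j k) *
          ((-Complex.I * τ) ^ (i : ℕ) * (Complex.I * τ) ^ (k : ℕ)) := by
    intro τ hτ i j
    have harc := Real.arctan_pos.2 hτ
    have harc' := Real.arctan_lt_pi_div_two τ
    have h := hT (2 * Real.arctan τ) ⟨by linarith, by linarith⟩
    rw [gram_eq, mul_div_cancel_left₀ _ (two_ne_zero' ℝ)] at h
    set c : ℂ := ((Real.cos (Real.arctan τ) : ℝ) : ℂ) with hc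
    have hc0 : c ≠ 0 := Complex.ofReal_ne_zero.2 (Real.cos_arctan_pos τ).ne'
    have hs : ((Real.sin (Real.arctan τ) : ℝ) : ℂ) = τ * c := by
      rw [hc, ← Complex.ofReal_mul]
      congr 1
      conv_rhs => rw [← Real.tan_arctan τ]
      rw [Real.tan_arctan, Real.sin_arctan, Real.cos_arctan]
      ring
    rw [hs] at h
    have hd : (fun i : Fin (m + 1) => c ^ (m - (i : ℕ)) * (-Complex.I * (τ * c)) ^ (i : ℕ)) =
        fun i : Fin (m + 1) => c ^ m * (-Complex.I * τ) ^ (i : ℕ) := by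
      ext i
      have : c ^ m = c ^ (m - (i : ℕ)) * c ^ (i : ℕ) := by
        rw [← pow_add]; congr 1; have := i.2; omega
      rw [this, ← mul_assoc, mul_pow _ c]; ring
    rw [hd] at h
    set Λ : Matrix (Fin (m + 1)) (Fin (m + 1)) ℂ :=
      diagonal fun i => c ^ m * (-Complex.I * τ) ^ (i : ℕ) with hΛ
    have h2 : T' * (Λ * gramCore m * Λᴴ) = Λ * gramCore m * Λᴴ * T'ᴴ := by
      have hLH : IsUnit (Lᴴ).det := by rw [det_conjTranspose]; exact hL.star
      have h3 : L * (T' * (Λ * gramCore m * Λᴴ)) * Lᴴ = L * (Λ * gramCore m * Λᴴ * T'ᴴ) * Lᴴ := by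
        have e2 : Lᴴ * Tᴴ = T'ᴴ * Lᴴ := by
          rw [← Matrix.conjTranspose_mul, hTL, Matrix.conjTranspose_mul]
        calc L * (T' * (Λ * gramCore m * Λᴴ)) * Lᴴ
            = T * (L * (Λ * gramCore m * Λᴴ) * Lᴴ) := by
              rw [← mul_assoc L, ← hTL]; simp only [mul_assoc]
          _ = L * (Λ * gramCore m * Λᴴ) * Lᴴ * Tᴴ := h
          _ = L * (Λ * gramCore m * Λᴴ * T'ᴴ) * Lᴴ := by
              rw [mul_assoc _ Lᴴ, e2]; simp only [mul_assoc]
      have h4 := congrArg (fun M => L⁻¹ * (M * (Lᴴ)⁻¹)) h3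
      simpa only [mul_nonsing_inv_cancel_right _ _ hLH, nonsing_inv_mul_cancel_left _ _ hL] using h4
    have h5 := congrFun (congrFun h2 i) j
    rw [mul_assoc, Matrix.mul_apply, mul_assoc, mul_assoc, hΛ, diagonal_conjTranspose] at h5
    rw [diagonal_mul, ← mul_assoc, Matrix.mul_apply, Finset.mul_sum] at h5
    simp only [← mul_assoc, mul_diagonal, diagonal_mul, conjTranspose_apply, Pi.star_apply] at h5
    have hcm : c ^ m * c ^ m ≠ 0 := mul_ne_zero (pow_ne_zero _ hc0) (pow_ne_zero _ hc0)
    have hst : ∀ k : Fin (m + 1), star (c ^ m * (-Complex.I * (τ : ℂ)) ^ (k : ℕ)) =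
        c ^ m * (Complex.I * τ) ^ (k : ℕ) := by
      intro k
      simp [hc, -Complex.ofReal_cos, Complex.conj_ofReal]
    simp only [hst] at h5
    refine mul_left_cancel₀ hcm ?_
    rw [Finset.mul_sum, Finset.mul_sum]
    convert h5 using 1 <;> refine Finset.sum_congr rfl fun k _ => ?_ <;> ring
  -- The identity holds for all τ > 0, hence between polynomials; this is the coefficient of
  -- τ^{k+j}.
  have hcoeff : ∀ i j k : Fin (m + 1),
      T' i k * gramCore m k j * ((-Complex.I) ^ (k : ℕ) * Complex.I ^ (j : ℕ)) =
        ∑ k' : Fin (m + 1), if (i : ℕ) + k' = k + j then gramCore m i k' * star (T' j k') *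
          ((-Complex.I) ^ (i : ℕ) * Complex.I ^ (k' : ℕ)) else 0 := by
    intro i j k
    let P : Polynomial ℂ := ∑ k : Fin (m + 1), Polynomial.monomial ((k : ℕ) + j)
      (T' i k * gramCore m k j * ((-Complex.I) ^ (k : ℕ) * Complex.I ^ (j : ℕ)))
    let Q : Polynomial ℂ := ∑ k : Fin (m + 1), Polynomial.monomial ((i : ℕ) + k)
      (gramCore m i k * star (T' j k) * ((-Complex.I) ^ (i : ℕ) * Complex.I ^ (k : ℕ)))
    have hPQ : P = Q := by
      refine Polynomial.eq_of_infinite_eval_eq P Q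
        (((Set.Ioi_infinite (0 : ℝ)).image Complex.ofReal_injective.injOn).mono ?_)
      rintro _ ⟨τ, hτ, rfl⟩
      have := hcore τ hτ i j
      simp only [P, Q, Set.mem_ofPred_eq, Polynomial.eval_finsetSum, Polynomial.eval_monomial]
      convert this using 1 <;> refine Finset.sum_congr rfl fun k _ => ?_ <;>
        rw [mul_pow, mul_pow, pow_add] <;> ring
    have := congrArg (fun p => Polynomial.coeff p ((k : ℕ) + j)) hPQ
    simp only [P, Q, Polynomial.finsetSum_coeff, Polynomial.coeff_monomial] at this
    rw [← this, Finset.sum_eq_single k, if_pos rfl]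
    · intro b _ hb
      rw [if_neg]
      intro h; exact hb (Fin.ext (by omega))
    · simp
  have hI : ∀ a b : ℕ, (-Complex.I) ^ a * Complex.I ^ b ≠ 0 := fun a b =>
    mul_ne_zero (pow_ne_zero _ (neg_ne_zero.2 Complex.I_ne_zero)) (pow_ne_zero _ Complex.I_ne_zero)
  have hdiag : ∀ i k : Fin (m + 1), i ≠ k → T' i k = 0 := by
    intro i k hik
    by_contra hne
    have hev := hpar i k hne
    have hi := i.2
    have hk := k.2
    have hik' : (i : ℕ) ≠ k := fun h => hik (Fin.ext h)
    -- Here i and k have equal parity, so they differ by at least 2. Taking j at the end of the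
    -- range (m or m - 1 if i < k, 0 or 1 if i > k, by parity) puts k + j - i outside 0, …, m. The
    -- right side of `hcoeff` is then empty while the coefficient of T' i k is nonzero.
    obtain ⟨j, hj, hjk⟩ : ∃ j : Fin (m + 1), Even ((k : ℕ) + j) ∧
        ∀ k' : Fin (m + 1), (i : ℕ) + k' ≠ k + j := by
      rw [Nat.even_iff] at hev
      rcases lt_or_gt_of_ne hik' with h | h
      · rcases Nat.even_or_odd ((k : ℕ) + m) with h2 | h2
        · exact ⟨⟨m, by omega⟩, h2, fun k' => by have := k'.2; simp only; omega⟩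
        · rw [Nat.odd_iff] at h2
          refine ⟨⟨m - 1, by omega⟩, ?_, fun k' => ?_⟩
          · rw [Nat.even_iff]; simp only; omega
          · have := k'.2; simp only; omega
      · rcases Nat.even_or_odd (k : ℕ) with h2 | h2
        · exact ⟨0, by simpa using h2, fun k' => by simp; omega⟩
        · rw [Nat.odd_iff] at h2
          refine ⟨⟨1, by omega⟩, ?_, fun k' => ?_⟩
          · rw [Nat.even_iff]; simp only; omega
          · simp only; omega
    have h := hcoeff i j k
    rw [Finset.sum_eq_zero fun k' _ => if_neg (hjk k')] at h
    exact mul_ne_zero (mul_ne_zero hne (gramCore_ne_zero m hj)) (hI _ _) h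
  have hstar : ∀ i j : Fin (m + 1), Even ((i : ℕ) + j) → T' i i = star (T' j j) := by
    intro i j hij
    have h := hcoeff i j i
    rw [Finset.sum_eq_single j, if_pos rfl] at h
    · have h1 := mul_right_cancel₀ (hI _ _) h
      rw [mul_comm] at h1
      exact mul_left_cancel₀ (gramCore_ne_zero m hij) h1
    · intro b _ hb
      rw [if_neg]
      intro h; exact hb (Fin.ext (by omega))
    · simp
  -- Applying `hstar` with both indices equal shows that the diagonal entries are real.
  have heq : ∀ i j : Fin (m + 1), Even ((i : ℕ) + j) → T' i i = T' j j := fun i j hij => by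
    rw [hstar i j hij, ← hstar j j ⟨_, rfl⟩]
  obtain ⟨a, b, hab⟩ : ∃ a b : ℂ, T' = a • 1 + b • signs m := by
    by_cases hm : m = 0
    · refine ⟨T' 0 0, 0, ?_⟩
      ext i j
      have hi : i = 0 := Fin.ext (by have := i.2; rw [Fin.val_zero]; omega)
      have hj : j = 0 := Fin.ext (by have := j.2; rw [Fin.val_zero]; omega)
      rw [hi, hj]
      simp
    · let i1 : Fin (m + 1) := ⟨1, by omega⟩
      refine ⟨(T' 0 0 + T' i1 i1) / 2, (T' 0 0 - T' i1 i1) / 2, ?_⟩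
      ext i j
      rw [Matrix.add_apply, Matrix.smul_apply, Matrix.smul_apply, signs, diagonal_apply,
        Matrix.one_apply]
      split_ifs with h
      · subst h
        rcases Nat.even_or_odd (i : ℕ) with h2 | h2
        · rw [heq i 0 (by simpa using h2), h2.neg_one_pow]; simp; ring
        · rw [heq i i1 (by simpa [i1] using h2.add_odd odd_one), h2.neg_one_pow]; simp; ring
      · rw [hdiag i j h]; simp
  refine ⟨a, b, ?_⟩
  have h1 : T * L = (a • 1 + b • flip m) * L := by
    rw [hTL, hab, add_mul, mul_add, smul_mul_assoc, smul_mul_assoc, mul_smul_comm, mul_smul_comm,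
      one_mul, mul_one, flip_mul_adapt]
  have := congrArg (· * L⁻¹) h1
  simpa only [mul_nonsing_inv_cancel_right _ _ hL] using this

/-! ### Existence and uniqueness of monic orthogonal polynomials -/

section OrthogonalPolynomials
variable {n : Type*} [Fintype n] {w : ℝ → Matrix n n ℂ}

open Polynomial (degree natDegree eval coeff monomial)

/-- The value at `x` of a row of polynomials. -/
def rowVal (p : n → Polynomial ℂ) (x : ℝ) : n → ℂ := fun i => (p i).eval (x : ℂ)

/-- The sesquilinear form of a weight on rows of polynomials. -/
def rowForm (w : ℝ → Matrix n n ℂ) (p q : n → Polynomial ℂ) : ℂ :=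
  ∫ x in (-1 : ℝ)..1, (rowVal p x ᵥ* w x) ⬝ᵥ star (rowVal q x)

theorem pairing_apply (w : ℝ → Matrix n n ℂ) (P Q : Matrix n n (Polynomial ℂ)) (i j : n) :
    pairing w P Q i j = rowForm w (P i) (Q j) := rfl

theorem IsWeight.integrableOn_eval_mul (hw : IsWeight w) (p : Polynomial ℂ) (i j : n) :
    IntegrableOn (fun x : ℝ => p.eval (x : ℂ) * w x i j) (Ioo (-1) 1) := by
  induction p using Polynomial.induction_on' with
  | add p q hp hq =>
    simp only [Polynomial.eval_add, add_mul]
    exact hp.add hq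
  | monomial k a =>
    simp only [Polynomial.eval_monomial, mul_assoc]
    exact (hw.moments k i j).const_mul a

theorem IsWeight.integrableOn_rowVal (hw : IsWeight w) (p q : n → Polynomial ℂ) :
    IntegrableOn (fun x => (rowVal p x ᵥ* w x) ⬝ᵥ star (rowVal q x)) (Ioo (-1) 1) := by
  have e : (fun x => (rowVal p x ᵥ* w x) ⬝ᵥ star (rowVal q x)) = fun x : ℝ => ∑ j, ∑ i,
      (p i * (q j).map (starRingEnd ℂ)).eval (x : ℂ) * w x i j := by
    ext x
    simp only [Matrix.vecMul, dotProduct, Finset.sum_mul]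
    refine Finset.sum_congr rfl fun j _ => Finset.sum_congr rfl fun i _ => ?_
    have : ((q j).map (starRingEnd ℂ)).eval (x : ℂ) = star ((q j).eval (x : ℂ)) := by
      conv_lhs => rw [← Complex.conj_ofReal x]
      rw [Polynomial.eval_map, Polynomial.eval₂_hom]; rfl
    rw [Polynomial.eval_mul, this]
    simp only [rowVal, Pi.star_apply]
    ring
  rw [e]
  exact integrable_finsetSum _ fun j _ => integrable_finsetSum _ fun i _ =>
    hw.integrableOn_eval_mul _ i j

theorem IsWeight.intervalIntegrable_rowVal (hw : IsWeight w) (p q : n → Polynomial ℂ) :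
    IntervalIntegrable (fun x => (rowVal p x ᵥ* w x) ⬝ᵥ star (rowVal q x)) volume (-1) 1 :=
  (intervalIntegrable_iff_integrableOn_Ioo_of_le (by norm_num)).2 (hw.integrableOn_rowVal p q)

theorem rowForm_eq (w : ℝ → Matrix n n ℂ) (p q : n → Polynomial ℂ) :
    rowForm w p q = ∫ x in Ioo (-1 : ℝ) 1, (rowVal p x ᵥ* w x) ⬝ᵥ star (rowVal q x) := by
  rw [rowForm, intervalIntegral.integral_of_le (by norm_num), integral_Ioc_eq_integral_Ioo]

theorem rowVal_add {n : Type*} (p q : n → Polynomial ℂ) (x : ℝ) : rowVal (p + q) x =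
    rowVal p x + rowVal q x := by
  ext; simp [rowVal]

theorem rowVal_smul {n : Type*} (c : ℂ) (p : n → Polynomial ℂ) (x : ℝ) : rowVal (c • p) x =
    c • rowVal p x := by
  ext; simp [rowVal]

theorem IsWeight.rowForm_add_left (hw : IsWeight w) (p p' q : n → Polynomial ℂ) :
    rowForm w (p + p') q = rowForm w p q + rowForm w p' q := by
  simp only [rowForm, rowVal_add, Matrix.add_vecMul, add_dotProduct]
  exact intervalIntegral.integral_add (hw.intervalIntegrable_rowVal p q)
    (hw.intervalIntegrable_rowVal p' q)

theorem IsWeight.rowForm_add_right (hw : IsWeight w) (p q q' : n → Polynomial ℂ) :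
    rowForm w p (q + q') = rowForm w p q + rowForm w p q' := by
  simp only [rowForm, rowVal_add, star_add, dotProduct_add]
  exact intervalIntegral.integral_add (hw.intervalIntegrable_rowVal p q)
    (hw.intervalIntegrable_rowVal p q')

theorem rowForm_smul_left (w : ℝ → Matrix n n ℂ) (c : ℂ) (p q : n → Polynomial ℂ) :
    rowForm w (c • p) q = c * rowForm w p q := by
  simp only [rowForm, rowVal_smul, Matrix.smul_vecMul, smul_dotProduct, smul_eq_mul]
  exact intervalIntegral.integral_const_mul _ _

theorem rowForm_smul_right (w : ℝ → Matrix n n ℂ) (c : ℂ) (p q : n → Polynomial ℂ) :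
    rowForm w p (c • q) = star c * rowForm w p q := by
  simp only [rowForm, rowVal_smul, star_smul, dotProduct_smul, smul_eq_mul]
  exact intervalIntegral.integral_const_mul _ _

theorem IsWeight.rowForm_sub_left (hw : IsWeight w) (p p' q : n → Polynomial ℂ) :
    rowForm w (p - p') q = rowForm w p q - rowForm w p' q := by
  have h := hw.rowForm_add_left p ((-1 : ℂ) • p') q
  rw [rowForm_smul_left] at h
  have e : p - p' = p + (-1 : ℂ) • p' := by rw [neg_one_smul, sub_eq_add_neg]
  rw [e, h]; ring

theorem IsWeight.rowForm_star (hw : IsWeight w) (p q : n → Polynomial ℂ) :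
    star (rowForm w p q) = rowForm w q p := by
  rw [rowForm_eq, rowForm_eq, Complex.star_def, ← integral_conj]
  refine integral_congr_ae ?_
  filter_upwards [hw.posDef] with x hx
  have h : (w x)ᴴ = w x := hx.isHermitian
  change star ((rowVal p x ᵥ* w x) ⬝ᵥ star (rowVal q x)) = (rowVal q x ᵥ* w x) ⬝ᵥ star (rowVal p x)
  rw [← Matrix.star_dotProduct_star, star_star, Matrix.star_vecMul, h, dotProduct_comm,
    ← Matrix.dotProduct_mulVec]
  exact dotProduct_comm _ _

/-- The integrand is nonnegative, so it vanishes almost everywhere, and so does p by positive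
definiteness; a nonzero polynomial has only finitely many zeros. -/
theorem IsWeight.rowForm_self_eq_zero (hw : IsWeight w) {p : n → Polynomial ℂ}
    (h : rowForm w p p = 0) : p = 0 := by
  have hpos : ∀ᵐ x ∂(volume.restrict (Ioo (-1 : ℝ) 1)),
      rowVal p x ≠ 0 → 0 < (rowVal p x ᵥ* w x) ⬝ᵥ star (rowVal p x) := by
    filter_upwards [hw.posDef] with x hx hne
    have := hx.dotProduct_mulVec_pos (x := star (rowVal p x)) (star_ne_zero.2 hne)
    rwa [star_star, Matrix.dotProduct_mulVec] at this
  have hre : ∫ x in Ioo (-1 : ℝ) 1, ((rowVal p x ᵥ* w x) ⬝ᵥ star (rowVal p x)).re = 0 := by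
    have := integral_re (hw.integrableOn_rowVal p p)
    rw [rowForm_eq] at h
    rw [h] at this
    simpa using this
  rw [setIntegral_eq_zero_iff_of_nonneg_ae] at hre
  · have hz : ∀ᵐ x ∂(volume.restrict (Ioo (-1 : ℝ) 1)), rowVal p x = 0 := by
      filter_upwards [hpos, hre] with x h1 h2
      by_contra hne
      exact ((Complex.lt_def.1 (h1 hne)).1).ne' h2
    ext1 i
    by_contra hne
    have hfin : ({x : ℝ | (p i).eval (x : ℂ) = 0}).Finite := by
      have := (Polynomial.finite_setOfPred_isRoot hne).preimage
        (Complex.ofReal_injective.injOn (s := Complex.ofReal ⁻¹' {x | (p i).IsRoot x}))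
      exact this
    have hnull : ∀ᵐ x : ℝ ∂(volume.restrict (Ioo (-1 : ℝ) 1)), (p i).eval (x : ℂ) ≠ 0 :=
      ae_restrict_of_ae (measure_eq_zero_iff_ae_notMem.1 (hfin.measure_zero volume))
    have hF : ∀ᵐ x ∂(volume.restrict (Ioo (-1 : ℝ) 1)), False := by
      filter_upwards [hz, hnull] with x h1 h2
      exact h2 (congrFun h1 i)
    rw [Filter.eventually_false_iff_eq_bot, ae_eq_bot, Measure.restrict_eq_zero] at hF
    simp at hF
    exact absurd hF (by norm_num)
  · filter_upwards [hpos] with x hx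
    by_cases h0 : rowVal p x = 0
    · simp [h0]
    · exact (Complex.lt_def.1 (hx h0)).1.le
  · exact (hw.integrableOn_rowVal p p).re

theorem IsWeight.rowForm_eq_zero_of_mem_span (hw : IsWeight w) {p : n → Polynomial ℂ}
    {s : Set (n → Polynomial ℂ)} (hs : ∀ r ∈ s, rowForm w p r = 0) {q : n → Polynomial ℂ}
    (hq : q ∈ Submodule.span ℂ s) : rowForm w p q = 0 := by
  induction hq using Submodule.span_induction with
  | mem r hr => exact hs r hr
  | zero => simp [rowForm, rowVal, dotProduct]
  | add r r' _ _ h h' => rw [hw.rowForm_add_right, h, h', add_zero]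
  | smul c r _ h => rw [rowForm_smul_right, h, mul_zero]

/-- The row of polynomials of degree less than `d` with the given coefficients. -/
def toRow {n : Type*} (d : ℕ) : (Fin d × n → ℂ) →ₗ[ℂ] (n → Polynomial ℂ) where
  toFun c j := ∑ k : Fin d, monomial (k : ℕ) (c (k, j))
  map_add' c c' := by ext1 j; simp [Finset.sum_add_distrib]
  map_smul' a c := by ext1 j; simp [Finset.smul_sum, Polynomial.smul_monomial]

theorem coeff_toRow {n : Type*} (d : ℕ) (c : Fin d × n → ℂ) (j : n) (k : Fin d) :
    ((toRow d c) j).coeff k = c (k, j) := by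
  change (∑ k : Fin d, monomial (k : ℕ) (c (k, j))).coeff k = _
  rw [Polynomial.finsetSum_coeff, Finset.sum_eq_single k]
  · rw [Polynomial.coeff_monomial, if_pos rfl]
  · intro b _ hb
    rw [Polynomial.coeff_monomial, if_neg fun h => hb (Fin.ext h)]
  · simp

theorem degree_toRow_lt {n : Type*} (d : ℕ) (c : Fin d × n → ℂ) (j : n) :
    ((toRow d c) j).degree < d := by
  change (∑ k : Fin d, monomial (k : ℕ) (c (k, j))).degree < _
  refine (Polynomial.degree_sum_le _ _).trans_lt ((Finset.sup_lt_iff (WithBot.bot_lt_coe d)).2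
    fun k _ => (Polynomial.degree_monomial_le _ _).trans_lt ?_)
  exact WithBot.coe_lt_coe.2 k.2

theorem exists_toRow {n : Type*} (d : ℕ) {q : n → Polynomial ℂ} (hq : ∀ j, (q j).degree < d) :
    q = toRow d fun x => (q x.2).coeff x.1 := by
  ext j k
  by_cases hk : k < d
  · exact (coeff_toRow d (fun x => (q x.2).coeff x.1) j ⟨k, hk⟩).symm
  · rw [Polynomial.coeff_eq_zero_of_degree_lt ((hq j).trans_le (by exact_mod_cast not_lt.1 hk)),
      Polynomial.coeff_eq_zero_of_degree_lt ((degree_toRow_lt d _ j).trans_le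
        (by exact_mod_cast not_lt.1 hk))]

variable [DecidableEq n]

theorem coeff_apply_eq_one {n : Type*} [DecidableEq n] {P : Matrix n n (Polynomial ℂ)} {d : ℕ}
    (h : P.map (fun p => p.coeff d) = 1) (i j : n) : (P i j).coeff d = if i = j then 1 else 0 := by
  have := congrFun (congrFun h i) j
  rwa [Matrix.map_apply, Matrix.one_apply] at this

/-- Triangularity: subtracting the combination of the rows of P_N given by the coefficients of X^N
lowers the degree, because P_N has leading coefficient 1. -/
theorem mem_span_rows {P : ℕ → Matrix n n (Polynomial ℂ)}
    (hdeg : ∀ d i j, (P d i j).natDegree ≤ d) (hlead : ∀ d, (P d).map (fun p => p.coeff d) = 1)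
    (N : ℕ) (q : n → Polynomial ℂ) (hq : ∀ j, (q j).degree < N) :
    q ∈ Submodule.span ℂ {r | ∃ e < N, ∃ k, r = P e k} := by
  induction N generalizing q with
  | zero =>
    have : q = 0 := funext fun j => by
      have := hq j
      rw [Nat.cast_zero] at this
      exact Polynomial.degree_eq_bot.1 (Nat.WithBot.lt_zero_iff.1 this)
    rw [this]; exact Submodule.zero_mem _
  | succ N ih =>
    set r : n → Polynomial ℂ := ∑ k, (q k).coeff N • P N k with hr
    have hrj : ∀ j, r j = ∑ k, (q k).coeff N • P N k j := fun j => by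
      rw [hr, Finset.sum_apply]; rfl
    have h1 : ∀ j, ((q - r) j).degree < N := by
      intro j
      rw [Polynomial.degree_lt_iff_coeff_zero]
      intro l hl
      rw [Pi.sub_apply, Polynomial.coeff_sub, hrj, Polynomial.finsetSum_coeff]
      simp only [Polynomial.coeff_smul, smul_eq_mul]
      rcases hl.eq_or_lt with rfl | hl
      · simp [coeff_apply_eq_one (hlead N)]
      · rw [Polynomial.coeff_eq_zero_of_degree_lt ((hq j).trans_le (by exact_mod_cast hl)),
          Finset.sum_eq_zero, sub_zero]
        intro k _
        rw [Polynomial.coeff_eq_zero_of_natDegree_lt ((hdeg N k j).trans_lt hl), mul_zero]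
    have h2 : q = (q - r) + r := by abel
    rw [h2]
    refine Submodule.add_mem _ (Submodule.span_mono ?_ (ih _ h1)) (Submodule.sum_mem _ fun k _ =>
      Submodule.smul_mem _ _ (Submodule.subset_span ⟨N, Nat.lt_succ_self N, k, rfl⟩))
    rintro _ ⟨e, he, k, rfl⟩
    exact ⟨e, he.trans (Nat.lt_succ_self N), k, rfl⟩

theorem IsMonicOPS.rowForm_eq_zero (hw : IsWeight w) {P : ℕ → Matrix n n (Polynomial ℂ)}
    (hP : IsMonicOPS w P) (d : ℕ) (i : n) {q : n → Polynomial ℂ} (hq : ∀ j, (q j).degree < d) :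
    rowForm w (P d i) q = 0 := by
  refine hw.rowForm_eq_zero_of_mem_span ?_ (mem_span_rows hP.natDegree_le hP.leadingCoeff d q hq)
  rintro _ ⟨e, he, k, rfl⟩
  rw [← pairing_apply, hP.orthogonal d e he.ne', Matrix.zero_apply]

/-- The difference of two monic candidates has degree less than d, so it is orthogonal to itself. -/
theorem IsMonicOPS.unique (hw : IsWeight w) {P P' : ℕ → Matrix n n (Polynomial ℂ)}
    (hP : IsMonicOPS w P) (hP' : IsMonicOPS w P') : P = P' := by
  ext1 d
  funext i
  rw [← sub_eq_zero]
  have hdeg : ∀ j, ((P d i - P' d i) j).degree < d := by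
    intro j
    rw [Polynomial.degree_lt_iff_coeff_zero]
    intro l hl
    rw [Pi.sub_apply, Polynomial.coeff_sub]
    rcases hl.eq_or_lt with rfl | hl
    · rw [coeff_apply_eq_one (hP.leadingCoeff d), coeff_apply_eq_one (hP'.leadingCoeff d), sub_self]
    · rw [Polynomial.coeff_eq_zero_of_natDegree_lt ((hP.natDegree_le d i j).trans_lt hl),
        Polynomial.coeff_eq_zero_of_natDegree_lt ((hP'.natDegree_le d i j).trans_lt hl), sub_self]
  refine hw.rowForm_self_eq_zero ?_
  rw [hw.rowForm_sub_left, hP.rowForm_eq_zero hw d i hdeg, hP'.rowForm_eq_zero hw d i hdeg, sub_self]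

/-- The row whose only nonzero entry is `X ^ k`, at position `j`. -/
def monoRow (k : ℕ) (j : n) : n → Polynomial ℂ := Pi.single j (monomial k 1)

theorem toRow_mem_span (d : ℕ) (c : Fin d × n → ℂ) :
    toRow d c ∈ Submodule.span ℂ {r : n → Polynomial ℂ | ∃ k < d, ∃ j, r = monoRow k j} := by
  have : toRow d c = ∑ k : Fin d, ∑ j, c (k, j) • monoRow (k : ℕ) j := by
    ext1 j
    rw [Finset.sum_apply]
    change ∑ k : Fin d, monomial (k : ℕ) (c (k, j)) = _
    refine Finset.sum_congr rfl fun k _ => ?_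
    rw [Finset.sum_apply, Finset.sum_eq_single j]
    · simp [monoRow, Polynomial.smul_monomial]
    · intro b _ hb
      simp [monoRow, Pi.single_eq_of_ne hb.symm]
    · simp
  rw [this]
  exact Submodule.sum_mem _ fun k _ => Submodule.sum_mem _ fun j _ =>
    Submodule.smul_mem _ _ (Submodule.subset_span ⟨k, k.2, j, rfl⟩)

/-- The Gram map on rows of degree less than d is injective by definiteness, hence surjective in
finite dimension; this solves for the projection of the monomial row. -/
theorem IsWeight.exists_orthogonal_row (hw : IsWeight w) (d : ℕ) (i : n) :
    ∃ c : Fin d × n → ℂ, ∀ q : n → Polynomial ℂ, (∀ j, (q j).degree < d) →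
      rowForm w (monoRow d i - toRow d c) q = 0 := by
  let A : (Fin d × n → ℂ) →ₗ[ℂ] (Fin d × n → ℂ) :=
    { toFun := fun c x => rowForm w (toRow d c) (monoRow x.1 x.2)
      map_add' := fun c c' => by ext x; simp [hw.rowForm_add_left]
      map_smul' := fun a c => by ext x; simp [rowForm_smul_left] }
  have hspan : ∀ p : n → Polynomial ℂ, (∀ (k : Fin d) j, rowForm w p (monoRow k j) = 0) →
      ∀ q : n → Polynomial ℂ, (∀ j, (q j).degree < d) → rowForm w p q = 0 := by
    intro p hp q hq
    rw [exists_toRow d hq]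
    refine hw.rowForm_eq_zero_of_mem_span ?_ (toRow_mem_span d _)
    rintro _ ⟨k, hk, j, rfl⟩
    exact hp ⟨k, hk⟩ j
  have hinj : Function.Injective A := by
    rw [← LinearMap.ker_eq_bot, LinearMap.ker_eq_bot']
    intro c hc
    have h0 := hw.rowForm_self_eq_zero (hspan (toRow d c) (fun k j => congrFun hc (k, j)) _
      (degree_toRow_lt d c))
    ext ⟨k, j⟩
    rw [← coeff_toRow d c j k, h0]; simp
  obtain ⟨c, hc⟩ := LinearMap.injective_iff_surjective.1 hinj
    (fun x => rowForm w (monoRow d i) (monoRow x.1 x.2))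
  refine ⟨c, hspan _ fun k j => ?_⟩
  rw [hw.rowForm_sub_left, ← congrFun hc (k, j)]
  exact sub_self _

theorem IsWeight.existsUnique_isMonicOPS (hw : IsWeight w) : ∃! P, IsMonicOPS w P := by
  choose c hc using hw.exists_orthogonal_row
  let P : ℕ → Matrix n n (Polynomial ℂ) := fun d i => monoRow d i - toRow d (c d i)
  have hdeg : ∀ d i j, (P d i j).natDegree ≤ d := by
    intro d i j
    refine Polynomial.natDegree_le_of_degree_le ((Polynomial.degree_sub_le _ _).trans
      (max_le ?_ (degree_toRow_lt d _ j).le))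
    rw [monoRow, Pi.single_apply]
    split_ifs
    · exact Polynomial.degree_monomial_le _ _
    · simp
  have hlt : ∀ d e, d < e → ∀ i j, rowForm w (P e i) (P d j) = 0 := fun d e hde i j =>
    hc e i _ fun k => (Polynomial.degree_le_of_natDegree_le (hdeg d j k)).trans_lt
      (by exact_mod_cast hde)
  have hP : IsMonicOPS w P := by
    refine ⟨hdeg, fun d => ?_, fun d e hde => ?_⟩
    · ext i j
      rw [Matrix.map_apply, Matrix.one_apply]
      change (monoRow d i j - toRow d (c d i) j).coeff d = _
      rw [Polynomial.coeff_sub, Polynomial.coeff_eq_zero_of_degree_lt (degree_toRow_lt d _ j), monoRow,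
        Pi.single_apply, sub_zero]
      simp only [eq_comm (a := j)]
      split_ifs <;> simp
    · ext i j
      rw [pairing_apply, Matrix.zero_apply]
      rcases lt_or_gt_of_ne hde with h | h
      · rw [← hw.rowForm_star, hlt d e h, star_zero]
      · exact hlt e d h i j
  exact ⟨P, hP, fun P' hP' => hP'.unique hw hP⟩

end OrthogonalPolynomials

/-! ### Block decompositions -/

section Blocks
variable {a b N : ℕ} (h : a + b = N)

theorem inBlocks_mul (A B : Matrix (Fin N) (Fin N) ℂ) :
    inBlocks h (A * B) = inBlocks h A * inBlocks h B :=
  (Matrix.submatrix_mul_equiv A B _ (blockEquiv h) _).symm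

/-- The matrix with the given blocks. -/
def ofBlocks {R : Type*} (A : Matrix (Fin a ⊕ Fin b) (Fin a ⊕ Fin b) R) : Matrix (Fin N)
    (Fin N) R :=
  A.submatrix (blockEquiv h).symm (blockEquiv h).symm

theorem ofBlocks_mul (A B : Matrix (Fin a ⊕ Fin b) (Fin a ⊕ Fin b) ℂ) :
    ofBlocks h (A * B) = ofBlocks h A * ofBlocks h B :=
  (Matrix.submatrix_mul_equiv A B _ (blockEquiv h).symm _).symm

theorem inBlocks_ofBlocks {R : Type*} (A : Matrix (Fin a ⊕ Fin b) (Fin a ⊕ Fin b) R) :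
    inBlocks h (ofBlocks h A) = A := by
  ext i j; simp [inBlocks, ofBlocks]

theorem ofBlocks_inBlocks {R : Type*} (A : Matrix (Fin N) (Fin N) R) :
    ofBlocks h (inBlocks h A) = A := by
  ext i j; simp [inBlocks, ofBlocks]

theorem ofBlocks_conjTranspose (A : Matrix (Fin a ⊕ Fin b) (Fin a ⊕ Fin b) ℂ) :
    (ofBlocks h A)ᴴ = ofBlocks h Aᴴ := rfl

theorem inBlocks_conjTranspose (A : Matrix (Fin N) (Fin N) ℂ) :
    (inBlocks h A)ᴴ = inBlocks h Aᴴ := rfl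

theorem inBlocks_smul (c : ℂ) (A : Matrix (Fin N) (Fin N) ℂ) :
    inBlocks h (c • A) = c • inBlocks h A := rfl

theorem inBlocks_one : inBlocks h (1 : Matrix (Fin N) (Fin N) ℂ) = 1 :=
  Matrix.submatrix_one_equiv _

variable {h}

/-- Commuting with diag(ε, -ε) forces 2ε times each off-diagonal block to vanish. -/
theorem inBlocks_eq_fromBlocks {B J : Matrix (Fin N) (Fin N) ℂ} {ε : ℂ} (hε : ε ≠ 0)
    (hJ : inBlocks h J = fromBlocks (ε • 1) 0 0 (-ε • 1)) (hc : B * J = J * B) :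
    inBlocks h B = fromBlocks (inBlocks h B).toBlocks₁₁ 0 0 (inBlocks h B).toBlocks₂₂ := by
  have e := congrArg (inBlocks h) hc
  rw [inBlocks_mul, inBlocks_mul, hJ] at e
  generalize inBlocks h B = M at e ⊢
  rw [← fromBlocks_toBlocks M, fromBlocks_multiply, fromBlocks_multiply, fromBlocks_inj] at e
  simp only [Matrix.mul_zero, Matrix.zero_mul, add_zero, zero_add, Matrix.mul_smul, Matrix.smul_mul,
    Matrix.mul_one, Matrix.one_mul] at e
  have h2 : (2 : ℂ) * ε ≠ 0 := mul_ne_zero two_ne_zero hε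
  have h12 : M.toBlocks₁₂ = 0 := by
    refine (smul_eq_zero_iff_right h2).1 ?_
    rw [mul_smul, two_smul]
    nth_rw 1 [← e.2.1]
    rw [neg_smul, neg_add_cancel]
  have h21 : M.toBlocks₂₁ = 0 := by
    refine (smul_eq_zero_iff_right h2).1 ?_
    rw [mul_smul, two_smul]
    nth_rw 1 [e.2.2.1]
    rw [neg_smul, neg_add_cancel]
  conv_lhs => rw [← fromBlocks_toBlocks M, h12, h21]

/-- A family of matrices with trivial real commutant does not reduce to a smaller size. -/
theorem not_reduces {D : Set ℝ} {w : ℝ → Matrix (Fin N) (Fin N) ℂ}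
    (hw : ∀ E : Matrix (Fin N) (Fin N) ℂ, (∀ x ∈ D, E * w x = w x * Eᴴ) → ∃ c : ℂ, E = c • 1) :
    ¬ Reduces D w := by
  rintro ⟨a, b, h, M, w₁, w₂, ha, hb, hM, hD⟩
  have hM' : IsUnit M.det := (Matrix.isUnit_iff_isUnit_det _).1 hM
  -- The projection on the first summand commutes with diag(w₁, w₂), so M p M⁻¹ satisfies the
  -- commutation hypothesis. It is not scalar: p has both a 1 and a 0 on its diagonal, as both sizes
  -- are positive.
  let p : Matrix (Fin N) (Fin N) ℂ := ofBlocks h (fromBlocks 1 0 0 0)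
  have hp : pᴴ = p := by
    simp only [p]
    rw [ofBlocks_conjTranspose, fromBlocks_conjTranspose]
    simp
  obtain ⟨c, hc⟩ := hw (M * p * M⁻¹) fun x hx => by
    have hcomm : p * ofBlocks h (fromBlocks (w₁ x) 0 0 (w₂ x)) =
        ofBlocks h (fromBlocks (w₁ x) 0 0 (w₂ x)) * p := by
      simp only [p]
      rw [← ofBlocks_mul, ← ofBlocks_mul, fromBlocks_multiply, fromBlocks_multiply]
      simp
    have hMM : Mᴴ * (M⁻¹)ᴴ = 1 := by
      rw [← Matrix.conjTranspose_mul, nonsing_inv_mul _ hM', conjTranspose_one]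
    have hwx : w x = M * ofBlocks h (fromBlocks (w₁ x) 0 0 (w₂ x)) * Mᴴ := hD x hx
    rw [hwx, Matrix.conjTranspose_mul, Matrix.conjTranspose_mul, hp]
    generalize ofBlocks h (fromBlocks (w₁ x) 0 0 (w₂ x)) = S at hcomm
    calc M * p * M⁻¹ * (M * S * Mᴴ) = M * p * (M⁻¹ * M) * S * Mᴴ := by simp only [mul_assoc]
      _ = M * (p * S) * Mᴴ := by rw [nonsing_inv_mul _ hM', mul_one]; simp only [mul_assoc]
      _ = M * S * (Mᴴ * (M⁻¹)ᴴ) * (p * Mᴴ) := by rw [hcomm, hMM, mul_one]; simp only [mul_assoc]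
      _ = M * S * Mᴴ * ((M⁻¹)ᴴ * (p * Mᴴ)) := by simp only [mul_assoc]
  have hpc : p = c • 1 := by
    calc p = (M⁻¹ * M) * p * (M⁻¹ * M) := by rw [nonsing_inv_mul _ hM', one_mul, mul_one]
      _ = M⁻¹ * (M * p * M⁻¹) * M := by simp only [mul_assoc]
      _ = c • 1 := by
        rw [hc, Matrix.mul_smul, Matrix.smul_mul, mul_one, nonsing_inv_mul _ hM']
  have hb' := congrArg (inBlocks h) hpc
  simp only [p] at hb'
  rw [inBlocks_ofBlocks, inBlocks_smul, inBlocks_one] at hb'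
  have h1 := congrFun (congrFun hb' (Sum.inl ⟨0, ha⟩)) (Sum.inl ⟨0, ha⟩)
  have h2 := congrFun (congrFun hb' (Sum.inr ⟨0, hb⟩)) (Sum.inr ⟨0, hb⟩)
  simp at h1 h2
  exact one_ne_zero (h1.trans h2.symm)

end Blocks

/-! ### The splitting matrices -/

/-- The orthogonal matrix whose rows are normalized eigenvectors of `flip m`: those with index below
the middle for the eigenvalue `ε`, those above the middle for `-ε`. -/
def splitMat (m : ℕ) (ε : ℝ) : Matrix (Fin (m + 1)) (Fin (m + 1)) ℝ := fun i j =>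
  if 2 * (i : ℕ) = m then (if j = i then 1 else 0)
  else (1 / Real.sqrt 2) *
    (if j = i then 1 else if j = Fin.rev i then (if 2 * (i : ℕ) < m then ε else -ε) else 0)

theorem rev_eq_self_iff {m : ℕ} (i : Fin (m + 1)) : Fin.rev i = i ↔ 2 * (i : ℕ) = m := by
  rw [Fin.ext_iff, Fin.val_rev]; omega

theorem splitMat_eq (m : ℕ) (ε : ℝ) (i j : Fin (m + 1)) : splitMat m ε i j =
    (if 2 * (i : ℕ) = m then 1 else 1 / Real.sqrt 2) * (1 : Matrix _ _ ℝ) i j +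
    (if 2 * (i : ℕ) = m then 0 else if 2 * (i : ℕ) < m then ε / Real.sqrt 2 else -ε / Real.sqrt 2) *
      (1 : Matrix _ _ ℝ) (Fin.rev i) j := by
  have := rev_eq_self_iff i
  unfold splitMat
  by_cases h : 2 * (i : ℕ) = m
  · simp [h, Matrix.one_apply, eq_comm]
  · have hr : Fin.rev i ≠ i := fun e => h (this.1 e)
    simp only [h, if_false, Matrix.one_apply]
    by_cases hj : j = i
    · subst hj; simp [hr]
    · by_cases hj' : j = Fin.rev i
      · subst hj'; simp [hr, hr.symm]; split_ifs <;> ring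
      · simp [hj, hj', Ne.symm hj, Ne.symm hj']

theorem splitMat_mul_apply (m : ℕ) (ε : ℝ) (A : Matrix (Fin (m + 1)) (Fin (m + 1)) ℝ)
    (i j : Fin (m + 1)) : (splitMat m ε * A) i j =
    (if 2 * (i : ℕ) = m then 1 else 1 / Real.sqrt 2) * A i j +
    (if 2 * (i : ℕ) = m then 0 else if 2 * (i : ℕ) < m then ε / Real.sqrt 2 else -ε / Real.sqrt 2) *
      A (Fin.rev i) j := by
  simp only [Matrix.mul_apply, splitMat_eq, add_mul, Finset.sum_add_distrib, mul_assoc,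
    ← Finset.mul_sum]
  simp [Matrix.one_apply]

theorem splitMat_mul_transpose (m : ℕ) {ε : ℝ} (hε : ε * ε = 1) :
    splitMat m ε * (splitMat m ε)ᵀ = 1 := by
  have h2 : (1 / Real.sqrt 2) * (1 / Real.sqrt 2) = 1 / 2 := by
    rw [div_mul_div_comm, Real.mul_self_sqrt (by norm_num), one_mul]
  ext i j
  rw [splitMat_mul_apply, transpose_apply, transpose_apply, splitMat_eq, splitMat_eq]
  have hi := rev_eq_self_iff i
  have hj := rev_eq_self_iff j
  have e1 : (1 : Matrix (Fin (m+1)) (Fin (m+1)) ℝ) (Fin.rev j) (Fin.rev i) =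
      (1 : Matrix _ _ ℝ) i j := by simp [Matrix.one_apply, eq_comm]
  have e2 : (1 : Matrix (Fin (m+1)) (Fin (m+1)) ℝ) j (Fin.rev i) =
      (1 : Matrix _ _ ℝ) (Fin.rev j) i := by
    simp only [Matrix.one_apply]; congr 1; rw [eq_iff_iff, Fin.rev_eq_iff]
  have e3 : (1 : Matrix (Fin (m+1)) (Fin (m+1)) ℝ) j i = (1 : Matrix _ _ ℝ) i j := by
    simp [Matrix.one_apply, eq_comm]
  rw [e1, e2, e3]
  by_cases hij : i = j
  · subst hij
    by_cases h : 2 * (i : ℕ) = m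
    · simp [h]
    · simp only [h, if_false, Matrix.one_apply, if_true, if_neg (fun e => h (hi.1 e))]
      split_ifs <;> ring_nf at * <;> nlinarith
  · by_cases hr : Fin.rev j = i
    · have hne : ¬ 2 * (i : ℕ) = m := fun e => hij (by
        have := hi.2 e; rw [← hr, Fin.rev_rev] at this; exact (this.trans hr).symm)
      have hv : (i : ℕ) + j = m := by rw [← hr, Fin.val_rev]; omega
      have hnj : ¬ 2 * (j : ℕ) = m := by omega
      simp only [hne, hnj, if_false, Matrix.one_apply, hr, hij, if_true]
      by_cases hl : 2 * (i : ℕ) < m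
      · rw [if_pos hl, if_neg (by omega)]; ring
      · rw [if_neg hl, if_pos (by omega)]; ring
    · simp [hij, hr]

theorem splitMat_mul_rev (m : ℕ) {ε : ℝ} (hε : ε * ε = 1) (i j : Fin (m + 1)) :
    splitMat m ε i (Fin.rev j) =
      (if 2 * (i : ℕ) = m then 1 else if 2 * (i : ℕ) < m then ε else -ε) * splitMat m ε i j := by
  have e1 : (1 : Matrix (Fin (m+1)) (Fin (m+1)) ℝ) (Fin.rev i) (Fin.rev j) =
      (1 : Matrix _ _ ℝ) i j := by simp [Matrix.one_apply]
  have e2 : (1 : Matrix (Fin (m+1)) (Fin (m+1)) ℝ) i (Fin.rev j) =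
      (1 : Matrix _ _ ℝ) (Fin.rev i) j := by
    simp only [Matrix.one_apply]; congr 1; rw [eq_iff_iff, eq_comm, Fin.rev_eq_iff, eq_comm]
  rw [splitMat_eq, splitMat_eq, e1, e2]
  by_cases h : 2 * (i : ℕ) = m
  · rw [(rev_eq_self_iff i).2 h]
    simp [h]
  · simp only [h, if_false]
    split_ifs
    · linear_combination (-(1 / Real.sqrt 2 * (1 : Matrix (Fin (m+1)) (Fin (m+1)) ℝ) (Fin.rev i) j)) * hε
    · linear_combination (-(1 / Real.sqrt 2 * (1 : Matrix (Fin (m+1)) (Fin (m+1)) ℝ) (Fin.rev i) j)) * hε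

/-- In the middle `Fin.rev k = k`, so the column is 2ψ_0, of norm 2; all other columns have norm √2.
-/
theorem eigenbasis_eq (m : ℕ) (i k : Fin (m + 1)) : eigenbasis m i k =
    (if 2 * (k : ℕ) = m then 2 else Real.sqrt 2) * splitMat m (-1) k i := by
  have h2 : Real.sqrt 2 ≠ 0 := by positivity
  have hk := rev_eq_self_iff k
  rw [splitMat_eq]
  unfold eigenbasis
  have e1 : (Pi.single k 1 : Fin (m + 1) → ℝ) i = (1 : Matrix _ _ ℝ) k i := by
    simp [Pi.single_apply, Matrix.one_apply, eq_comm]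
  have e2 : (Pi.single (Fin.rev k) 1 : Fin (m + 1) → ℝ) i = (1 : Matrix _ _ ℝ) (Fin.rev k) i := by
    simp [Pi.single_apply, Matrix.one_apply, eq_comm]
  simp only [e1, e2]
  by_cases h : 2 * (k : ℕ) = m
  · rw [hk.2 h, if_neg (by omega), if_pos h, if_pos h, if_pos h]; ring
  · simp only [h, if_false]
    split_ifs <;> field_simp
    ring

theorem Yl_eq (m : ℕ) : Yl m = ((splitMat m (-1)).map Complex.ofReal)ᵀ := by
  ext i k
  rw [transpose_apply, Matrix.map_apply, Yl]
  congr 1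
  have hs : (0 : ℝ) < (if 2 * (k : ℕ) = m then 2 else Real.sqrt 2) := by split_ifs <;> positivity
  have h1 := congrFun (congrFun (splitMat_mul_transpose m (ε := -1) (by norm_num)) k) k
  simp only [Matrix.mul_apply, transpose_apply, ← sq, Matrix.one_apply_eq] at h1
  simp only [eigenbasis_eq, mul_pow, ← Finset.mul_sum, h1, mul_one]
  rw [Real.sqrt_sq hs.le, mul_div_cancel_left₀ _ hs.ne']

/-- `Z` is unitary and brings `flip m` to the form `diag(ε, -ε)`. -/
structure Diagonalizes {a b m : ℕ} (h : a + b = m + 1) (Z : Matrix (Fin (m + 1)) (Fin (m + 1)) ℂ)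
    (ε : ℂ) : Prop where
  mul_conjTranspose : Z * Zᴴ = 1
  flip : inBlocks h (Z * flip m * Zᴴ) = fromBlocks (ε • 1) 0 0 (-ε • 1)
  ne_zero : ε ≠ 0

theorem ofReal_map_conjTranspose {m : ℕ} (A : Matrix (Fin (m + 1)) (Fin (m + 1)) ℝ) :
    (A.map Complex.ofReal)ᴴ = (A.map Complex.ofReal)ᵀ := by
  ext i j; simp [conjTranspose_apply]

/-- The middle row, when present, belongs to the eigenvalue 1 whatever ε is. The hypotheses `ha` and
`hb` ask that it lie in the first block for ε = 1 and in the second for ε = -1. -/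
theorem splitMat_diagonalizes {a b m : ℕ} (h : a + b = m + 1) {ε : ℝ} (hε : ε * ε = 1)
    (ha : ∀ i : Fin (m + 1), (i : ℕ) < a →
      (if 2 * (i : ℕ) = m then 1 else if 2 * (i : ℕ) < m then ε else -ε) = ε)
    (hb : ∀ i : Fin (m + 1), a ≤ (i : ℕ) →
      (if 2 * (i : ℕ) = m then 1 else if 2 * (i : ℕ) < m then ε else -ε) = -ε) :
    Diagonalizes h ((splitMat m ε).map Complex.ofReal) ε := by
  have h1 : (splitMat m ε).map Complex.ofReal * ((splitMat m ε).map Complex.ofReal)ᴴ = 1 := by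
    rw [ofReal_map_conjTranspose, ← transpose_map]
    exact (Matrix.map_mul (f := Complex.ofRealHom)).symm.trans (by
      rw [splitMat_mul_transpose m hε]
      exact Matrix.map_one _ (map_zero _) (map_one _))
  refine ⟨h1, ?_, fun h0 => ?_⟩
  · set d : Fin (m + 1) → ℂ := fun i =>
      ((if 2 * (i : ℕ) = m then 1 else if 2 * (i : ℕ) < m then ε else -ε : ℝ) : ℂ) with hd
    have h2 : (splitMat m ε).map Complex.ofReal * SphericalSU2.flip m =
        diagonal d * (splitMat m ε).map Complex.ofReal := by
      ext i j
      rw [mul_flip_apply, diagonal_mul, Matrix.map_apply, Matrix.map_apply,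
        splitMat_mul_rev m hε, Complex.ofReal_mul]
    rw [h2, mul_assoc, h1, mul_one]
    ext i j
    rcases i with i | i <;> rcases j with j | j
    · have := ha (blockEquiv h (Sum.inl i)) (by simp [blockEquiv])
      simp [inBlocks, diagonal_apply, Matrix.one_apply, hd, this]
    · simp [inBlocks]
    · simp [inBlocks]
    · have := hb (blockEquiv h (Sum.inr i)) (by simp [blockEquiv])
      simp only [inBlocks, submatrix_apply, diagonal_apply, EmbeddingLike.apply_eq_iff_eq, hd, this]
      by_cases hij : i = j <;> simp [hij]
  · rw [Complex.ofReal_eq_zero] at h0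
    simp [h0] at hε

theorem Y_diagonalizes (m : ℕ) : Diagonalizes (size_one_add_two m) (Y m) 1 := by
  have := splitMat_diagonalizes (size_one_add_two m) (ε := 1) (by norm_num)
    (fun i hi => by split_ifs <;> first | rfl | omega)
    (fun i hi => by rw [if_neg (by omega), if_neg (by omega)])
  rwa [Complex.ofReal_one] at this

theorem Yl_conjTranspose (m : ℕ) : (Yl m)ᴴ = (Yl m)ᵀ := by
  rw [Yl_eq, ← transpose_map, ofReal_map_conjTranspose]

theorem Y_conjTranspose (m : ℕ) : (Y m)ᴴ = (Y m)ᵀ := ofReal_map_conjTranspose _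

theorem Yl_transpose_diagonalizes (m : ℕ) :
    Diagonalizes (size_minus_add_plus m) (Yl m)ᵀ (-1) := by
  have := splitMat_diagonalizes (size_minus_add_plus m) (ε := -1) (by norm_num)
    (fun i hi => by rw [if_neg (by omega), if_pos (by omega)])
    (fun i hi => by
      split_ifs
      · norm_num
      · omega
      · rfl)
  rw [Yl_eq, transpose_transpose]
  simpa using this

theorem Yl_transpose_mul (m : ℕ) : (Yl m)ᵀ * Yl m = 1 := by
  have := (Yl_transpose_diagonalizes m).mul_conjTranspose
  rwa [← Yl_conjTranspose, conjTranspose_conjTranspose, Yl_conjTranspose] at this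

theorem Yl_inv (m : ℕ) : (Yl m)⁻¹ = (Yl m)ᵀ := inv_eq_left_inv (Yl_transpose_mul m)

/-! ### Matrices commuting with J, and the commutant of the blocks of the Gram matrix. -/

section Diagonalizes
variable {a b m : ℕ} {h : a + b = m + 1} {Z : Matrix (Fin (m + 1)) (Fin (m + 1)) ℂ} {ε : ℂ}

theorem Diagonalizes.conjTranspose_mul (hZ : Diagonalizes h Z ε) : Zᴴ * Z = 1 :=
  mul_eq_one_comm.1 hZ.mul_conjTranspose

theorem Diagonalizes.conj_mul_conj (hZ : Diagonalizes h Z ε)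
    (A B : Matrix (Fin (m + 1)) (Fin (m + 1)) ℂ) :
    Z * A * Zᴴ * (Z * B * Zᴴ) = Z * (A * B) * Zᴴ := by
  calc Z * A * Zᴴ * (Z * B * Zᴴ) = Z * A * (Zᴴ * Z) * B * Zᴴ := by simp only [mul_assoc]
    _ = _ := by rw [hZ.conjTranspose_mul, mul_one]; simp only [mul_assoc]

theorem Diagonalizes.inBlocks_eq (hZ : Diagonalizes h Z ε)
    {A : Matrix (Fin (m + 1)) (Fin (m + 1)) ℂ} (hA : A * SphericalSU2.flip m = SphericalSU2.flip m * A) :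
    inBlocks h (Z * A * Zᴴ) = fromBlocks (inBlocks h (Z * A * Zᴴ)).toBlocks₁₁ 0 0
      (inBlocks h (Z * A * Zᴴ)).toBlocks₂₂ := by
  refine inBlocks_eq_fromBlocks hZ.ne_zero hZ.flip ?_
  rw [hZ.conj_mul_conj, hZ.conj_mul_conj, hA]

/-- The commutant of the blocks of the Gram matrix is trivial. -/
theorem Diagonalizes.commutant (hZ : Diagonalizes h Z ε) (E₁ : Matrix (Fin a) (Fin a) ℂ)
    (E₂ : Matrix (Fin b) (Fin b) ℂ)
    (h₁ : ∀ t ∈ Ioo 0 Real.pi, E₁ * (inBlocks h (Z * gram m t * Zᴴ)).toBlocks₁₁ =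
      (inBlocks h (Z * gram m t * Zᴴ)).toBlocks₁₁ * E₁ᴴ)
    (h₂ : ∀ t ∈ Ioo 0 Real.pi, E₂ * (inBlocks h (Z * gram m t * Zᴴ)).toBlocks₂₂ =
      (inBlocks h (Z * gram m t * Zᴴ)).toBlocks₂₂ * E₂ᴴ) :
    (∃ c : ℂ, E₁ = c • 1) ∧ ∃ c : ℂ, E₂ = c • 1 := by
  -- The two block conditions are glued into one matrix T, which commutes with J because S is block
  -- diagonal.
  set S := ofBlocks h (fromBlocks E₁ 0 0 E₂) with hS
  set T := Zᴴ * S * Z with hT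
  have hZT : Z * T * Zᴴ = S := by
    calc Z * T * Zᴴ = (Z * Zᴴ) * S * (Z * Zᴴ) := by simp only [hT, mul_assoc]
      _ = S := by rw [hZ.mul_conjTranspose, one_mul, mul_one]
  have hSb : inBlocks h S = fromBlocks E₁ 0 0 E₂ := inBlocks_ofBlocks h _
  clear_value T S
  have inj : ∀ A B : Matrix (Fin (m + 1)) (Fin (m + 1)) ℂ,
      inBlocks h (Z * A * Zᴴ) = inBlocks h (Z * B * Zᴴ) → A = B := by
    intro A B hAB
    have := congrArg (ofBlocks h) hAB
    rw [ofBlocks_inBlocks, ofBlocks_inBlocks] at this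
    have h3 := congrArg (fun X => Zᴴ * X * Z) this
    have h4 : ∀ A : Matrix (Fin (m + 1)) (Fin (m + 1)) ℂ, Zᴴ * (Z * A * Zᴴ) * Z = A := by
      intro A
      calc Zᴴ * (Z * A * Zᴴ) * Z = (Zᴴ * Z) * A * (Zᴴ * Z) := by simp only [mul_assoc]
        _ = A := by rw [hZ.conjTranspose_mul, one_mul, mul_one]
    simpa only [h4] using h3
  have hTJ : T * SphericalSU2.flip m = SphericalSU2.flip m * T := by
    apply inj
    rw [← hZ.conj_mul_conj, ← hZ.conj_mul_conj, hZT, inBlocks_mul h S, inBlocks_mul h _ S, hSb, hZ.flip,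
      fromBlocks_multiply, fromBlocks_multiply]
    simp
  have hTG : ∀ t ∈ Ioo 0 Real.pi, T * gram m t = gram m t * Tᴴ := by
    intro t ht
    apply inj
    have hZTs : Z * Tᴴ * Zᴴ = Sᴴ := by
      rw [← hZT, Matrix.conjTranspose_mul, Matrix.conjTranspose_mul, conjTranspose_conjTranspose,
        mul_assoc]
    rw [← hZ.conj_mul_conj, ← hZ.conj_mul_conj, hZT, hZTs, inBlocks_mul h S, inBlocks_mul h _ Sᴴ,
      ← inBlocks_conjTranspose, hSb, hZ.inBlocks_eq (gram_comm_flip m t), fromBlocks_conjTranspose,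
      fromBlocks_multiply, fromBlocks_multiply]
    simp [h₁ t ht, h₂ t ht]
  -- J acts by ε on the first block and by -ε on the second, so x + yJ is scalar on each.
  obtain ⟨x, y, hxy⟩ := eq_smul_one_add_smul_flip hTJ hTG
  have : inBlocks h (Z * T * Zᴴ) =
      fromBlocks ((x + y * ε) • 1) 0 0 ((x - y * ε) • 1) := by
    have e : Z * T * Zᴴ = x • 1 + y • (Z * SphericalSU2.flip m * Zᴴ) := by
      rw [hxy, mul_add, add_mul, Matrix.mul_smul, Matrix.smul_mul, mul_one, hZ.mul_conjTranspose,
        Matrix.mul_smul, Matrix.smul_mul]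
    rw [e]
    change x • inBlocks h 1 + y • inBlocks h (Z * SphericalSU2.flip m * Zᴴ) = _
    rw [hZ.flip, inBlocks_one, ← fromBlocks_one, fromBlocks_smul, fromBlocks_smul, fromBlocks_add]
    simp [add_smul, mul_smul, sub_eq_add_neg]
  rw [hZT, hSb, fromBlocks_inj] at this
  exact ⟨⟨_, this.1⟩, ⟨_, this.2.2.2⟩⟩

end Diagonalizes

/-! ### The weights -/

theorem V_eq (m : ℕ) (t : ℝ) : V m t = ((Real.sin t ^ 2 : ℝ) : ℂ) • gram m t := by
  rw [V, abs_of_nonneg (sq_nonneg _)]; rfl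

theorem W_eq (m : ℕ) (x : ℝ) :
    W m x = ((Real.sqrt (1 - x ^ 2) : ℝ) : ℂ) • gram m (Real.arccos x) := by
  rw [W, V_eq, Real.sin_arccos, smul_smul, ← Complex.ofReal_mul]
  congr 2
  -- Where the root is 0 its inverse is 0 too, so both sides vanish; this covers x = ±1.
  by_cases h : Real.sqrt (1 - x ^ 2) = 0
  · simp [h]
  · rw [sq (Real.sqrt _), inv_mul_cancel_left₀ h]

theorem W_comm_flip (m : ℕ) (x : ℝ) : W m x * flip m = flip m * W m x := by
  rw [W_eq, Matrix.smul_mul, gram_comm_flip, Matrix.mul_smul]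

theorem V_comm_flip (m : ℕ) (t : ℝ) : V m t * flip m = flip m * V m t := by
  rw [V_eq, Matrix.smul_mul, gram_comm_flip, Matrix.mul_smul]

/-- This holds also where Φ_0 is singular: the inverse of a product is reversed without any
invertibility assumption. -/
theorem fullQ_comm_flip (m d : ℕ) (t : ℝ) : fullQ m d t * flip m = flip m * fullQ m d t := by
  have hf : (flip m)⁻¹ = flip m := inv_eq_left_inv (flip_mul_flip m)
  have h := congrArg (·⁻¹) (fullSpherical_comm_flip m 0 t)
  simp only [Matrix.mul_inv_rev, hf] at h
  rw [fullQ, mul_assoc, ← h, ← mul_assoc, fullSpherical_comm_flip, mul_assoc]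

theorem continuous_gram_apply (m : ℕ) (i j : Fin (m + 1)) : Continuous fun t => gram m t i j := by
  simp only [gram, Matrix.mul_apply, conjTranspose_apply]
  exact continuous_finsetSum _ fun k _ =>
    (continuous_fullSpherical m 0 i k).mul (continuous_fullSpherical m 0 j k).star

theorem isWeight_W (m : ℕ) : IsWeight (W m) where
  moments k i j := by
    have hc : Continuous fun x : ℝ => (x : ℂ) ^ k * W m x i j := by
      simp only [W_eq, Matrix.smul_apply]
      have := (continuous_gram_apply m i j).comp Real.continuous_arccos
      have h2 : Continuous fun x : ℝ => ((Real.sqrt (1 - x ^ 2) : ℝ) : ℂ) := by fun_prop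
      exact (Complex.continuous_ofReal.pow k).mul (h2.smul this)
    exact (hc.integrableOn_Icc (a := -1) (b := 1)).mono_set Ioo_subset_Icc_self
  posDef := by
    refine (ae_restrict_iff' measurableSet_Ioo).2 (Filter.Eventually.of_forall fun x hx => ?_)
    have hs : 0 < Real.sqrt (1 - x ^ 2) := Real.sqrt_pos.2 (by nlinarith [hx.1, hx.2])
    rw [W_eq]
    refine (gram_posDef m ?_).smul (Complex.zero_lt_real.2 hs)
    rw [Real.sin_arccos]; exact hs.ne'

section
variable {n k : Type*} [Fintype n] [Fintype k] {w : ℝ → Matrix n n ℂ}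

theorem IsWeight.conj (hw : IsWeight w) (Z : Matrix k n ℂ)
    (hZ : Function.Injective Z.vecMul) : IsWeight fun x => Z * w x * Zᴴ where
  moments d i j := by
    simp only [Matrix.mul_apply, Finset.sum_mul, Finset.mul_sum]
    refine integrable_finsetSum _ fun a _ => integrable_finsetSum _ fun b _ => ?_
    have := ((hw.moments d b a).const_mul (Z i b)).mul_const (Zᴴ a j)
    exact this.congr (Filter.Eventually.of_forall fun x => by ring)
  posDef := hw.posDef.mono fun _ hx => hx.mul_mul_conjTranspose_same hZ

theorem IsWeight.submatrix (hw : IsWeight w) {e : k → n} (he : Function.Injective e) :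
    IsWeight fun x => (w x).submatrix e e where
  moments d i j := hw.moments d (e i) (e j)
  posDef := hw.posDef.mono fun _ hx => hx.submatrix he

theorem integral_mul_mul_eq_zero {n k : Type*} [Fintype n] {F : ℝ → Matrix n n ℂ} {a b : ℝ}
    (hF : ∀ i j, IntervalIntegrable (fun x => F x i j) volume a b)
    (h0 : ∀ i j, ∫ x in a..b, F x i j = 0) (A : Matrix k n ℂ) (B : Matrix n k ℂ) (i j : k) :
    IntervalIntegrable (fun x => (A * F x * B) i j) volume a b ∧
      ∫ x in a..b, (A * F x * B) i j = 0 := by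
  have hi : ∀ p q, IntervalIntegrable (fun x => A i q * F x q p * B p j) volume a b :=
    fun p q => ((hF q p).const_mul _).mul_const _
  have e : (fun x => (A * F x * B) i j) = fun x => ∑ p, ∑ q, A i q * F x q p * B p j := by
    funext x; simp only [Matrix.mul_apply, Finset.sum_mul]
  have hs : ∀ p, IntervalIntegrable (fun x => ∑ q, A i q * F x q p * B p j) volume a b :=
    fun p => by simpa only [Finset.sum_fn] using IntervalIntegrable.sum Finset.univ (fun q _ => hi p q)
  rw [e]
  refine ⟨by simpa only [Finset.sum_fn] using IntervalIntegrable.sum Finset.univ (fun p _ => hs p), ?_⟩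
  rw [intervalIntegral.integral_finsetSum fun p _ => hs p]
  refine Finset.sum_eq_zero fun p _ => ?_
  rw [intervalIntegral.integral_finsetSum fun q _ => hi p q]
  refine Finset.sum_eq_zero fun q _ => ?_
  rw [intervalIntegral.integral_mul_const, intervalIntegral.integral_const_mul, h0]
  simp

end

theorem Wtilde_eq_conjTranspose (m : ℕ) (x : ℝ) :
    Wtilde m x = inBlocks (size_one_add_two m) (Y m * W m x * (Y m)ᴴ) := by
  rw [Wtilde, Y_conjTranspose]

theorem Wtilde_eq_fromBlocks (m : ℕ) (x : ℝ) :
    Wtilde m x = fromBlocks (W1 m x) 0 0 (W2 m x) := by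
  rw [W1, W2, Wtilde_eq_conjTranspose]
  exact (Y_diagonalizes m).inBlocks_eq (W_comm_flip m x)

theorem isWeight_Wtilde (m : ℕ) : IsWeight (Wtilde m) := by
  have hinj : Function.Injective (Y m).vecMul := fun u v huv => by
    have := congrArg (· ᵥ* (Y m)ᴴ) huv
    simpa [Matrix.vecMul_vecMul, (Y_diagonalizes m).mul_conjTranspose] using this
  have := ((isWeight_W m).conj (Y m) hinj).submatrix (blockEquiv (size_one_add_two m)).injective
  rw [Y_conjTranspose] at this
  exact this

theorem isWeight_W1 (m : ℕ) : IsWeight (W1 m) :=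
  (isWeight_Wtilde m).submatrix Sum.inl_injective

theorem isWeight_W2 (m : ℕ) : IsWeight (W2 m) :=
  (isWeight_Wtilde m).submatrix Sum.inr_injective

theorem inBlocks_conj_smul {a b m : ℕ} (h : a + b = m + 1)
    (Z A : Matrix (Fin (m + 1)) (Fin (m + 1)) ℂ) (c : ℂ) :
    inBlocks h (Z * (c • A) * Zᴴ) = c • inBlocks h (Z * A * Zᴴ) := by
  rw [Matrix.mul_smul, Matrix.smul_mul, inBlocks_smul]

theorem Vconj_eq_smul (m : ℕ) (t : ℝ) : Vconj m t = ((Real.sin t ^ 2 : ℝ) : ℂ) •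
    inBlocks (size_minus_add_plus m) ((Yl m)ᵀ * gram m t * ((Yl m)ᵀ)ᴴ) := by
  rw [Vconj, Yl_inv, V_eq, ← inBlocks_conj_smul, ← Yl_conjTranspose, conjTranspose_conjTranspose]

theorem Vconj_eq_fromBlocks (m : ℕ) (t : ℝ) :
    Vconj m t = fromBlocks (Vminus m t) 0 0 (Vplus m t) := by
  have := (Yl_transpose_diagonalizes m).inBlocks_eq (V_comm_flip m t)
  rw [← Yl_conjTranspose, conjTranspose_conjTranspose, Yl_conjTranspose, ← Yl_inv] at this
  exact this

theorem Qconj_eq_fromBlocks (m d : ℕ) (t : ℝ) :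
    Qconj m d t = fromBlocks (Qminus m d t) 0 0 (Qplus m d t) := by
  have := (Yl_transpose_diagonalizes m).inBlocks_eq (fullQ_comm_flip m d t)
  rw [← Yl_conjTranspose, conjTranspose_conjTranspose, Yl_conjTranspose, ← Yl_inv] at this
  exact this

/-! ### No further reduction -/

theorem mul_eq_mul_conjTranspose_of_smul {N : ℕ} {c : ℂ} (hc : c ≠ 0)
    {E G : Matrix (Fin N) (Fin N) ℂ} (h : E * (c • G) = (c • G) * Eᴴ) : E * G = G * Eᴴ := by
  rw [Matrix.mul_smul, Matrix.smul_mul] at h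
  exact smul_right_injective _ hc h

theorem Wtilde_cos (m : ℕ) {t : ℝ} (ht : t ∈ Ioo 0 Real.pi) :
    Wtilde m (Real.cos t) = ((Real.sin t : ℝ) : ℂ) •
      inBlocks (size_one_add_two m) (Y m * gram m t * (Y m)ᴴ) := by
  have hs := Real.sin_pos_of_mem_Ioo ht
  rw [Wtilde_eq_conjTranspose, W_eq, inBlocks_conj_smul, Real.arccos_cos ht.1.le ht.2.le,
    ← Real.sin_sq, Real.sqrt_sq hs.le]

theorem cos_mem_Ioo {t : ℝ} (ht : t ∈ Ioo 0 Real.pi) : Real.cos t ∈ Ioo (-1 : ℝ) 1 := by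
  have hs := Real.sin_pos_of_mem_Ioo ht
  have := Real.sin_sq_add_cos_sq t
  constructor <;> nlinarith [sq_nonneg (Real.cos t + 1), sq_nonneg (Real.cos t - 1)]

/-- The other block is filled with 0, which satisfies its commutation condition trivially; x = cos t
transports the condition from (-1, 1) to (0, π). -/
theorem not_reduces_W1 (m : ℕ) : ¬ Reduces (Ioo (-1) 1) (W1 m) := by
  refine not_reduces fun E hE => ((Y_diagonalizes m).commutant E 0 (fun t ht => ?_) (by simp)).1
  refine mul_eq_mul_conjTranspose_of_smul
    (c := (Real.sin t : ℝ)) (Complex.ofReal_ne_zero.2 (Real.sin_pos_of_mem_Ioo ht).ne') ?_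
  have := hE _ (cos_mem_Ioo ht)
  rwa [W1, Wtilde_cos m ht] at this

theorem not_reduces_W2 (m : ℕ) : ¬ Reduces (Ioo (-1) 1) (W2 m) := by
  refine not_reduces fun E hE => ((Y_diagonalizes m).commutant 0 E (by simp) (fun t ht => ?_)).2
  refine mul_eq_mul_conjTranspose_of_smul
    (c := (Real.sin t : ℝ)) (Complex.ofReal_ne_zero.2 (Real.sin_pos_of_mem_Ioo ht).ne') ?_
  have := hE _ (cos_mem_Ioo ht)
  rwa [W2, Wtilde_cos m ht] at this

theorem sin_sq_ne_zero {t : ℝ} (ht : t ∈ Ioo 0 Real.pi) : ((Real.sin t ^ 2 : ℝ) : ℂ) ≠ 0 :=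
  Complex.ofReal_ne_zero.2 (pow_pos (Real.sin_pos_of_mem_Ioo ht) 2).ne'

theorem not_reduces_Vminus (m : ℕ) : ¬ Reduces univ (Vminus m) := by
  refine not_reduces fun E hE =>
    ((Yl_transpose_diagonalizes m).commutant E 0 (fun t ht => ?_) (by simp)).1
  refine mul_eq_mul_conjTranspose_of_smul (sin_sq_ne_zero ht) ?_
  have := hE t (mem_univ t)
  rwa [Vminus, Vconj_eq_smul] at this

theorem not_reduces_Vplus (m : ℕ) : ¬ Reduces univ (Vplus m) := by
  refine not_reduces fun E hE =>
    ((Yl_transpose_diagonalizes m).commutant 0 E (by simp) (fun t ht => ?_)).2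
  refine mul_eq_mul_conjTranspose_of_smul (sin_sq_ne_zero ht) ?_
  have := hE t (mem_univ t)
  rwa [Vplus, Vconj_eq_smul] at this

/-! ### Orthogonality over the group -/

/-- The inverses of Φ_0 cancel against V where sin t ≠ 0; elsewhere the factor sin² t kills both
sides. -/
theorem fullQ_mul_V_mul (m d e : ℕ) (t : ℝ) : fullQ m d t * V m t * (fullQ m e t)ᴴ =
    ((Real.sin t : ℝ) : ℂ) ^ 2 •
      (fullSpherical m d (aElt t) * (fullSpherical m e (aElt t))ᴴ) := by
  rw [V_eq, Matrix.mul_smul, Matrix.smul_mul, Complex.ofReal_pow]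
  by_cases ht : Real.sin t = 0
  · simp [ht]
  congr 1
  have hu := (Matrix.isUnit_iff_isUnit_det _).1 (isUnit_fullSpherical_zero m ht)
  rw [fullQ, fullQ, gram, Matrix.conjTranspose_mul]
  generalize fullSpherical m 0 (aElt t) = P at hu ⊢
  have h1 : Pᴴ * (P⁻¹)ᴴ = 1 := by
    rw [← Matrix.conjTranspose_mul, nonsing_inv_mul _ hu, conjTranspose_one]
  calc _ = fullSpherical m d (aElt t) * (P⁻¹ * P) * (Pᴴ * (P⁻¹)ᴴ) *
        (fullSpherical m e (aElt t))ᴴ := by simp only [mul_assoc]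
    _ = _ := by rw [h1, nonsing_inv_mul _ hu, mul_one, mul_one]

theorem Qconj_mul_Vconj_mul (m d e : ℕ) (t : ℝ) : Qconj m d t * Vconj m t * (Qconj m e t)ᴴ =
    inBlocks (size_minus_add_plus m) ((Yl m)ᵀ * (((Real.sin t : ℝ) : ℂ) ^ 2 •
      (fullSpherical m d (aElt t) * (fullSpherical m e (aElt t))ᴴ)) * Yl m) := by
  have h1 : Yl m * (Yl m)ᵀ = 1 := mul_eq_one_comm.1 (Yl_transpose_mul m)
  have h2 : ((Yl m)ᵀ)ᴴ = Yl m := by rw [← Yl_conjTranspose, conjTranspose_conjTranspose]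
  rw [Qconj, Vconj, Qconj, inBlocks_conjTranspose, ← inBlocks_mul, ← inBlocks_mul, Yl_inv,
    Matrix.conjTranspose_mul, Matrix.conjTranspose_mul, h2, Yl_conjTranspose, ← fullQ_mul_V_mul]
  congr 1
  calc _ = (Yl m)ᵀ * fullQ m d t * (Yl m * (Yl m)ᵀ) * V m t * (Yl m * (Yl m)ᵀ) *
        (fullQ m e t)ᴴ * Yl m := by simp only [mul_assoc]
    _ = _ := by rw [h1, mul_one, mul_one]; simp only [mul_assoc]

theorem integral_Qconj {m d e : ℕ} (hde : d ≠ e)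
    (i j : Fin ((m + 1) / 2) ⊕ Fin (m / 2 + 1)) :
    IntervalIntegrable (fun t => (Qconj m d t * Vconj m t * (Qconj m e t)ᴴ) i j) volume 0
        (4 * Real.pi) ∧
      ∫ t in (0 : ℝ)..(4 * Real.pi), (Qconj m d t * Vconj m t * (Qconj m e t)ᴴ) i j = 0 := by
  simp only [Qconj_mul_Vconj_mul]
  refine integral_mul_mul_eq_zero (fun p q => Continuous.intervalIntegrable ?_ _ _)
    (fun p q => integral_fullSpherical_eq_zero m hde p q) (Yl m)ᵀ (Yl m) _ _
  simp only [Matrix.mul_apply, conjTranspose_apply]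
  exact ((Complex.continuous_ofReal.comp Real.continuous_sin).pow 2).smul
    (continuous_finsetSum _ fun k _ =>
      (continuous_fullSpherical m d p k).mul (continuous_fullSpherical m e q k).star)

theorem Qconj_mul_Vconj_mul_eq_fromBlocks (m d e : ℕ) (t : ℝ) :
    Qconj m d t * Vconj m t * (Qconj m e t)ᴴ =
      fromBlocks (Qminus m d t * Vminus m t * (Qminus m e t)ᴴ) 0 0
        (Qplus m d t * Vplus m t * (Qplus m e t)ᴴ) := by
  rw [Qconj_eq_fromBlocks, Vconj_eq_fromBlocks, Qconj_eq_fromBlocks, fromBlocks_conjTranspose,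
    fromBlocks_multiply, fromBlocks_multiply]
  simp

theorem orthogonalOnA_minus (m : ℕ) : OrthogonalOnA (Vminus m) (Qminus m) := fun d e hde i j => by
  have := integral_Qconj (m := m) hde (Sum.inl i) (Sum.inl j)
  simpa only [Qconj_mul_Vconj_mul_eq_fromBlocks, fromBlocks_apply₁₁] using this

theorem orthogonalOnA_plus (m : ℕ) : OrthogonalOnA (Vplus m) (Qplus m) := fun d e hde i j => by
  have := integral_Qconj (m := m) hde (Sum.inr i) (Sum.inr j)
  simpa only [Qconj_mul_Vconj_mul_eq_fromBlocks, fromBlocks_apply₂₂] using this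

/-! ### Orthogonal polynomials for a block diagonal weight -/

theorem evalAt_fromBlocks {n k : Type*} (P : Matrix n n (Polynomial ℂ))
    (Q : Matrix k k (Polynomial ℂ)) (x : ℝ) :
    evalAt (fromBlocks P 0 0 Q) x = fromBlocks (evalAt P x) 0 0 (evalAt Q x) := by
  simp [evalAt, fromBlocks_map, Matrix.map_zero]

theorem IsMonicOPS.fromBlocks {n k : Type*} [Fintype n] [Fintype k] [DecidableEq n] [DecidableEq k]
    {w : ℝ → Matrix n n ℂ} {v : ℝ → Matrix k k ℂ} {P : ℕ → Matrix n n (Polynomial ℂ)}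
    {Q : ℕ → Matrix k k (Polynomial ℂ)} (hP : IsMonicOPS w P) (hQ : IsMonicOPS v Q) :
    IsMonicOPS (fun x => Matrix.fromBlocks (w x) 0 0 (v x))
      fun d => Matrix.fromBlocks (P d) 0 0 (Q d) where
  natDegree_le d i j := by
    rcases i with i | i <;> rcases j with j | j
    · exact hP.natDegree_le d i j
    · simp
    · simp
    · exact hQ.natDegree_le d i j
  leadingCoeff d := by
    rw [fromBlocks_map, hP.leadingCoeff, hQ.leadingCoeff, ← fromBlocks_one]
    congr 1
  orthogonal d e hde := by
    have h1 := hP.orthogonal d e hde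
    have h2 := hQ.orthogonal d e hde
    ext i j
    simp only [pairing, evalAt_fromBlocks, fromBlocks_conjTranspose, fromBlocks_multiply]
    rcases i with i | i <;> rcases j with j | j
    · simpa [pairing] using congrFun (congrFun h1 i) j
    · simp
    · simp
    · simpa [pairing] using congrFun (congrFun h2 i) j

/-- Leaving f abstract serves both evaluation at a point and extraction of a coefficient. -/
theorem map_C_mul_map {m : ℕ} (A B : Matrix (Fin (m + 1)) (Fin (m + 1)) ℂ)
    (P : Matrix (Fin (m + 1)) (Fin (m + 1)) (Polynomial ℂ)) (f : Polynomial ℂ → ℂ)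
    (hf : ∀ (a b : ℂ) (p : Polynomial ℂ), f (Polynomial.C a * p * Polynomial.C b) = a * f p * b)
    (hadd : ∀ (s : Finset (Fin (m + 1))) (g : Fin (m + 1) → Polynomial ℂ),
      f (∑ i ∈ s, g i) = ∑ i ∈ s, f (g i)) :
    (A.map Polynomial.C * P * B.map Polynomial.C).map f = A * P.map f * B := by
  ext i j
  simp only [Matrix.map_apply, Matrix.mul_apply, Finset.sum_mul, hadd, hf]

theorem evalAt_Pconj (m : ℕ) (P : Matrix (Fin (m + 1)) (Fin (m + 1)) (Polynomial ℂ)) (x : ℝ) :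
    evalAt (Pconj m P) x = inBlocks (size_one_add_two m) (Y m * evalAt P x * (Y m)ᵀ) :=
  congrArg (inBlocks (size_one_add_two m)) (map_C_mul_map (Y m) (Y m)ᵀ P (Polynomial.eval (x : ℂ))
    (fun a b p => by simp) (fun s g => Polynomial.eval_finsetSum s g _))

/-- Y is constant and orthogonal: it preserves the leading coefficient 1, and the inner factors YᵗY
cancel in the pairing. -/
theorem isMonicOPS_Pconj {m : ℕ} {P : ℕ → Matrix (Fin (m + 1)) (Fin (m + 1)) (Polynomial ℂ)}
    (hP : IsMonicOPS (W m) P) : IsMonicOPS (Wtilde m) fun d => Pconj m (P d) where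
  natDegree_le d i j := by
    simp only [Pconj, inBlocks, submatrix_apply, Matrix.mul_apply, Finset.sum_mul, Matrix.map_apply]
    refine Polynomial.natDegree_sum_le_of_forall_le _ _ fun a _ =>
      Polynomial.natDegree_sum_le_of_forall_le _ _ fun b _ => ?_
    exact (Polynomial.natDegree_mul_C_le _ _).trans
      ((Polynomial.natDegree_C_mul_le _ _).trans (hP.natDegree_le d _ _))
  leadingCoeff d := by
    have h := map_C_mul_map (Y m) (Y m)ᵀ (P d) (fun p => p.coeff d) (fun a b p => by simp)
      (fun s g => Polynomial.finsetSum_coeff s g d)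
    rw [hP.leadingCoeff, mul_one, ← Y_conjTranspose,
      (Y_diagonalizes m).mul_conjTranspose, Y_conjTranspose] at h
    exact (congrArg (inBlocks (size_one_add_two m)) h).trans (inBlocks_one _)
  orthogonal d e hde := by
    ext i j
    have h2 : ((Y m)ᵀ)ᴴ = Y m := by rw [← Y_conjTranspose, conjTranspose_conjTranspose]
    have h1 : (Y m)ᵀ * Y m = 1 := by
      rw [← Y_conjTranspose]; exact (Y_diagonalizes m).conjTranspose_mul
    have key : ∀ x, evalAt (Pconj m (P d)) x * Wtilde m x * (evalAt (Pconj m (P e)) x)ᴴ =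
        inBlocks (size_one_add_two m)
          (Y m * (evalAt (P d) x * W m x * (evalAt (P e) x)ᴴ) * (Y m)ᵀ) := fun x => by
      rw [evalAt_Pconj, evalAt_Pconj, Wtilde, inBlocks_conjTranspose, ← inBlocks_mul,
        ← inBlocks_mul, Matrix.conjTranspose_mul, Matrix.conjTranspose_mul, h2, Y_conjTranspose]
      congr 1
      calc _ = Y m * evalAt (P d) x * ((Y m)ᵀ * Y m) * W m x * ((Y m)ᵀ * Y m) *
            (evalAt (P e) x)ᴴ * (Y m)ᵀ := by simp only [mul_assoc]
        _ = _ := by rw [h1, mul_one, mul_one]; simp only [mul_assoc]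
    simp only [pairing, key]
    exact (integral_mul_mul_eq_zero
      (fun p q => (isWeight_W m).intervalIntegrable_rowVal (P d p) (P e q))
      (fun p q => congrFun (congrFun (hP.orthogonal d e hde) p) q) (Y m) (Y m)ᵀ _ _).2

theorem isMonicOPS_Wtilde {m : ℕ} {P₁ : ℕ → Matrix (Fin (m / 2 + 1)) (Fin (m / 2 + 1)) (Polynomial ℂ)}
    {P₂ : ℕ → Matrix (Fin ((m + 1) / 2)) (Fin ((m + 1) / 2)) (Polynomial ℂ)}
    (h₁ : IsMonicOPS (W1 m) P₁) (h₂ : IsMonicOPS (W2 m) P₂) :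
    IsMonicOPS (Wtilde m) fun d => fromBlocks (P₁ d) 0 0 (P₂ d) := by
  rw [funext (Wtilde_eq_fromBlocks m)]
  exact h₁.fromBlocks h₂

/-- Both sides are monic orthogonal sequences for W̃, so uniqueness identifies them and the
conjugated polynomials are block diagonal. -/
theorem exists_Pconj_eq_fromBlocks {m : ℕ}
    {P : ℕ → Matrix (Fin (m + 1)) (Fin (m + 1)) (Polynomial ℂ)} (hP : IsMonicOPS (W m) P) :
    ∃ P₁ P₂, IsMonicOPS (W1 m) P₁ ∧ IsMonicOPS (W2 m) P₂ ∧
      ∀ d, Pconj m (P d) = fromBlocks (P₁ d) 0 0 (P₂ d) := by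
  obtain ⟨P₁, h₁, -⟩ := (isWeight_W1 m).existsUnique_isMonicOPS
  obtain ⟨P₂, h₂, -⟩ := (isWeight_W2 m).existsUnique_isMonicOPS
  exact ⟨P₁, P₂, h₁, h₂, congrFun
    (IsMonicOPS.unique (isWeight_Wtilde m) (isMonicOPS_Pconj hP) (isMonicOPS_Wtilde h₁ h₂))⟩

end

end SphericalSU2

/-! ### The theorem. -/

theorem mainTheorem3 (m : ℕ) :
    -- the weight `W` and the conjugation by the orthogonal matrix `Y`
    (IsWeight (W m) ∧ Y m * (Y m)ᵀ = 1 ∧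
      (∀ x ∈ Set.Icc (-1 : ℝ) 1, Wtilde m x = Matrix.fromBlocks (W1 m x) 0 0 (W2 m x)) ∧
      IsWeight (W1 m) ∧ IsWeight (W2 m)) ∧
    -- the monic orthogonal polynomials
    ((∃! P, IsMonicOPS (W m) P) ∧
      (∀ P₁ P₂, IsMonicOPS (W1 m) P₁ → IsMonicOPS (W2 m) P₂ →
        IsMonicOPS (Wtilde m) (fun d => Matrix.fromBlocks (P₁ d) 0 0 (P₂ d))) ∧
      (∀ P, IsMonicOPS (W m) P → ∃ P₁ P₂, IsMonicOPS (W1 m) P₁ ∧ IsMonicOPS (W2 m) P₂ ∧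
        ∀ d, Pconj m (P d) = Matrix.fromBlocks (P₁ d) 0 0 (P₂ d))) ∧
    -- no further reduction of the blocks of `W`
    (¬ Reduces (Set.Ioo (-1) 1) (W1 m) ∧ ¬ Reduces (Set.Ioo (-1) 1) (W2 m)) ∧
    -- the weight `V` and the full spherical polynomials `Q_d` on `A_*`
    ((Yl m)ᵀ * Yl m = 1 ∧
      (∀ t, Vconj m t = Matrix.fromBlocks (Vminus m t) 0 0 (Vplus m t)) ∧
      (∀ d t, Real.sin t ≠ 0 →
        Qconj m d t = Matrix.fromBlocks (Qminus m d t) 0 0 (Qplus m d t)) ∧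
      OrthogonalOnA (Vminus m) (Qminus m) ∧ OrthogonalOnA (Vplus m) (Qplus m) ∧
      ¬ Reduces Set.univ (Vminus m) ∧ ¬ Reduces Set.univ (Vplus m)) :=
  ⟨⟨isWeight_W m, by rw [← Y_conjTranspose]; exact (Y_diagonalizes m).mul_conjTranspose,
      fun x _ => Wtilde_eq_fromBlocks m x, isWeight_W1 m, isWeight_W2 m⟩,
    ⟨(isWeight_W m).existsUnique_isMonicOPS, fun _ _ h₁ h₂ => isMonicOPS_Wtilde h₁ h₂,
      fun _ hP => exists_Pconj_eq_fromBlocks hP⟩,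
    ⟨not_reduces_W1 m, not_reduces_W2 m⟩,
    Yl_transpose_mul m, Vconj_eq_fromBlocks m, fun d t _ => Qconj_eq_fromBlocks m d t,
    orthogonalOnA_minus m, orthogonalOnA_plus m, not_reduces_Vminus m, not_reduces_Vplus m⟩
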